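/- Let $Q=Q(f,L)\ge 0$, $f,L\ge 0$, be such that $Q,\partial_fQ$ exist and are continuous on $[0,\infty[\times[0,\infty[$, $\partial_f^2Q$ exists and is continuous on $]0,\infty[\times[0,\infty[$, and assume that with constants $C_1,\dots,C_4,F_0>0$ and $0<\mu_1,\mu_2,\mu_3<3/2$, for all $L\ge 0$: (Q1) $Q(f,L)\ge C_1f^{1+1/\mu_1}$ for $f\ge F_0$; (Q2) $Q(f,L)\le C_2f^{1+1/\mu_2}$ for $0\le f\le F_0$; (Q3) $Q(\lambda f,L)\ge\lambda^{1+1/\mu_3}Q(f,L)$ for $f\ge0$, $0\le\lambda\le1$, and, if $\mu_3<1/2$, $Q(f,\cdot)$ is (weakly) decreasing for every $f\ge 0$; (Q4) $\partial_f^2Q(f,L)>0$ for $f>0$, and $\partial_fQ(0,L)=0$; (Q5) $C_3\partial_f^2Q(f,L)\le\partial_f^2Q(\lambda f,L)\le C_4\partial_f^2Q(f,L)$ for all $f>0$ and all $\lambda$ in some neighborhood of $1$ (independent of $f,L$). For $f=f(x,v)$, $x,v\in\mathbb R^3$, let $\rho_f(x)=\int f(x,v)\,dv$, $U_f(x)=-\int\frac{\rho_f(y)}{|x-y|}\,dy$,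 $L=|x\times v|^2$, $$J(f)=\iint Q(f,L)\,dv\,dx+\tfrac12\iint|v|^2f\,dv\,dx,\qquad \mathcal D(f)=J(f)-\tfrac1{8\pi}\int|\nabla U_f|^2\,dx .$$ For $M>0$ let $\mathcal F_M$ be the set of $f\in L^1(\mathbb R^6)$ with $f\ge0$, $\iint f\,dv\,dx=M$, $J(f)<\infty$, that are spherically symmetric, i.e. for every $A\in SO(3)$, $f(Ax,Av)=f(x,v)$ for a.e. $(x,v)$. Let $\mathcal M_M$ be the set of all minimizers of $\mathcal D$ over $\mathcal F_M$. For $f_0\in\mathcal M_M$ put $U_0=U_{f_0}$, $E=\frac12|v|^2+U_0(x)$, $E_0=\frac1M\iint(\partial_fQ(f_0,L)+E)f_0\,dv\,dx$, and $$d(f,f_0)=\iint\bigl[Q(f,L)-Q(f_0,L)+(E-E_0)(f-f_0)\bigr]\,dv\,dx .$$ A classical solution of the Vlasov-Poisson system on $[0,T[$, $T\in\,]0,\infty]$, is a function $f=f(t,x,v)\ge0$ in $C^1([0,T[\times\mathbb R^6)$ such that $\rho_{f(t)}$ and $U_{f(t)}$ exist and are $C^1$ in $(t,x)$, $U_{f(t)}(x)$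 is $C^2$ in $x$ with $D_x^2U_{f(t)}(x)$ continuous in $(t,x)$, $\nabla U_{f(t)}(x)$ is bounded on $[0,t_0]\times\mathbb R^3$ for each $t_0<T$, and $$\partial_tf+v\cdot\nabla_xf-\nabla U_{f(t)}\cdot\nabla_vf=0,\qquad\Delta U_{f(t)}=4\pi\rho_{f(t)} .$$ Then for every $\varepsilon>0$ there is $\delta>0$ such that for every classical solution $f$ on some interval $[0,T[$ with $f(0)\in\mathcal F_M\cap C^1_c(\mathbb R^6)$, $$\inf_{f_0\in\mathcal M_M}\Bigl[d(f(0),f_0)+\tfrac1{8\pi}\|\nabla U_{f(0)}-\nabla U_0\|_2^2\Bigr]<\delta$$ implies $$\inf_{f_0\in\mathcal M_M}\Bigl[d(f(t),f_0)+\tfrac1{8\pi}\|\nabla U_{f(t)}-\nabla U_0\|_2^2\Bigr]<\varepsilon\quad\text{for all }t\in[0,T[ .$$ (No uniqueness of the minimizer is assumed; an infimum over the empty set is $+\infty$.) -/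

import Mathlib

open MeasureTheory Set Filter Topology

noncomputable section

namespace VlasovPoisson

/-- Physical space (and velocity space) with the Euclidean norm. -/
abbrev E3 : Type := EuclideanSpace ℝ (Fin 3)

/-- The squared modulus of angular momentum `|x × v|² = |x|²|v|² - (x · v)²`. -/
def angMom (x v : E3) : ℝ := ‖x‖ ^ 2 * ‖v‖ ^ 2 - (inner ℝ x v) ^ 2

/-- The partial derivative `∂_f Q(f, L)` for `f ≥ 0` (one-sided at `f = 0`). -/
def dQ (Q : ℝ → ℝ → ℝ) (f L : ℝ) : ℝ := derivWithin (fun g => Q g L) (Ici 0) f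

/-- The second partial derivative `∂_f² Q(f, L)`, used only for `f > 0`. -/
def d2Q (Q : ℝ → ℝ → ℝ) (f L : ℝ) : ℝ := deriv (fun g => dQ Q g L) f

/-- The standing assumptions on the Casimir function `Q = Q(f, L)`, `f, L ≥ 0`; the values of
`Q` at negative arguments are irrelevant. -/
structure CasimirAssumptions (Q : ℝ → ℝ → ℝ) (μ₁ μ₂ μ₃ C₁ C₂ C₃ C₄ F₀ : ℝ) : Prop where
  mu1 : 0 < μ₁ ∧ μ₁ < 3 / 2
  mu2 : 0 < μ₂ ∧ μ₂ < 3 / 2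
  mu3 : 0 < μ₃ ∧ μ₃ < 3 / 2
  C1_pos : 0 < C₁
  C2_pos : 0 < C₂
  C3_pos : 0 < C₃
  C4_pos : 0 < C₄
  F0_pos : 0 < F₀
  /-- `Q ∈ C^{1,0}([0,∞[ × [0,∞[)`: `Q` and `∂_f Q` exist and are continuous there. -/
  continuousOn : ContinuousOn (fun p : ℝ × ℝ => Q p.1 p.2) (Ici 0 ×ˢ Ici 0)
  differentiableOn : ∀ L, 0 ≤ L → DifferentiableOn ℝ (fun f => Q f L) (Ici 0)
  continuousOn_dQ : ContinuousOn (fun p : ℝ × ℝ => dQ Q p.1 p.2) (Ici 0 ×ˢ Ici 0)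
  /-- `Q ∈ C^{2,0}(]0,∞[ × [0,∞[)`: `∂_f² Q` exists and is continuous there. -/
  differentiableOn_dQ : ∀ L, 0 ≤ L → DifferentiableOn ℝ (fun f => dQ Q f L) (Ioi 0)
  continuousOn_d2Q : ContinuousOn (fun p : ℝ × ℝ => d2Q Q p.1 p.2) (Ioi 0 ×ˢ Ici 0)
  nonneg : ∀ f L, 0 ≤ f → 0 ≤ L → 0 ≤ Q f L
  q1 : ∀ f L, F₀ ≤ f → 0 ≤ L → C₁ * f ^ (1 + 1 / μ₁) ≤ Q f L
  q2 : ∀ f L, 0 ≤ f → f ≤ F₀ → 0 ≤ L → Q f L ≤ C₂ * f ^ (1 + 1 / μ₂)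
  q3 : ∀ s f L, 0 ≤ s → s ≤ 1 → 0 ≤ f → 0 ≤ L → s ^ (1 + 1 / μ₃) * Q f L ≤ Q (s * f) L
  q3_antitone : μ₃ < 1 / 2 → ∀ f, 0 ≤ f → AntitoneOn (fun L => Q f L) (Ici 0)
  q4 : ∀ f L, 0 < f → 0 ≤ L → 0 < d2Q Q f L
  q4_zero : ∀ L, 0 ≤ L → dQ Q 0 L = 0
  q5 : ∀ᶠ s in 𝓝 (1 : ℝ), ∀ f L, 0 < f → 0 ≤ L →
    C₃ * d2Q Q f L ≤ d2Q Q (s * f) L ∧ d2Q Q (s * f) L ≤ C₄ * d2Q Q f L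

/-- The spatial density `ρ_f(x) = ∫ f(x,v) dv`. -/
def density (f : E3 × E3 → ℝ) (x : E3) : ℝ := ∫ v : E3, f (x, v)

/-- The induced potential `U_f = - (1/|·|) * ρ_f`, which vanishes at spatial infinity. -/
def potential (f : E3 × E3 → ℝ) (x : E3) : ℝ := -∫ y : E3, density f y / ‖x - y‖

/-- The gradient `∇U_f`. For integrable spherically symmetric `f` the potential is continuously
differentiable away from the origin, so that the pointwise gradient is the weak one. -/
def field (f : E3 × E3 → ℝ) (x : E3) : E3 := gradient (potential f) x

/-- The functional `J(f) = ∬ Q(f,L) dv dx + (1/2) ∬ |v|² f dv dx`. -/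
def casimirKinetic (Q : ℝ → ℝ → ℝ) (f : E3 × E3 → ℝ) : ℝ :=
  (∫ z : E3 × E3, Q (f z) (angMom z.1 z.2)) + 1 / 2 * ∫ z : E3 × E3, ‖z.2‖ ^ 2 * f z

/-- The energy-Casimir functional `D(f) = J(f) - (1/8π) ∫ |∇U_f|² dx`. -/
def energyCasimir (Q : ℝ → ℝ → ℝ) (f : E3 × E3 → ℝ) : ℝ :=
  casimirKinetic Q f - 1 / (8 * Real.pi) * ∫ x : E3, ‖field f x‖ ^ 2

/-- Spherical symmetry `f(Ax, Av) = f(x, v)`, `A ∈ SO(3)`, for (classes of) measurable functions: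
for each `A` the identity holds for almost all `(x, v)`. -/
def SphericallySymmetric (f : E3 × E3 → ℝ) : Prop :=
  ∀ A : E3 ≃ₗᵢ[ℝ] E3, LinearMap.det (A.toLinearEquiv : E3 →ₗ[ℝ] E3) = 1 →
    ∀ᵐ z : E3 × E3, f (A z.1, A z.2) = f z

/-- The constraint set `F_M`. As `Q(f,L)` and `|v|² f` are nonnegative, `J(f) < ∞` says that both
are integrable. -/
structure Admissible (Q : ℝ → ℝ → ℝ) (M : ℝ) (f : E3 × E3 → ℝ) : Prop where
  integrable : Integrable f
  nonneg : ∀ᵐ z : E3 × E3, 0 ≤ f z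
  mass : ∫ z : E3 × E3, f z = M
  casimir_finite : Integrable (fun z : E3 × E3 => Q (f z) (angMom z.1 z.2))
  kinetic_finite : Integrable (fun z : E3 × E3 => ‖z.2‖ ^ 2 * f z)
  symmetric : SphericallySymmetric f

/-- The set of all minimizers of the energy-Casimir functional over `F_M`. -/
def minimizers (Q : ℝ → ℝ → ℝ) (M : ℝ) : Set (E3 × E3 → ℝ) :=
  {f₀ | Admissible Q M f₀ ∧ ∀ g, Admissible Q M g → energyCasimir Q f₀ ≤ energyCasimir Q g}

/-- The particle energy `E(x,v) = |v|²/2 + U_{f₀}(x)`. -/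
def particleEnergy (f₀ : E3 × E3 → ℝ) (z : E3 × E3) : ℝ := 1 / 2 * ‖z.2‖ ^ 2 + potential f₀ z.1

/-- The cut-off energy `E₀ = (1/M) ∬ (∂_f Q(f₀,L) + E) f₀ dv dx`. -/
def cutoffEnergy (Q : ℝ → ℝ → ℝ) (M : ℝ) (f₀ : E3 × E3 → ℝ) : ℝ :=
  1 / M * ∫ z : E3 × E3, (dQ Q (f₀ z) (angMom z.1 z.2) + particleEnergy f₀ z) * f₀ z

/-- `d(f,f₀) = ∬ [Q(f,L) - Q(f₀,L) + (E - E₀)(f - f₀)] dv dx`. -/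
def casimirDist (Q : ℝ → ℝ → ℝ) (M : ℝ) (f f₀ : E3 × E3 → ℝ) : ℝ :=
  ∫ z : E3 × E3, (Q (f z) (angMom z.1 z.2) - Q (f₀ z) (angMom z.1 z.2)
    + (particleEnergy f₀ z - cutoffEnergy Q M f₀) * (f z - f₀ z))

/-- `d(f,f₀) + (1/8π) ‖∇U_f - ∇U_{f₀}‖₂²`. -/
def totalDist (Q : ℝ → ℝ → ℝ) (M : ℝ) (f f₀ : E3 × E3 → ℝ) : ℝ :=
  casimirDist Q M f f₀ + 1 / (8 * Real.pi) * ∫ x : E3, ‖field f x - field f₀ x‖ ^ 2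

/-- The infimum of `totalDist` over the set of all minimizers, as an extended real (so that no
convention about empty or unbounded sets of reals enters). -/
def distToMinimizers (Q : ℝ → ℝ → ℝ) (M : ℝ) (f : E3 × E3 → ℝ) : EReal :=
  ⨅ f₀ ∈ minimizers Q M, (totalDist Q M f f₀ : EReal)

/-- The time interval `[0, T[`, where `T = ∞` is allowed. -/
def timeInterval (T : EReal) : Set ℝ := {t | 0 ≤ t ∧ (t : EReal) < T}

/-- Classical solutions `f = f(t,x,v)` of the Vlasov-Poisson system on `[0, T[`. -/
structure IsClassicalSolution (T : EReal) (f : ℝ → E3 × E3 → ℝ) : Prop where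
  nonneg : ∀ t ∈ timeInterval T, ∀ z, 0 ≤ f t z
  contDiffOn : ContDiffOn ℝ 1 (fun p : ℝ × (E3 × E3) => f p.1 p.2) (timeInterval T ×ˢ univ)
  /-- The density and the potential exist and are continuously differentiable, and the potential
  is twice continuously differentiable with respect to `x`. -/
  density_exists : ∀ t ∈ timeInterval T, ∀ x, Integrable (fun v : E3 => f t (x, v))
  potential_exists : ∀ t ∈ timeInterval T, ∀ x,
    Integrable (fun y : E3 => density (f t) y / ‖x - y‖)
  contDiffOn_density :
    ContDiffOn ℝ 1 (fun p : ℝ × E3 => density (f p.1) p.2) (timeInterval T ×ˢ univ)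
  contDiffOn_potential :
    ContDiffOn ℝ 1 (fun p : ℝ × E3 => potential (f p.1) p.2) (timeInterval T ×ˢ univ)
  contDiff_potential : ∀ t ∈ timeInterval T, ContDiff ℝ 2 (potential (f t))
  continuousOn_hessian : ContinuousOn
    (fun p : ℝ × E3 => iteratedFDeriv ℝ 2 (potential (f p.1)) p.2) (timeInterval T ×ˢ univ)
  /-- The field is bounded on compact time intervals. -/
  field_bounded : ∀ t ∈ timeInterval T, ∃ K : ℝ, ∀ s ∈ Icc 0 t, ∀ x, ‖field (f s) x‖ ≤ K
  vlasov : ∀ t ∈ timeInterval T, ∀ x v : E3,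
    derivWithin (fun s => f s (x, v)) (timeInterval T) t
      + inner ℝ v (gradient (fun y => f t (y, v)) x)
      - inner ℝ (field (f t) x) (gradient (fun w => f t (x, w)) v) = 0
  poisson : ∀ t ∈ timeInterval T, ∀ x,
    Laplacian.laplacian (potential (f t)) x = 4 * Real.pi * density (f t) x

end VlasovPoisson

end

/-! Why stability holds. For f and f₀ of equal mass the expansion D(f) − D(f₀) = d(f,f₀) −
(1/8π)‖∇U_f − ∇U_0‖² is exact, because E₀ multiplies a difference of equal masses (`totalDist_eq`).
Thus the quantity in the theorem equals D(f) − D(f₀) + (1/4π)‖∇U_f − ∇U_0‖². If it is small at time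
zero for some minimizer, then D(f(0)) is close to the minimum. Since D is conserved
(`IsClassicalSolution.conservation`), so is D(f(t)) for all t. It remains to show that minimizing
sequences come arbitrarily close to the set of minimizers, which reduces to strong convergence of
the fields (`exists_totalDist_lt`). Argument by contradiction then produces δ (`exists_delta`).

Compactness. By Newton's theorem the field of a symmetric f is m(r)x/r³, where m(r) is the mass in
the ball of radius r, and the field energy is ½∫m²/r² dr. Assumption (Q1) with μ₁ < 3/2 bounds m(r)
near 0 by a power of r with exponent above 1/2. This gives an integrable majorant for m²/r² that
depends only on J and M, and shows that the field energy grows sublinearly in J, so that J is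
bounded on sublevel sets of D. Along a subsequence J and the masses at a dense set of radii
converge. The densities obeying these constraints approximately form decreasing convex sets, because
J is convex; a Komlós-type selection (`exists_tendsto_exp_of_convex`) yields elements of these sets
converging almost everywhere to some g. The masses m pass to the limit, Fatou's lemma controls J,
and D(g) is at most the minimum. Since the minimum is negative by (Q2) (`exists_negative`) and
negative energy can be lowered by adding mass by (Q3) (`exists_lower`), g has the full mass M and is
a minimizer. The original subsequence has the same limiting masses, so its fields converge to that
of g.

Conservation. No characteristic flow is constructed; all statements come from differentiating
integrals over phase space, using that the Vlasov vector field is divergence free. A shrinking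
cut-off shows that supports stay bounded. Spherical symmetry is propagated by a Grönwall estimate
for the L² norm of f − f∘A. The field is then central and L is conserved, which preserves the joint
law of (f, L) and hence the Casimir integral. Energy conservation follows from the symmetry of the
mutual potential energy. -/

open MeasureTheory Set Filter Topology

noncomputable section

namespace VlasovPoisson

open scoped ENNReal NNReal

/-! ### Spherical averages and Newton's theorem -/

/-- Splitting off the first coordinate of `E3`. -/
theorem lintegral_E3 (G : ℝ → ℝ × ℝ → ℝ≥0∞) (hG : Measurable (fun q : ℝ × (ℝ × ℝ) => G q.1 q.2)) :
    ∫⁻ x : E3, G (x 0) (x 1, x 2) = ∫⁻ z : ℝ, ∫⁻ p : ℝ × ℝ, G z p := by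
  have h1 := (PiLp.volume_preserving_ofLp (Fin 3))
  have h2 := volume_preserving_piFinSuccAbove (fun _ : Fin 3 => ℝ) 0
  have h3 := (MeasurePreserving.id (volume : Measure ℝ)).prod (volume_preserving_finTwoArrow ℝ)
  have h4 := (h3.comp h2).comp h1
  have h5 := h4.lintegral_comp hG
  rw [lintegral_prod _ hG.aemeasurable] at h5
  rw [← h5]
  rfl

theorem lintegral_polar (f : ℝ × ℝ → ℝ≥0∞) (hf : Measurable f) :
    ∫⁻ p, f p = ∫⁻ r in Ioi (0:ℝ), ∫⁻ θ in Ioo (-Real.pi) Real.pi,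
      ENNReal.ofReal r * f (r * Real.cos θ, r * Real.sin θ) := by
  rw [← lintegral_comp_polarCoord_symm, polarCoord_target, Measure.volume_eq_prod,
    ← Measure.prod_restrict, lintegral_prod]
  · rfl
  · apply Measurable.aemeasurable
    simp only [polarCoord_symm_apply, smul_eq_mul]
    fun_prop

theorem norm_E3 (x : E3) : ‖x‖ = Real.sqrt ((x 0) ^ 2 + ((x 1) ^ 2 + (x 2) ^ 2)) := by
  rw [EuclideanSpace.norm_eq, Fin.sum_univ_three]
  simp [add_assoc]

theorem lintegral_cos (g : ℝ → ℝ≥0∞) :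
    ∫⁻ θ in Ioo 0 Real.pi, ENNReal.ofReal (Real.sin θ) * g (Real.cos θ)
      = ∫⁻ t in Ioo (-1 : ℝ) 1, g t := by
  have himg : Real.cos '' Ioo 0 Real.pi = Ioo (-1) 1 := by
    apply Subset.antisymm
    · rintro _ ⟨θ, hθ, rfl⟩
      constructor
      · have := Real.strictAntiOn_cos (Ioo_subset_Icc_self hθ) (right_mem_Icc.2 Real.pi_pos.le) hθ.2
        simpa using this
      · have := Real.strictAntiOn_cos (left_mem_Icc.2 Real.pi_pos.le) (Ioo_subset_Icc_self hθ) hθ.1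
        simpa using this
    · intro t ht
      refine ⟨Real.arccos t, ⟨Real.arccos_pos.2 ht.2, ?_⟩, Real.cos_arccos ht.1.le ht.2.le⟩
      refine lt_of_le_of_ne (Real.arccos_le_pi t) ?_
      rw [Ne, Real.arccos_eq_pi]
      exact not_le.2 ht.1
  rw [← himg, lintegral_image_eq_lintegral_abs_deriv_mul measurableSet_Ioo
    (fun x _ => (Real.hasDerivAt_cos x).hasDerivWithinAt)
    (Real.injOn_cos.mono Ioo_subset_Icc_self)]
  refine setLIntegral_congr_fun measurableSet_Ioo fun θ hθ => ?_
  simp [abs_of_pos (Real.sin_pos_of_mem_Ioo hθ)]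

theorem lintegral_sq_Ioo : ∫⁻ r in Ioo (0:ℝ) 1, ENNReal.ofReal (r ^ 2) = ENNReal.ofReal (1 / 3) := by
  rw [← ofReal_integral_eq_lintegral_ofReal]
  · rw [← integral_Ioc_eq_integral_Ioo, ← intervalIntegral.integral_of_le zero_le_one, integral_pow]
    norm_num
  · exact ((continuous_pow 2).integrableOn_Icc (a := (0:ℝ)) (b := 1)).mono_set Ioo_subset_Icc_self
  · exact ae_of_all _ fun r => by positivity

/-- Archimedes' hat-box theorem: the distribution of a coordinate on the sphere is uniform. -/
theorem lintegral_ball_coord (g : ℝ → ℝ≥0∞) (hg : Measurable g) :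
    ∫⁻ x in Metric.ball (0 : E3) 1, g (x 0 / ‖x‖)
      = ENNReal.ofReal (2 * Real.pi / 3) * ∫⁻ t in Ioo (-1 : ℝ) 1, g t := by
  set H : ℝ → ℝ → ℝ≥0∞ := fun z s =>
    (Iio (1:ℝ)).indicator (fun _ => g (z / Real.sqrt (z ^ 2 + s))) (Real.sqrt (z ^ 2 + s)) with hH
  have hHm : Measurable (fun q : ℝ × ℝ => H q.1 q.2) := by
    have : (fun q : ℝ × ℝ => H q.1 q.2) = ({q : ℝ × ℝ | Real.sqrt (q.1 ^ 2 + q.2) < 1}).indicator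
        (fun q => g (q.1 / Real.sqrt (q.1 ^ 2 + q.2))) := by
      ext q; simp only [hH, indicator, mem_Iio, mem_ofPred_eq]
    rw [this]
    refine Measurable.indicator (by fun_prop) ?_
    exact measurableSet_lt (by fun_prop) measurable_const
  have e1 : ∫⁻ x in Metric.ball (0 : E3) 1, g (x 0 / ‖x‖)
      = ∫⁻ x : E3, H (x 0) ((x 1) ^ 2 + (x 2) ^ 2) := by
    rw [← lintegral_indicator measurableSet_ball]
    refine lintegral_congr fun x => ?_
    simp only [hH, ← norm_E3, indicator, Metric.mem_ball, dist_zero_right, mem_Iio]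
  have e2 := lintegral_E3 (fun z p => H z (p.1 ^ 2 + p.2 ^ 2))
    (hHm.comp (by fun_prop : Measurable fun q : ℝ × (ℝ × ℝ) => (q.1, q.2.1 ^ 2 + q.2.2 ^ 2)))
  rw [e1, e2]
  have e3 : ∀ z : ℝ, ∫⁻ p : ℝ × ℝ, H z (p.1 ^ 2 + p.2 ^ 2)
      = ∫⁻ s in Ioi (0:ℝ), ENNReal.ofReal (2 * Real.pi) * (ENNReal.ofReal s * H z (s ^ 2)) := by
    intro z
    rw [lintegral_polar (fun p => H z (p.1 ^ 2 + p.2 ^ 2)) (hHm.comp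
      (by fun_prop : Measurable fun q : ℝ × ℝ => (z, q.1 ^ 2 + q.2 ^ 2)))]
    refine lintegral_congr fun r => ?_
    have : ∀ θ : ℝ, (r * Real.cos θ) ^ 2 + (r * Real.sin θ) ^ 2 = r ^ 2 := fun θ => by
      linear_combination r ^ 2 * Real.sin_sq_add_cos_sq θ
    simp only [this, lintegral_const, Measure.restrict_apply MeasurableSet.univ, univ_inter,
      Real.volume_Ioo]
    rw [mul_comm]; congr 2; ring
  simp only [e3]
  set K : ℝ × ℝ → ℝ≥0∞ := fun q => (Ioi (0:ℝ)).indicator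
    (fun s => ENNReal.ofReal (2 * Real.pi) * (ENNReal.ofReal s * H q.1 (s ^ 2))) q.2 with hK
  have hKm : Measurable K := by
    have : K = {q : ℝ × ℝ | 0 < q.2}.indicator
      (fun q => ENNReal.ofReal (2 * Real.pi) * (ENNReal.ofReal q.2 * H q.1 (q.2 ^ 2))) := by
      ext q; simp only [hK, indicator, mem_Ioi, mem_ofPred_eq]
    rw [this]
    refine Measurable.indicator ?_ (measurableSet_lt measurable_const measurable_snd)
    have := hHm.comp (by fun_prop : Measurable fun q : ℝ × ℝ => (q.1, q.2 ^ 2))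
    simp only [Function.comp_def] at this
    fun_prop
  have e4 : ∫⁻ z : ℝ, ∫⁻ s in Ioi (0:ℝ), ENNReal.ofReal (2 * Real.pi) * (ENNReal.ofReal s * H z (s ^ 2))
      = ∫⁻ q, K q := by
    rw [Measure.volume_eq_prod, lintegral_prod _ hKm.aemeasurable]
    refine lintegral_congr fun z => ?_
    rw [← lintegral_indicator measurableSet_Ioi]
  rw [e4, lintegral_polar K hKm]
  have e5 : ∀ r ∈ Ioi (0:ℝ), ∫⁻ θ in Ioo (-Real.pi) Real.pi,
      ENNReal.ofReal r * K (r * Real.cos θ, r * Real.sin θ)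
      = (Iio (1:ℝ)).indicator (fun r => ENNReal.ofReal (r ^ 2)) r *
        (ENNReal.ofReal (2 * Real.pi) * ∫⁻ t in Ioo (-1 : ℝ) 1, g t) := by
    intro r hr
    have hr' : 0 < r := hr
    rw [← lintegral_cos, ← lintegral_const_mul _ (by fun_prop), ← lintegral_const_mul _ (by fun_prop),
      ← lintegral_indicator measurableSet_Ioo, ← lintegral_indicator measurableSet_Ioo]
    refine lintegral_congr fun θ => ?_
    by_cases hθ : θ ∈ Ioo (-Real.pi) Real.pi
    · by_cases hθ0 : 0 < θ
      · have hθ' : θ ∈ Ioo 0 Real.pi := ⟨hθ0, hθ.2⟩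
        have hs : 0 < Real.sin θ := Real.sin_pos_of_mem_Ioo ⟨hθ0, hθ.2⟩
        have hrr : Real.sqrt ((r * Real.cos θ) ^ 2 + (r * Real.sin θ) ^ 2) = r := by
          rw [show (r * Real.cos θ) ^ 2 + (r * Real.sin θ) ^ 2 = r ^ 2 by
            linear_combination r ^ 2 * Real.sin_sq_add_cos_sq θ, Real.sqrt_sq hr'.le]
        rw [indicator_of_mem hθ, indicator_of_mem hθ']
        have hHe : H (r * Real.cos θ) ((r * Real.sin θ) ^ 2)
            = (Iio (1:ℝ)).indicator (fun _ => g (r * Real.cos θ / r)) r := by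
          simp only [hH]; rw [hrr]
        simp only [hK]
        rw [indicator_of_mem (show r * Real.sin θ ∈ Ioi (0:ℝ) from mul_pos hr' hs), hHe]
        by_cases h1 : r < 1
        · rw [indicator_of_mem (show r ∈ Iio (1:ℝ) from h1), indicator_of_mem (show r ∈ Iio (1:ℝ) from h1),
            mul_div_cancel_left₀ _ hr'.ne', ENNReal.ofReal_mul hr'.le, sq, ENNReal.ofReal_mul hr'.le]
          ring
        · rw [indicator_of_notMem (show r ∉ Iio (1:ℝ) from h1),
            indicator_of_notMem (show r ∉ Iio (1:ℝ) from h1)]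
          simp
      · have hs : r * Real.sin θ ∉ Ioi (0:ℝ) := not_lt.2 (mul_nonpos_of_nonneg_of_nonpos hr'.le
          (Real.sin_nonpos_of_nonpos_of_neg_pi_le (not_lt.1 hθ0) hθ.1.le))
        rw [indicator_of_mem hθ, indicator_of_notMem (fun h => hθ0 h.1)]
        simp only [hK]
        rw [indicator_of_notMem hs, mul_zero]
    · rw [indicator_of_notMem hθ, indicator_of_notMem]
      exact fun h => hθ ⟨by linarith [h.1, Real.pi_pos], h.2⟩
  rw [setLIntegral_congr_fun measurableSet_Ioi e5, lintegral_mul_const _ ?_, ← lintegral_indicator measurableSet_Ioi]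
  · have : ∀ r : ℝ, (Ioi (0:ℝ)).indicator ((Iio (1:ℝ)).indicator fun r => ENNReal.ofReal (r ^ 2)) r
        = (Ioo (0:ℝ) 1).indicator (fun r => ENNReal.ofReal (r ^ 2)) r := by
      intro r
      rw [indicator_indicator, Ioi_inter_Iio]
    rw [lintegral_congr this, lintegral_indicator measurableSet_Ioo, lintegral_sq_Ioo, ← mul_assoc,
      ← ENNReal.ofReal_mul (by norm_num)]
    congr 2; ring
  · exact Measurable.indicator (by fun_prop) measurableSet_Iio

/-- The reflection exchanging x and y has determinant −1. Composing it with a reflection that fixes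
y restores determinant 1, which is needed because the symmetry assumption concerns SO(3) only. -/
theorem exists_rotation {x y : E3} (h : ‖x‖ = ‖y‖) :
    ∃ A : E3 ≃ₗᵢ[ℝ] E3, LinearMap.det (A.toLinearEquiv : E3 →ₗ[ℝ] E3) = 1 ∧ A x = y := by
  have hdet : ∀ u : E3, u ≠ 0 →
      LinearMap.det (((ℝ ∙ u)ᗮ.reflection.toLinearEquiv : E3 →ₗ[ℝ] E3)) = -1 := by
    intro u hu
    have := (ℝ ∙ u)ᗮ.det_reflection
    rw [Submodule.orthogonal_orthogonal, finrank_span_singleton hu, pow_one] at this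
    exact this
  by_cases hxy : x = y
  · refine ⟨LinearIsometryEquiv.refl ℝ E3, ?_, by simpa using hxy⟩
    exact LinearMap.det_id
  -- The complement of the line through y has dimension at least 2, so it contains a mirror normal u
  -- even when y = 0.
  obtain ⟨u, hu, hu0⟩ : ∃ u ∈ (ℝ ∙ y)ᗮ, u ≠ 0 := by
    apply Submodule.exists_mem_ne_zero_of_ne_bot
    intro hbot
    have h1 := Submodule.finrank_add_finrank_orthogonal (ℝ ∙ y)
    rw [hbot, finrank_bot] at h1
    have h2 := finrank_span_le_card (R := ℝ) ({y} : Set E3)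
    have h3 : Module.finrank ℝ E3 = 3 := by simp
    simp at h2
    omega
  refine ⟨((ℝ ∙ (x - y))ᗮ.reflection).trans ((ℝ ∙ u)ᗮ.reflection), ?_, ?_⟩
  · have : (((ℝ ∙ (x - y))ᗮ.reflection.trans (ℝ ∙ u)ᗮ.reflection).toLinearEquiv : E3 →ₗ[ℝ] E3)
        = ((ℝ ∙ u)ᗮ.reflection.toLinearEquiv : E3 →ₗ[ℝ] E3) ∘ₗ
          ((ℝ ∙ (x - y))ᗮ.reflection.toLinearEquiv : E3 →ₗ[ℝ] E3) := rfl
    rw [this, LinearMap.det_comp, hdet _ hu0, hdet _ (sub_ne_zero.2 hxy)]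
    norm_num
  · rw [LinearIsometryEquiv.trans_apply, Submodule.reflection_sub h,
      Submodule.reflection_mem_subspace_eq_self]
    rw [Submodule.mem_orthogonal_singleton_iff_inner_right] at hu ⊢
    rw [real_inner_comm]; exact hu

/-- The primitive is −√(r² + s² − 2rst)/(rs), whose end values are |r − s| and r + s; it degenerates
at s = 0, which is treated apart. The case s = r is excluded to keep the integrand continuous up to
t = 1. -/
theorem integral_inv_sqrt {r s : ℝ} (hr : 0 < r) (hs : 0 ≤ s) (hrs : s ≠ r) :
    ∫⁻ t in Ioo (-1 : ℝ) 1, ENNReal.ofReal (Real.sqrt (r ^ 2 + s ^ 2 - 2 * r * s * t))⁻¹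
      = ENNReal.ofReal (2 / max r s) := by
  have hpos : ∀ t ∈ Icc (-1 : ℝ) 1, 0 < r ^ 2 + s ^ 2 - 2 * r * s * t := by
    intro t ht
    have h1 : 0 < (r - s) ^ 2 := by
      have : r - s ≠ 0 := sub_ne_zero.2 hrs.symm
      positivity
    nlinarith [mul_nonneg (mul_nonneg hr.le hs) (sub_nonneg.2 ht.2)]
  have hcont : ContinuousOn (fun t : ℝ => (Real.sqrt (r ^ 2 + s ^ 2 - 2 * r * s * t))⁻¹) (Icc (-1) 1) := by
    refine ContinuousOn.inv₀ (by fun_prop) fun t ht => (Real.sqrt_pos.2 (hpos t ht)).ne'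
  rw [← ofReal_integral_eq_lintegral_ofReal (hcont.integrableOn_Icc.mono_set Ioo_subset_Icc_self)
    (ae_of_all _ fun t => by positivity), ← integral_Ioc_eq_integral_Ioo,
    ← intervalIntegral.integral_of_le (by norm_num)]
  congr 1
  rcases hs.eq_or_lt with rfl | hs
  · simp [hr.le]
    rw [show (1:ℝ) + 1 = 2 by norm_num, div_eq_mul_inv]
  have hder : ∀ t ∈ uIcc (-1 : ℝ) 1, HasDerivAt
      (fun t => -(Real.sqrt (r ^ 2 + s ^ 2 - 2 * r * s * t)) / (r * s))
      (Real.sqrt (r ^ 2 + s ^ 2 - 2 * r * s * t))⁻¹ t := by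
    intro t ht
    rw [uIcc_of_le (by norm_num)] at ht
    have h1 : HasDerivAt (fun t => r ^ 2 + s ^ 2 - 2 * r * s * t) (-(2 * r * s)) t := by
      simpa using ((hasDerivAt_id t).const_mul (2 * r * s)).const_sub (r ^ 2 + s ^ 2)
    have h2 := (h1.sqrt (hpos t ht).ne').neg.div_const (r * s)
    have h3 := Real.sqrt_pos.2 (hpos t ht)
    refine h2.congr_deriv ?_
    field_simp
  rw [intervalIntegral.integral_eq_sub_of_hasDerivAt hder
    ((hcont.mono (by rw [uIcc_of_le (by norm_num)])).intervalIntegrable)]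
  have h1 : r ^ 2 + s ^ 2 - 2 * r * s * 1 = (r - s) ^ 2 := by ring
  have h2 : r ^ 2 + s ^ 2 - 2 * r * s * (-1) = (r + s) ^ 2 := by ring
  rw [h1, h2, Real.sqrt_sq_eq_abs, Real.sqrt_sq (by positivity)]
  rcases le_total r s with h | h
  · rw [max_eq_right h, abs_of_nonpos (by linarith)]; field_simp; ring
  · rw [max_eq_left h, abs_of_nonneg (by linarith)]; field_simp; ring

/-- The integrand depends only on the direction of x, so the integral over the ball is a spherical
average weighted by the volume 4π/3. After y is rotated onto the first axis, the law of cosines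
leaves a function of x₀/‖x‖, which is uniformly distributed. -/
theorem lintegral_ball_inv_norm_sub {r : ℝ} (hr : 0 < r) (y : E3) (hy : ‖y‖ ≠ r) :
    ∫⁻ x in Metric.ball (0 : E3) 1, ENNReal.ofReal ‖(r / ‖x‖) • x - y‖⁻¹
      = ENNReal.ofReal (4 * Real.pi / 3) * ENNReal.ofReal (max r ‖y‖)⁻¹ := by
  set e : E3 := EuclideanSpace.single 0 ‖y‖ with he
  obtain ⟨A, -, hA⟩ := exists_rotation (x := e) (y := y) (by simp [he])
  have hmp := A.measurePreserving
  have hpre : A ⁻¹' (Metric.ball (0 : E3) 1) = Metric.ball 0 1 := by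
    rw [A.preimage_ball, map_zero]
  have h1 : ∫⁻ x in Metric.ball (0 : E3) 1, ENNReal.ofReal ‖(r / ‖x‖) • x - y‖⁻¹
      = ∫⁻ x in Metric.ball (0 : E3) 1, ENNReal.ofReal ‖(r / ‖x‖) • x - e‖⁻¹ := by
    rw [← hmp.setLIntegral_comp_preimage measurableSet_ball (by fun_prop), hpre]
    refine lintegral_congr fun x => ?_
    rw [← hA, A.norm_map, ← map_smul, ← map_sub, A.norm_map]
  have h2 : ∫⁻ x in Metric.ball (0 : E3) 1, ENNReal.ofReal ‖(r / ‖x‖) • x - e‖⁻¹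
      = ∫⁻ x in Metric.ball (0 : E3) 1, ENNReal.ofReal
        (Real.sqrt (r ^ 2 + ‖y‖ ^ 2 - 2 * r * ‖y‖ * (x 0 / ‖x‖)))⁻¹ := by
    refine lintegral_congr_ae (ae_restrict_of_ae ?_)
    have h0 : ∀ᵐ x : E3, x ≠ 0 := by simp [ae_iff]
    filter_upwards [h0] with x hx
    have hn : ‖x‖ ≠ 0 := norm_ne_zero_iff.2 hx
    congr 2
    rw [← Real.sqrt_sq (norm_nonneg ((r / ‖x‖) • x - e)), norm_sub_sq_real, norm_smul, inner_smul_left]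
    congr 1
    have : inner ℝ x e = ‖y‖ * x 0 := by
      rw [he, EuclideanSpace.inner_single_right]; simp
    rw [this, show ‖e‖ = ‖y‖ by simp [he], Real.norm_of_nonneg (by positivity)]
    simp only [conj_trivial]
    field_simp
    ring
  rw [h1, h2, lintegral_ball_coord
    (fun t => ENNReal.ofReal (Real.sqrt (r ^ 2 + ‖y‖ ^ 2 - 2 * r * ‖y‖ * t))⁻¹) (by fun_prop),
    integral_inv_sqrt hr (norm_nonneg y) hy, ← ENNReal.ofReal_mul (by positivity),
    ← ENNReal.ofReal_mul (by positivity)]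
  congr 1; ring

/-- Newton's theorem: a rotation invariant mass distribution acts like shells. -/
theorem lintegral_inv_norm_sub (ν : Measure E3) [SFinite ν]
    (hinv : ∀ A : E3 ≃ₗᵢ[ℝ] E3, LinearMap.det (A.toLinearEquiv : E3 →ₗ[ℝ] E3) = 1 → ν.map A = ν)
    (hnull : ∀ r, 0 < r → ν (Metric.sphere 0 r) = 0) {x : E3} (hx : x ≠ 0) :
    ∫⁻ y, ENNReal.ofReal ‖x - y‖⁻¹ ∂ν = ∫⁻ y, ENNReal.ofReal (max ‖x‖ ‖y‖)⁻¹ ∂ν := by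
  have hr : 0 < ‖x‖ := norm_pos_iff.2 hx
  set c := ENNReal.ofReal (4 * Real.pi / 3) with hc
  have hc0 : c ≠ 0 := by
    rw [hc, Ne, ENNReal.ofReal_eq_zero, not_le]; positivity
  have hct : c ≠ ∞ := ENNReal.ofReal_ne_top
  have hvol : volume (Metric.ball (0 : E3) 1) = c := by
    rw [EuclideanSpace.volume_ball_fin_three, hc]; simp; ring_nf
  -- By invariance of ν the potential depends only on ‖x‖, so it may be averaged over all directions
  -- w. Tonelli's theorem then moves the average onto the kernel, where it is explicit off the
  -- ν-null sphere of radius ‖x‖.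
  have h1 : ∀ᵐ w : E3 ∂(volume.restrict (Metric.ball (0 : E3) 1)),
      ∫⁻ y, ENNReal.ofReal ‖(‖x‖ / ‖w‖) • w - y‖⁻¹ ∂ν = ∫⁻ y, ENNReal.ofReal ‖x - y‖⁻¹ ∂ν := by
    have h0 : ∀ᵐ x : E3, x ≠ 0 := by simp [ae_iff]
    filter_upwards [ae_restrict_of_ae h0] with w hw
    have hn : ‖w‖ ≠ 0 := norm_ne_zero_iff.2 hw
    obtain ⟨A, hA, hAx⟩ := exists_rotation (x := x) (y := (‖x‖ / ‖w‖) • w)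
      (by rw [norm_smul, Real.norm_of_nonneg (by positivity)]; field_simp)
    conv_lhs => rw [← hinv A hA]
    rw [lintegral_map (by fun_prop) A.continuous.measurable]
    refine lintegral_congr fun y => ?_
    rw [← hAx, ← map_sub, A.norm_map]
  have h2 := lintegral_congr_ae h1
  rw [lintegral_const, Measure.restrict_apply_univ, hvol,
    lintegral_lintegral_swap (by fun_prop)] at h2
  have h3 : ∀ᵐ y ∂ν, ∫⁻ w in Metric.ball (0 : E3) 1, ENNReal.ofReal ‖(‖x‖ / ‖w‖) • w - y‖⁻¹
      = c * ENNReal.ofReal (max ‖x‖ ‖y‖)⁻¹ := by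
    have : ∀ᵐ y ∂ν, y ∉ Metric.sphere (0 : E3) ‖x‖ := by
      exact measure_eq_zero_iff_ae_notMem.1 (hnull _ hr)
    filter_upwards [this] with y hy
    exact lintegral_ball_inv_norm_sub hr y (by simpa using hy)
  rw [lintegral_congr_ae h3, lintegral_const_mul _ (by fun_prop), mul_comm] at h2
  exact ((ENNReal.mul_left_inj hc0 hct).1 h2).symm

/-! ### Radial densities: mass function, potential and field -/

/-- Nonnegative integrable spherically symmetric phase space densities. -/
structure IsRadial (f : E3 × E3 → ℝ) : Prop where
  integrable : Integrable f
  nonneg : ∀ᵐ z : E3 × E3, 0 ≤ f z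
  symmetric : SphericallySymmetric f

theorem Admissible.isRadial {Q : ℝ → ℝ → ℝ} {M : ℝ} {f : E3 × E3 → ℝ} (h : Admissible Q M f) :
    IsRadial f := ⟨h.integrable, h.nonneg, h.symmetric⟩

/-- The mass inside the ball of radius `r`. -/
def massIn (f : E3 × E3 → ℝ) (r : ℝ) : ℝ := ∫ z in {z : E3 × E3 | ‖z.1‖ ≤ r}, f z

theorem measurableSet_norm_fst_le (r : ℝ) : MeasurableSet {z : E3 × E3 | ‖z.1‖ ≤ r} :=
  measurableSet_le (by fun_prop) measurable_const

/-- The spatial mass distribution as a measure. -/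
def massMeasure (f : E3 × E3 → ℝ) : Measure E3 :=
  ((volume : Measure (E3 × E3)).withDensity (fun z => ENNReal.ofReal (f z))).map Prod.fst

theorem measurePreserving_rotation (A : E3 ≃ₗᵢ[ℝ] E3) :
    MeasurePreserving (fun z : E3 × E3 => (A z.1, A z.2)) :=
  A.measurePreserving.prod A.measurePreserving

theorem measurableEmbedding_rotation (A : E3 ≃ₗᵢ[ℝ] E3) :
    MeasurableEmbedding (fun z : E3 × E3 => (A z.1, A z.2)) :=
  (A.toHomeomorph.prodCongr A.toHomeomorph).measurableEmbedding

theorem volume_fst_sphere (r : ℝ) : volume {z : E3 × E3 | ‖z.1‖ = r} = 0 := by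
  have : {z : E3 × E3 | ‖z.1‖ = r} = (Metric.sphere (0 : E3) r) ×ˢ univ := by
    ext z; simp
  rw [this, Measure.volume_eq_prod, Measure.prod_prod, Measure.addHaar_sphere, zero_mul]

theorem ae_norm_fst_ne (r : ℝ) : ∀ᵐ z : E3 × E3, ‖z.1‖ ≠ r := by
  have := measure_eq_zero_iff_ae_notMem.1 (volume_fst_sphere r)
  simpa using this

theorem lintegral_massMeasure {f : E3 × E3 → ℝ} (hf : AEMeasurable f) {k : E3 → ℝ≥0∞}
    (hk : Measurable k) :
    ∫⁻ y, k y ∂(massMeasure f) = ∫⁻ z, ENNReal.ofReal (f z) * k z.1 := by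
  rw [massMeasure, lintegral_map hk measurable_fst,
    lintegral_withDensity_eq_lintegral_mul₀ (g := fun z : E3 × E3 => k z.1) hf.ennreal_ofReal
      (hk.comp measurable_fst).aemeasurable]
  rfl

namespace IsRadial

variable {f g : E3 × E3 → ℝ}

theorem isFiniteMeasure (hf : IsRadial f) : IsFiniteMeasure (massMeasure f) := by
  have := isFiniteMeasure_withDensity_ofReal hf.integrable.2
  unfold massMeasure
  infer_instance

/-- Symmetry is assumed only almost everywhere, with an exceptional set depending on the rotation.
For the spatial mass measure it becomes an exact invariance, as Newton's theorem requires. -/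
theorem massMeasure_map (hf : IsRadial f) (A : E3 ≃ₗᵢ[ℝ] E3)
    (hA : LinearMap.det (A.toLinearEquiv : E3 →ₗ[ℝ] E3) = 1) :
    (massMeasure f).map A = massMeasure f := by
  ext s hs
  have hAm : Measurable A := A.continuous.measurable
  have key := (measurePreserving_rotation A).setLIntegral_comp_preimage_emb
    (measurableEmbedding_rotation A) (fun z => ENNReal.ofReal (f z)) (Prod.fst ⁻¹' s)
  rw [Measure.map_apply hAm hs, massMeasure, Measure.map_apply measurable_fst (hAm hs),
    Measure.map_apply measurable_fst hs, withDensity_apply _ (measurable_fst (hAm hs)),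
    withDensity_apply _ (measurable_fst hs), ← key]
  symm
  refine lintegral_congr_ae (ae_restrict_of_ae (μ := (volume : Measure (E3 × E3))) ?_)
  filter_upwards [hf.symmetric A hA] with z hz
  rw [hz]

theorem massMeasure_sphere (f : E3 × E3 → ℝ) (r : ℝ) : massMeasure f (Metric.sphere 0 r) = 0 := by
  have hs : MeasurableSet (Metric.sphere (0 : E3) r) := Metric.isClosed_sphere.measurableSet
  rw [massMeasure, Measure.map_apply measurable_fst hs]
  refine withDensity_absolutelyContinuous _ _ ?_
  convert volume_fst_sphere r using 2
  ext z; simp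

theorem lintegral_eq (hf : IsRadial f) {x : E3} (hx : x ≠ 0) :
    ∫⁻ z, ENNReal.ofReal (f z * ‖x - z.1‖⁻¹)
      = ∫⁻ z, ENNReal.ofReal (f z * (max ‖x‖ ‖z.1‖)⁻¹) := by
  have := hf.isFiniteMeasure
  have h := lintegral_inv_norm_sub (massMeasure f) hf.massMeasure_map
    (fun r _ => massMeasure_sphere f r) hx
  rw [lintegral_massMeasure hf.integrable.aemeasurable (by fun_prop),
    lintegral_massMeasure hf.integrable.aemeasurable (by fun_prop)] at h
  have h1 : ∀ k : E3 × E3 → ℝ, ∫⁻ z, ENNReal.ofReal (f z * k z)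
      = ∫⁻ z, ENNReal.ofReal (f z) * ENNReal.ofReal (k z) := fun k => by
    refine lintegral_congr_ae ?_
    filter_upwards [hf.nonneg] with z hz
    rw [ENNReal.ofReal_mul hz]
  rw [h1, h1, h]

theorem integrable_mul_inv_max (hf : IsRadial f) {a : ℝ} (ha : 0 < a) :
    Integrable (fun z => f z * (max a ‖z.1‖)⁻¹) := by
  refine hf.integrable.mul_bdd (c := a⁻¹) (by fun_prop) (ae_of_all _ fun z => ?_)
  rw [Real.norm_of_nonneg (by positivity)]
  exact inv_anti₀ ha (le_max_left _ _)

/-- No local bound on f is available to tame the singular kernel; its integrability is read off from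
the bounded kernel 1/max(‖x‖, ‖y‖) on the other side of Newton's identity. -/
theorem integrable_mul_inv_norm (hf : IsRadial f) {x : E3} (hx : x ≠ 0) :
    Integrable (fun z => f z * ‖x - z.1‖⁻¹) := by
  have h0 : 0 ≤ᵐ[volume] (fun z => f z * ‖x - z.1‖⁻¹) := by
    filter_upwards [hf.nonneg] with z hz
    exact mul_nonneg hz (by positivity)
  refine ⟨hf.integrable.aestronglyMeasurable.mul (by fun_prop), ?_⟩
  rw [hasFiniteIntegral_iff_ofReal h0, hf.lintegral_eq hx]
  exact (hf.integrable_mul_inv_max (norm_pos_iff.2 hx)).lintegral_lt_top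

theorem potential_eq (hf : IsRadial f) {x : E3} (hx : x ≠ 0) :
    potential f x = -∫ z, f z * (max ‖x‖ ‖z.1‖)⁻¹ := by
  have h1 : ∫ z, f z * ‖x - z.1‖⁻¹ = ∫ z, f z * (max ‖x‖ ‖z.1‖)⁻¹ := by
    rw [integral_eq_lintegral_of_nonneg_ae, integral_eq_lintegral_of_nonneg_ae, hf.lintegral_eq hx]
    · filter_upwards [hf.nonneg] with z hz
      exact mul_nonneg hz (by positivity)
    · exact (hf.integrable_mul_inv_max (norm_pos_iff.2 hx)).1
    · filter_upwards [hf.nonneg] with z hz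
      exact mul_nonneg hz (by positivity)
    · exact (hf.integrable_mul_inv_norm hx).1
  rw [← h1, potential, Measure.volume_eq_prod, integral_prod _ (hf.integrable_mul_inv_norm hx)]
  congr 1
  refine integral_congr_ae (ae_of_all _ fun y => ?_)
  simp only [density, div_eq_mul_inv]
  rw [integral_mul_const]

end IsRadial

theorem integral_Ioi_inv_sq {c : ℝ} (hc : 0 < c) : ∫ s in Ioi c, (s ^ 2)⁻¹ = c⁻¹ := by
  have h := integral_Ioi_rpow_of_lt (a := -2) (by norm_num) hc
  have h2 : ∫ s in Ioi c, (s ^ 2)⁻¹ = ∫ s in Ioi c, s ^ (-2 : ℝ) := by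
    refine setIntegral_congr_fun measurableSet_Ioi fun s hs => ?_
    have : (0:ℝ) < s := hc.trans hs
    rw [Real.rpow_neg this.le, Real.rpow_two]
  rw [h2, h]
  norm_num [Real.rpow_neg_one]

theorem integrableOn_Ioi_inv_sq {c : ℝ} (hc : 0 < c) :
    IntegrableOn (fun s : ℝ => (s ^ 2)⁻¹) (Ioi c) := by
  refine (integrableOn_Ioi_rpow_of_lt (a := -2) (by norm_num) hc).congr_fun ?_ measurableSet_Ioi
  intro s hs
  have : (0:ℝ) < s := hc.trans hs
  simp only
  rw [Real.rpow_neg this.le, Real.rpow_two]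

/-- This writes 1/max(a, b) as a superposition over radii s, so that Fubini's theorem turns the
potential into an integral of m(s)/s². -/
theorem setIntegral_indicator_inv_sq {a b : ℝ} (ha : 0 < a) :
    ∫ s in Ioi a, (if b ≤ s then (s ^ 2)⁻¹ else 0) = (max a b)⁻¹ := by
  rw [← integral_Ioi_inv_sq (lt_max_of_lt_left ha : 0 < max a b)]
  have : ∀ s : ℝ, (if b ≤ s then (s ^ 2)⁻¹ else 0) = (Ici b).indicator (fun s => (s ^ 2)⁻¹) s := by
    intro s; simp [indicator]
  simp only [this]
  rw [setIntegral_indicator measurableSet_Ici]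
  refine setIntegral_congr_set ?_
  have h1 : (Ici b : Set ℝ) =ᵐ[volume] Ioi b := Ioi_ae_eq_Ici.symm
  have h2 := (ae_eq_refl (Ioi a : Set ℝ)).inter h1
  rwa [Ioi_inter_Ioi] at h2

namespace IsRadial

variable {f g : E3 × E3 → ℝ}

theorem massIn_mono (hf : IsRadial f) : Monotone (massIn f) := by
  intro r s hrs
  refine setIntegral_mono_set hf.integrable.integrableOn (ae_restrict_of_ae hf.nonneg) ?_
  exact LE.le.eventuallyLE fun z (hz : ‖z.1‖ ≤ r) => (le_trans hz hrs : ‖z.1‖ ≤ s)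

theorem massIn_nonneg (hf : IsRadial f) (r : ℝ) : 0 ≤ massIn f r :=
  integral_nonneg_of_ae (ae_restrict_of_ae hf.nonneg)

theorem massIn_le (hf : IsRadial f) (r : ℝ) : massIn f r ≤ ∫ z, f z :=
  setIntegral_le_integral hf.integrable hf.nonneg

/-- Spheres are null sets, so the indicator of the ball of radius s converges almost everywhere as s
→ r, and f itself dominates. Continuity makes the potential differentiable in the radius although f
is merely integrable. -/
theorem continuous_massIn (hf : IsRadial f) : Continuous (massIn f) := by
  rw [continuous_iff_continuousAt]
  intro r
  have : massIn f = fun r => ∫ z, {z : E3 × E3 | ‖z.1‖ ≤ r}.indicator f z := by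
    ext r; rw [massIn, integral_indicator (measurableSet_norm_fst_le r)]
  rw [this]
  refine continuousAt_of_dominated (bound := fun z => ‖f z‖) ?_ ?_ hf.integrable.norm ?_
  · exact Eventually.of_forall fun s =>
      hf.integrable.aestronglyMeasurable.indicator (measurableSet_norm_fst_le s)
  · exact Eventually.of_forall fun s => ae_of_all _ fun z => norm_indicator_le_norm_self f z
  · filter_upwards [ae_norm_fst_ne r] with z hz
    rcases lt_or_gt_of_ne hz with h | h
    · have : ∀ᶠ s in 𝓝 r, {z : E3 × E3 | ‖z.1‖ ≤ s}.indicator f z = f z := by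
        filter_upwards [lt_mem_nhds h] with s hs
        exact indicator_of_mem (show z ∈ {z : E3 × E3 | ‖z.1‖ ≤ s} from hs.le) _
      exact (continuousAt_const).congr (this.mono fun s hs => hs.symm)
    · have : ∀ᶠ s in 𝓝 r, {z : E3 × E3 | ‖z.1‖ ≤ s}.indicator f z = (0 : ℝ) := by
        filter_upwards [gt_mem_nhds h] with s hs
        exact indicator_of_notMem
          (show z ∉ {z : E3 × E3 | ‖z.1‖ ≤ s} from fun h' => absurd hs (not_lt.2 h')) f
      exact (continuousAt_const).congr (this.mono fun s hs => hs.symm)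

theorem integrableOn_massIn_div (hf : IsRadial f) {a : ℝ} (ha : 0 < a) :
    IntegrableOn (fun s => massIn f s * (s ^ 2)⁻¹) (Ioi a) := by
  refine Integrable.bdd_mul (integrableOn_Ioi_inv_sq ha)
    (c := ∫ z, f z) hf.continuous_massIn.aestronglyMeasurable (ae_of_all _ fun s => ?_)
  rw [Real.norm_of_nonneg (hf.massIn_nonneg s)]
  exact hf.massIn_le s

/-- The radial profile of the (sign-reversed) potential. -/
theorem integral_mul_inv_max (hf : IsRadial f) {a : ℝ} (ha : 0 < a) :
    ∫ z, f z * (max a ‖z.1‖)⁻¹ = ∫ s in Ioi a, massIn f s * (s ^ 2)⁻¹ := by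
  have hint : Integrable (fun p : (E3 × E3) × ℝ =>
      {p : (E3 × E3) × ℝ | ‖p.1.1‖ ≤ p.2}.indicator (fun p => f p.1 * (p.2 ^ 2)⁻¹) p)
      ((volume : Measure (E3 × E3)).prod (volume.restrict (Ioi a))) :=
    (hf.integrable.mul_prod (integrableOn_Ioi_inv_sq ha)).indicator
      (measurableSet_le (by fun_prop) measurable_snd)
  have h := integral_integral_swap (μ := (volume : Measure (E3 × E3))) (ν := volume.restrict (Ioi a))
    (f := fun z s => {p : (E3 × E3) × ℝ | ‖p.1.1‖ ≤ p.2}.indicator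
      (fun p => f p.1 * (p.2 ^ 2)⁻¹) (z, s)) hint
  have h1 : ∀ z : E3 × E3, ∫ s in Ioi a, {p : (E3 × E3) × ℝ | ‖p.1.1‖ ≤ p.2}.indicator
      (fun p => f p.1 * (p.2 ^ 2)⁻¹) (z, s) = f z * (max a ‖z.1‖)⁻¹ := by
    intro z
    rw [← setIntegral_indicator_inv_sq ha, ← integral_const_mul]
    refine integral_congr_ae (ae_of_all _ fun s => ?_)
    simp [indicator, mul_ite]
  have h2 : ∀ s : ℝ, ∫ z, {p : (E3 × E3) × ℝ | ‖p.1.1‖ ≤ p.2}.indicator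
      (fun p => f p.1 * (p.2 ^ 2)⁻¹) (z, s) = massIn f s * (s ^ 2)⁻¹ := by
    intro s
    rw [massIn, ← integral_mul_const, ← integral_indicator (measurableSet_norm_fst_le s)]
    rfl
  simp only [h1, h2] at h
  exact h

theorem potential_eq_integral (hf : IsRadial f) {x : E3} (hx : x ≠ 0) :
    potential f x = -∫ s in Ioi ‖x‖, massIn f s * (s ^ 2)⁻¹ := by
  rw [hf.potential_eq hx, hf.integral_mul_inv_max (norm_pos_iff.2 hx)]

theorem hasDerivAt_profile (hf : IsRadial f) {a : ℝ} (ha : 0 < a) :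
    HasDerivAt (fun r => -∫ s in Ioi r, massIn f s * (s ^ 2)⁻¹) (massIn f a * (a ^ 2)⁻¹) a := by
  have hc : ContinuousOn (fun s => massIn f s * (s ^ 2)⁻¹) (Ioi 0) :=
    hf.continuous_massIn.continuousOn.mul
      ((continuous_pow 2).continuousOn.inv₀ fun s (hs : 0 < s) => by positivity)
  have h1 : HasDerivAt (fun r => ∫ s in (a/2)..r, massIn f s * (s ^ 2)⁻¹)
      (massIn f a * (a ^ 2)⁻¹) a := by
    refine intervalIntegral.integral_hasDerivAt_right ?_ ?_ (hc.continuousAt (Ioi_mem_nhds ha))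
    · exact (hc.mono fun s hs => by
        rw [uIcc_of_le (by linarith)] at hs
        exact lt_of_lt_of_le (by linarith) hs.1).intervalIntegrable
    · exact hc.stronglyMeasurableAtFilter isOpen_Ioi a ha
  have h2 : ∀ᶠ r in 𝓝 a, (-∫ s in Ioi r, massIn f s * (s ^ 2)⁻¹)
      = (∫ s in (a/2)..r, massIn f s * (s ^ 2)⁻¹) - ∫ s in Ioi (a/2), massIn f s * (s ^ 2)⁻¹ := by
    filter_upwards [Ioi_mem_nhds (by linarith : a / 2 < a)] with r hr
    rw [← intervalIntegral.integral_Ioi_sub_Ioi (hf.integrableOn_massIn_div (by linarith)) hr.le]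
    ring
  exact (h1.sub_const _).congr_of_eventuallyEq h2

/-- The field of a radial density. -/
theorem field_eq (hf : IsRadial f) {x : E3} (hx : x ≠ 0) :
    field f x = (massIn f ‖x‖ * (‖x‖ ^ 3)⁻¹) • x := by
  have hn := norm_pos_iff.2 hx
  have h0 : HasFDerivAt (fun y : E3 => ‖y‖) (‖x‖⁻¹ • innerSL ℝ x) x := by
    have h := (hasStrictFDerivAt_norm_sq x).hasFDerivAt.sqrt (by positivity)
    simp only [Real.sqrt_sq (norm_nonneg _)] at h
    refine h.congr_fderiv ?_
    ext y
    simp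
    field_simp
  have h1 := (hf.hasDerivAt_profile hn).comp_hasFDerivAt x h0
  have h2 : (fun y : E3 => potential f y) =ᶠ[𝓝 x]
      ((fun r => -∫ s in Ioi r, massIn f s * (s ^ 2)⁻¹) ∘ fun y : E3 => ‖y‖) := by
    filter_upwards [isOpen_ne.mem_nhds hx] with y hy
    exact hf.potential_eq_integral hy
  have h3 := h1.congr_of_eventuallyEq h2
  have h4 : HasGradientAt (potential f) ((massIn f ‖x‖ * (‖x‖ ^ 3)⁻¹) • x) x := by
    rw [hasGradientAt_iff_hasFDerivAt]
    refine h3.congr_fderiv ?_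
    ext y
    simp
    field_simp
  exact h4.gradient

end IsRadial

/-! ### Field energy in terms of the mass function -/

theorem angMom_nonneg (x v : E3) : 0 ≤ angMom x v := by
  have h := abs_real_inner_le_norm x v
  have h2 := sq_le_sq' (by linarith [neg_abs_le (inner ℝ x v), le_abs_self (inner ℝ x v)])
    ((le_abs_self _).trans h)
  rw [mul_pow] at h2
  unfold angMom
  linarith

/-- The radial form of the field energy. -/
def potEnergy (f g : E3 × E3 → ℝ) : ℝ := ∫ r in Ioi (0 : ℝ), massIn f r * massIn g r * (r ^ 2)⁻¹

/-- Polar coordinates; the factor 4π is the dimension 3 times the volume 4π/3 of the unit ball. The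
case φ = m_f gives the field energy, the case φ = m_f − m_g the field distance. -/
theorem integral_sq_field_aux (φ : ℝ → ℝ) :
    ∫ x : E3, (φ ‖x‖ * (‖x‖ ^ 3)⁻¹) ^ 2 * ‖x‖ ^ 2
      = 4 * Real.pi * ∫ r in Ioi (0 : ℝ), φ r ^ 2 * (r ^ 2)⁻¹ := by
  have h := integral_fun_norm_addHaar (volume : Measure E3)
    (fun r => (φ r * (r ^ 3)⁻¹) ^ 2 * r ^ 2)
  rw [h]
  have hv : (volume : Measure E3).real (Metric.ball 0 1) = 4 * Real.pi / 3 := by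
    rw [measureReal_def, EuclideanSpace.volume_ball_fin_three]
    rw [ENNReal.toReal_mul, ENNReal.toReal_ofReal (by positivity)]
    simp
    ring
  have h2 : ∫ y in Ioi (0:ℝ), y ^ (Module.finrank ℝ E3 - 1) • ((φ y * (y ^ 3)⁻¹) ^ 2 * y ^ 2)
      = ∫ r in Ioi (0 : ℝ), φ r ^ 2 * (r ^ 2)⁻¹ := by
    refine setIntegral_congr_fun measurableSet_Ioi fun y hy => ?_
    have : (0:ℝ) < y := hy
    simp only [finrank_euclideanSpace, Fintype.card_fin, smul_eq_mul]
    field_simp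
    norm_num
    ring
  rw [h2, hv]
  simp
  ring

theorem IsRadial.integral_field_sub_sq {f g : E3 × E3 → ℝ} (hf : IsRadial f) (hg : IsRadial g) :
    ∫ x : E3, ‖field f x - field g x‖ ^ 2
      = 4 * Real.pi * ∫ r in Ioi (0 : ℝ), (massIn f r - massIn g r) ^ 2 * (r ^ 2)⁻¹ := by
  rw [← integral_sq_field_aux (fun r => massIn f r - massIn g r)]
  refine integral_congr_ae ?_
  have h0 : ∀ᵐ x : E3, x ≠ 0 := by simp [ae_iff]
  filter_upwards [h0] with x hx
  rw [hf.field_eq hx, hg.field_eq hx, ← sub_smul, norm_smul, mul_pow, Real.norm_eq_abs, sq_abs]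
  ring

theorem IsRadial.integral_field_sq {f : E3 × E3 → ℝ} (hf : IsRadial f) :
    ∫ x : E3, ‖field f x‖ ^ 2 = 4 * Real.pi * potEnergy f f := by
  have h := integral_sq_field_aux (fun r => massIn f r)
  have h2 : ∀ r, massIn f r ^ 2 * (r ^ 2)⁻¹ = massIn f r * massIn f r * (r ^ 2)⁻¹ := fun r => by
    ring
  simp only [h2] at h
  rw [potEnergy, ← h]
  refine integral_congr_ae ?_
  have h0 : ∀ᵐ x : E3, x ≠ 0 := by simp [ae_iff]
  filter_upwards [h0] with x hx
  rw [hf.field_eq hx, norm_smul, mul_pow, Real.norm_eq_abs, sq_abs]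

/-! ### Truncation in height and velocity -/

section
variable {Q : ℝ → ℝ → ℝ} {μ₁ μ₂ μ₃ C₁ C₂ C₃ C₄ F₀ M : ℝ} {f g : E3 × E3 → ℝ}

theorem IsRadial.energyCasimir_eq (hf : IsRadial f) :
    energyCasimir Q f = casimirKinetic Q f - 1 / 2 * potEnergy f f := by
  rw [energyCasimir, hf.integral_field_sq]
  have := Real.pi_pos
  field_simp
  ring

theorem CasimirAssumptions.casimir_ae_nonneg (hQ : CasimirAssumptions Q μ₁ μ₂ μ₃ C₁ C₂ C₃ C₄ F₀)
    (hf : ∀ᵐ z, 0 ≤ f z) : ∀ᵐ z : E3 × E3, 0 ≤ Q (f z) (angMom z.1 z.2) := by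
  filter_upwards [hf] with z hz
  exact hQ.nonneg _ _ hz (angMom_nonneg _ _)

theorem kinetic_ae_nonneg (hf : ∀ᵐ z, 0 ≤ f z) : ∀ᵐ z : E3 × E3, 0 ≤ ‖z.2‖ ^ 2 * f z := by
  filter_upwards [hf] with z hz
  positivity

theorem casimir_le_casimirKinetic
    (hf : ∀ᵐ z, 0 ≤ f z) :
    ∫ z : E3 × E3, Q (f z) (angMom z.1 z.2) ≤ casimirKinetic Q f := by
  have := integral_nonneg_of_ae (kinetic_ae_nonneg hf)
  unfold casimirKinetic
  linarith

theorem CasimirAssumptions.kinetic_le (hQ : CasimirAssumptions Q μ₁ μ₂ μ₃ C₁ C₂ C₃ C₄ F₀)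
    (hf : ∀ᵐ z, 0 ≤ f z) :
    ∫ z : E3 × E3, ‖z.2‖ ^ 2 * f z ≤ 2 * casimirKinetic Q f := by
  have := integral_nonneg_of_ae (hQ.casimir_ae_nonneg hf)
  unfold casimirKinetic
  linarith

theorem CasimirAssumptions.casimirKinetic_nonneg
    (hQ : CasimirAssumptions Q μ₁ μ₂ μ₃ C₁ C₂ C₃ C₄ F₀) (hf : ∀ᵐ z, 0 ≤ f z) :
    0 ≤ casimirKinetic Q f :=
  (integral_nonneg_of_ae (hQ.casimir_ae_nonneg hf)).trans (casimir_le_casimirKinetic hf)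

/-- Truncation at height `A` and velocity `P` costs only a small part of `J`. -/
theorem CasimirAssumptions.le_truncate (hQ : CasimirAssumptions Q μ₁ μ₂ μ₃ C₁ C₂ C₃ C₄ F₀)
    {A P a L w : ℝ} (hA : F₀ ≤ A) (hP : 0 < P) (ha : 0 ≤ a) (hL : 0 ≤ L) :
    a ≤ (if w ≤ P then min a A else 0) + w ^ 2 * a / P ^ 2 + Q a L / (C₁ * A ^ (1 / μ₁)) := by
  have hA0 : 0 < A := hQ.F0_pos.trans_le hA
  have hApow : 0 < A ^ (1 / μ₁) := Real.rpow_pos_of_pos hA0 _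
  have hC := hQ.C1_pos
  have hQn := hQ.nonneg a L ha hL
  have h1 : 0 ≤ w ^ 2 * a / P ^ 2 := by positivity
  have h2 : 0 ≤ Q a L / (C₁ * A ^ (1 / μ₁)) := by positivity
  by_cases hwP : w ≤ P
  · rw [if_pos hwP]
    rcases le_total a A with haA | haA
    · rw [min_eq_left haA]; linarith
    -- Above height A, (Q1) gives Q ≥ C₁a·a^(1/μ₁) ≥ C₁a·A^(1/μ₁), so a itself is paid for by the
    -- Casimir term; at speeds above P it is paid for by the kinetic term, as in Chebyshev's
    -- inequality.
    · have h3 := hQ.q1 a L (hA.trans haA) hL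
      have ha0 : 0 < a := hA0.trans_le haA
      rw [Real.rpow_add ha0, Real.rpow_one] at h3
      have h4 : A ^ (1 / μ₁) ≤ a ^ (1 / μ₁) :=
        Real.rpow_le_rpow hA0.le haA (by have := hQ.mu1.1; positivity)
      have h5 : a ≤ Q a L / (C₁ * A ^ (1 / μ₁)) := by
        rw [le_div_iff₀ (by positivity)]
        calc a * (C₁ * A ^ (1 / μ₁)) ≤ a * (C₁ * a ^ (1 / μ₁)) := by gcongr
          _ = C₁ * (a * a ^ (1 / μ₁)) := by ring
          _ ≤ _ := h3
      have : 0 ≤ min a A := le_min ha hA0.le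
      linarith
  · rw [if_neg hwP]
    have : a ≤ w ^ 2 * a / P ^ 2 := by
      rw [le_div_iff₀ (by positivity)]
      have : P ^ 2 ≤ w ^ 2 := pow_le_pow_left₀ hP.le (not_le.1 hwP).le 2
      nlinarith
    linarith

theorem volume_real_ball_prod {r P : ℝ} (hr : 0 ≤ r) (hP : 0 ≤ P) :
    (volume : Measure (E3 × E3)).real {z | ‖z.1‖ ≤ r ∧ ‖z.2‖ ≤ P}
      = (4 * Real.pi / 3) ^ 2 * r ^ 3 * P ^ 3 := by
  have : {z : E3 × E3 | ‖z.1‖ ≤ r ∧ ‖z.2‖ ≤ P}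
      = Metric.closedBall (0 : E3) r ×ˢ Metric.closedBall (0 : E3) P := by
    ext z; simp
  rw [this, measureReal_def, Measure.volume_eq_prod, Measure.prod_prod,
    EuclideanSpace.volume_closedBall_fin_three, EuclideanSpace.volume_closedBall_fin_three]
  simp only [ENNReal.toReal_mul, ENNReal.toReal_pow]
  rw [ENNReal.toReal_ofReal hr, ENNReal.toReal_ofReal hP, ENNReal.toReal_ofReal (by positivity)]
  ring

theorem measurableSet_ball_prod (r P : ℝ) :
    MeasurableSet {z : E3 × E3 | ‖z.1‖ ≤ r ∧ ‖z.2‖ ≤ P} :=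
  (measurableSet_norm_fst_le r).inter
    (measurableSet_le (f := fun z : E3 × E3 => ‖z.2‖) (by fun_prop) measurable_const)

theorem volume_ball_prod_lt_top (r P : ℝ) :
    (volume : Measure (E3 × E3)) {z | ‖z.1‖ ≤ r ∧ ‖z.2‖ ≤ P} < ∞ := by
  have : {z : E3 × E3 | ‖z.1‖ ≤ r ∧ ‖z.2‖ ≤ P}
      = Metric.closedBall (0 : E3) r ×ˢ Metric.closedBall (0 : E3) P := by
    ext z; simp
  rw [this]
  exact ((isCompact_closedBall _ _).prod (isCompact_closedBall _ _)).measure_lt_top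

/-- The truncated mass inside a ball. -/
def massTrunc (A P : ℝ) (f : E3 × E3 → ℝ) (r : ℝ) : ℝ :=
  ∫ z in {z : E3 × E3 | ‖z.1‖ ≤ r ∧ ‖z.2‖ ≤ P}, min (f z) A

theorem integrableOn_min (hf : Integrable f) (A r P : ℝ) :
    IntegrableOn (fun z => min (f z) A) {z : E3 × E3 | ‖z.1‖ ≤ r ∧ ‖z.2‖ ≤ P} := by
  refine Integrable.inf hf.integrableOn ?_
  exact integrableOn_const (volume_ball_prod_lt_top r P).ne

theorem CasimirAssumptions.massIn_le_massTrunc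
    (hQ : CasimirAssumptions Q μ₁ μ₂ μ₃ C₁ C₂ C₃ C₄ F₀) (hf : Admissible Q M f)
    {A P : ℝ} (hA : F₀ ≤ A) (hP : 0 < P) (r : ℝ) :
    massIn f r ≤ massTrunc A P f r + (∫ z, ‖z.2‖ ^ 2 * f z) / P ^ 2
      + (∫ z, Q (f z) (angMom z.1 z.2)) / (C₁ * A ^ (1 / μ₁)) := by
  have hm := measurableSet_norm_fst_le r
  have hA0 : 0 < A := hQ.F0_pos.trans_le hA
  have hApow : 0 < A ^ (1 / μ₁) := Real.rpow_pos_of_pos hA0 _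
  have hC := hQ.C1_pos
  have i1 : Integrable (fun z => {z : E3 × E3 | ‖z.1‖ ≤ r ∧ ‖z.2‖ ≤ P}.indicator
      (fun z => min (f z) A) z) :=
    (integrableOn_min hf.integrable A r P).integrable_indicator (measurableSet_ball_prod r P)
  have i2 := hf.kinetic_finite.div_const (P ^ 2)
  have i3 := hf.casimir_finite.div_const (C₁ * A ^ (1 / μ₁))
  have i12 : Integrable (fun z => {z : E3 × E3 | ‖z.1‖ ≤ r ∧ ‖z.2‖ ≤ P}.indicator
      (fun z => min (f z) A) z + ‖z.2‖ ^ 2 * f z / P ^ 2) := i1.add i2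
  have key : ∀ᵐ z : E3 × E3, {z : E3 × E3 | ‖z.1‖ ≤ r}.indicator f z
      ≤ {z : E3 × E3 | ‖z.1‖ ≤ r ∧ ‖z.2‖ ≤ P}.indicator (fun z => min (f z) A) z
        + ‖z.2‖ ^ 2 * f z / P ^ 2 + Q (f z) (angMom z.1 z.2) / (C₁ * A ^ (1 / μ₁)) := by
    filter_upwards [hf.nonneg] with z hz
    have h := hQ.le_truncate hA hP hz (w := ‖z.2‖) (angMom_nonneg z.1 z.2)
    have hQn := hQ.nonneg (f z) _ hz (angMom_nonneg z.1 z.2)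
    by_cases hr : ‖z.1‖ ≤ r
    · simpa [indicator, hr] using h
    · have h1 : 0 ≤ ‖z.2‖ ^ 2 * f z / P ^ 2 := by positivity
      have h2 : 0 ≤ Q (f z) (angMom z.1 z.2) / (C₁ * A ^ (1 / μ₁)) := by positivity
      simp only [indicator, mem_ofPred_eq, hr, if_false, false_and]
      linarith
  rw [massIn, massTrunc, ← integral_indicator hm, ← integral_indicator (measurableSet_ball_prod r P),
    ← integral_div, ← integral_div, ← integral_add i1 i2, ← integral_add i12 i3]
  exact integral_mono_ae (hf.integrable.indicator hm) (i12.add i3) key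

theorem massTrunc_le_massIn (hf : IsRadial f) (A P r : ℝ) : massTrunc A P f r ≤ massIn f r := by
  calc massTrunc A P f r ≤ ∫ z in {z : E3 × E3 | ‖z.1‖ ≤ r ∧ ‖z.2‖ ≤ P}, f z := by
        exact integral_mono (integrableOn_min hf.integrable A r P) hf.integrable.integrableOn
          fun z => min_le_left _ _
    _ ≤ massIn f r := by
        refine setIntegral_mono_set hf.integrable.integrableOn (ae_restrict_of_ae hf.nonneg) ?_
        exact LE.le.eventuallyLE fun z (hz : _ ∧ _) => hz.1

theorem massTrunc_le (hf : Integrable f) {A P r : ℝ} (hr : 0 ≤ r) (hP : 0 ≤ P) :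
    massTrunc A P f r ≤ A * ((4 * Real.pi / 3) ^ 2 * r ^ 3 * P ^ 3) := by
  rw [← volume_real_ball_prod hr hP]
  calc massTrunc A P f r ≤ ∫ z in {z : E3 × E3 | ‖z.1‖ ≤ r ∧ ‖z.2‖ ≤ P}, A := by
        exact integral_mono (integrableOn_min hf A r P)
          (integrableOn_const (volume_ball_prod_lt_top r P).ne) fun z => min_le_right _ _
    _ = _ := by rw [setIntegral_const, smul_eq_mul, mul_comm]

end

/-! ### Mass near the origin and coercivity of the energy-Casimir functional -/

section
variable {Q : ℝ → ℝ → ℝ} {μ₁ μ₂ μ₃ C₁ C₂ C₃ C₄ F₀ M : ℝ} {f g : E3 × E3 → ℝ}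

/-- The Hölder exponent of the mass function at the origin. -/
def massExponent (μ₁ : ℝ) : ℝ := min (3 / 4) (3 / (4 * μ₁))

/-- The exponent of `J` in the bound for the field energy. -/
def fieldExponent (μ₁ : ℝ) : ℝ := (μ₁ + 3 / 2) / 3

/-- The constant in the bound for the mass function. -/
def massConst (μ₁ C₁ F₀ : ℝ) : ℝ :=
  F₀ * (4 * Real.pi / 3) ^ 2 + 2 + 1 / (C₁ * F₀ ^ (1 / μ₁))

theorem CasimirAssumptions.half_lt_massExponent
    (hQ : CasimirAssumptions Q μ₁ μ₂ μ₃ C₁ C₂ C₃ C₄ F₀) : 1 / 2 < massExponent μ₁ := by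
  have h1 := hQ.mu1.1
  have h2 := hQ.mu1.2
  refine lt_min (by norm_num) ?_
  rw [lt_div_iff₀ (by positivity)]
  linarith

/-- Truncate at velocity P = (j/s)^(1/2) and height A = F₀ j^μ₁ s^(−3/4). The truncated mass is at
most a constant times A r³ P³, and the choice r = j^(−γ)s with 3γ = μ₁ + 3/2 cancels all powers of
j, leaving s^(3/4). The kinetic error is at most 2s and the Casimir error a constant times
s^(3/(4μ₁)). The smallest exponent exceeds 1/2 because μ₁ < 3/2. -/
theorem CasimirAssumptions.massIn_le_rpow
    (hQ : CasimirAssumptions Q μ₁ μ₂ μ₃ C₁ C₂ C₃ C₄ F₀) (hf : Admissible Q M f) {j s : ℝ}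
    (hj : 1 ≤ j) (hJ : casimirKinetic Q f ≤ j) (hs : 0 < s) (hs1 : s ≤ 1) :
    massIn f (j ^ (-fieldExponent μ₁) * s) ≤ massConst μ₁ C₁ F₀ * s ^ massExponent μ₁ := by
  have hμ := hQ.mu1.1
  have hC := hQ.C1_pos
  have hF := hQ.F0_pos
  have hj0 : 0 < j := by linarith
  have hK := (hQ.kinetic_le hf.nonneg).trans (mul_le_mul_of_nonneg_left hJ zero_le_two)
  have hq := (casimir_le_casimirKinetic (Q := Q) hf.nonneg).trans hJ
  set r := j ^ (-fieldExponent μ₁) * s with hr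
  have hr0 : 0 < r := by positivity
  set P := (j / s) ^ (1 / 2 : ℝ) with hP
  have hP0 : 0 < P := by positivity
  set A := F₀ * (j ^ μ₁ * s ^ (-(3 / 4) : ℝ)) with hA
  have hs34 : 1 ≤ s ^ (-(3 / 4) : ℝ) := Real.one_le_rpow_of_pos_of_le_one_of_nonpos hs hs1 (by norm_num)
  have hjμ : 1 ≤ j ^ μ₁ := Real.one_le_rpow hj hμ.le
  have hAF : F₀ ≤ A := by
    rw [hA]
    nlinarith [mul_le_mul hjμ hs34 zero_le_one (by positivity)]
  have h := hQ.massIn_le_massTrunc hf hAF hP0 r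
  have h1 := massTrunc_le (f := f) hf.integrable (A := A) hr0.le hP0.le
  have e1 : A * ((4 * Real.pi / 3) ^ 2 * r ^ 3 * P ^ 3)
      = F₀ * (4 * Real.pi / 3) ^ 2 * s ^ (3 / 4 : ℝ) := by
    have hP3 : P ^ 3 = j ^ (3 / 2 : ℝ) * s ^ (-(3 / 2) : ℝ) := by
      rw [hP, ← Real.rpow_natCast, ← Real.rpow_mul (by positivity), Real.div_rpow hj0.le hs.le,
        div_eq_mul_inv, ← Real.rpow_neg hs.le]
      norm_num
    have hr3 : r ^ 3 = j ^ (-(μ₁ + 3 / 2)) * s ^ (3 : ℝ) := by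
      rw [hr, mul_pow, ← Real.rpow_natCast, ← Real.rpow_mul hj0.le, fieldExponent,
        ← Real.rpow_natCast s 3]
      congr 2
      · push_cast; ring
    rw [hP3, hr3, hA]
    have ej : j ^ μ₁ * j ^ (-(μ₁ + 3 / 2)) * j ^ (3 / 2 : ℝ) = 1 := by
      rw [← Real.rpow_add hj0, ← Real.rpow_add hj0]
      ring_nf; exact Real.rpow_zero j
    have es : s ^ (-(3 / 4) : ℝ) * s ^ (3 : ℝ) * s ^ (-(3 / 2) : ℝ) = s ^ (3 / 4 : ℝ) := by
      rw [← Real.rpow_add hs, ← Real.rpow_add hs]; norm_num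
    rw [← es]
    linear_combination F₀ * (4 * Real.pi / 3) ^ 2 * (s ^ (-(3 / 4) : ℝ) * s ^ (3 : ℝ) * s ^ (-(3 / 2) : ℝ)) * ej
  have e2 : (∫ z, ‖z.2‖ ^ 2 * f z) / P ^ 2 ≤ 2 * s := by
    have hP2 : P ^ 2 = j / s := by
      rw [hP, ← Real.rpow_natCast, ← Real.rpow_mul (by positivity)]; norm_num
    rw [hP2, div_le_iff₀ (by positivity)]
    calc _ ≤ 2 * j := hK
      _ = _ := by field_simp
  have e3 : (∫ z, Q (f z) (angMom z.1 z.2)) / (C₁ * A ^ (1 / μ₁))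
      ≤ 1 / (C₁ * F₀ ^ (1 / μ₁)) * s ^ (3 / (4 * μ₁)) := by
    have hA1 : A ^ (1 / μ₁) = F₀ ^ (1 / μ₁) * (j * (s ^ (3 / (4 * μ₁)))⁻¹) := by
      rw [hA, Real.mul_rpow hF.le (by positivity), Real.mul_rpow (by positivity) (by positivity),
        ← Real.rpow_mul hj0.le, ← Real.rpow_mul hs.le, ← Real.rpow_neg hs.le]
      congr 2
      · rw [mul_one_div_cancel hμ.ne', Real.rpow_one]
      · congr 1; field_simp
    rw [hA1]
    have hs' : 0 < s ^ (3 / (4 * μ₁)) := by positivity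
    have hF' : 0 < F₀ ^ (1 / μ₁) := by positivity
    rw [div_le_iff₀ (by positivity)]
    calc _ ≤ j := hq
      _ = _ := by field_simp
  have d1 : s ^ (3 / 4 : ℝ) ≤ s ^ massExponent μ₁ :=
    Real.rpow_le_rpow_of_exponent_ge hs hs1 (min_le_left _ _)
  have d3 : s ^ (3 / (4 * μ₁)) ≤ s ^ massExponent μ₁ :=
    Real.rpow_le_rpow_of_exponent_ge hs hs1 (min_le_right _ _)
  have d2 : s ≤ s ^ massExponent μ₁ := by
    conv_lhs => rw [← Real.rpow_one s]
    exact Real.rpow_le_rpow_of_exponent_ge hs hs1 ((min_le_left _ _).trans (by norm_num))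
  calc massIn f r ≤ F₀ * (4 * Real.pi / 3) ^ 2 * s ^ (3 / 4 : ℝ) + 2 * s
      + 1 / (C₁ * F₀ ^ (1 / μ₁)) * s ^ (3 / (4 * μ₁)) := by linarith
    _ ≤ F₀ * (4 * Real.pi / 3) ^ 2 * s ^ massExponent μ₁ + 2 * s ^ massExponent μ₁
      + 1 / (C₁ * F₀ ^ (1 / μ₁)) * s ^ massExponent μ₁ := by gcongr
    _ = _ := by unfold massConst; ring

/-- A common majorant of the functions `m_f² / r²`. -/
def massDom (C σ M r₀ r : ℝ) : ℝ :=
  if r ≤ r₀ then C ^ 2 * (r₀⁻¹ ^ (2 * σ)) * r ^ (2 * σ - 2) else M ^ 2 * (r ^ 2)⁻¹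

/-- Integrability at the origin requires 2σ − 2 > −1, that is σ > 1/2. Both pieces scale like 1/r₀,
which is what converts the length r₀ = j^(−γ) into the power j^γ of the functional J. -/
theorem massDom_integral {C σ M r₀ : ℝ} (hσ : 1 / 2 < σ) (hr₀ : 0 < r₀) :
    IntegrableOn (massDom C σ M r₀) (Ioi 0) ∧
      ∫ r in Ioi 0, massDom C σ M r₀ r = (C ^ 2 / (2 * σ - 1) + M ^ 2) * r₀⁻¹ := by
  have e1 : EqOn (fun r => C ^ 2 * (r₀⁻¹ ^ (2 * σ)) * r ^ (2 * σ - 2)) (massDom C σ M r₀)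
      (Ioc 0 r₀) := fun r hr => by simp only [massDom, if_pos hr.2]
  have e2 : EqOn (fun r => M ^ 2 * (r ^ 2)⁻¹) (massDom C σ M r₀) (Ioi r₀) := fun r hr => by
    simp only [massDom, if_neg (not_le.2 (mem_Ioi.1 hr))]
  have i1 : IntegrableOn (fun r => C ^ 2 * (r₀⁻¹ ^ (2 * σ)) * r ^ (2 * σ - 2)) (Ioc 0 r₀) := by
    have := intervalIntegral.intervalIntegrable_rpow' (r := 2 * σ - 2) (by linarith)
      (a := 0) (b := r₀)
    rw [intervalIntegrable_iff_integrableOn_Ioc_of_le hr₀.le] at this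
    exact this.const_mul _
  have i2 : IntegrableOn (fun r => M ^ 2 * (r ^ 2)⁻¹) (Ioi r₀) :=
    (integrableOn_Ioi_inv_sq hr₀).const_mul _
  have j1 := i1.congr_fun e1 measurableSet_Ioc
  have j2 := i2.congr_fun e2 measurableSet_Ioi
  rw [← Ioc_union_Ioi_eq_Ioi hr₀.le]
  refine ⟨j1.union j2, ?_⟩
  rw [setIntegral_union (Ioc_disjoint_Ioi le_rfl) measurableSet_Ioi j1 j2,
    ← setIntegral_congr_fun measurableSet_Ioc e1, ← setIntegral_congr_fun measurableSet_Ioi e2,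
    integral_const_mul, integral_const_mul, integral_Ioi_inv_sq hr₀,
    ← intervalIntegral.integral_of_le hr₀.le, integral_rpow (Or.inl (by linarith)),
    Real.zero_rpow (by linarith), Real.inv_rpow hr₀.le]
  have h1 : r₀ ^ (2 * σ - 2 + 1) = r₀ ^ (2 * σ) * r₀⁻¹ := by
    rw [show 2 * σ - 2 + 1 = 2 * σ + (-1) by ring, Real.rpow_add hr₀, Real.rpow_neg_one]
  rw [h1, show 2 * σ - 2 + 1 = 2 * σ - 1 by ring]
  have h2 : 0 < r₀ ^ (2 * σ) := by positivity
  have h3 : 2 * σ - 1 ≠ 0 := by linarith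
  field_simp
  ring

theorem CasimirAssumptions.massIn_sq_le_massDom
    (hQ : CasimirAssumptions Q μ₁ μ₂ μ₃ C₁ C₂ C₃ C₄ F₀) (hf : Admissible Q M f) {j r : ℝ}
    (hj : 1 ≤ j) (hJ : casimirKinetic Q f ≤ j) (hr : 0 < r) :
    massIn f r * massIn f r * (r ^ 2)⁻¹
      ≤ massDom (massConst μ₁ C₁ F₀) (massExponent μ₁) M (j ^ (-fieldExponent μ₁)) r := by
  have hj0 : 0 < j := by linarith
  have h0 := hf.isRadial.massIn_nonneg r
  set r₀ := j ^ (-fieldExponent μ₁) with hr₀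
  have hr₀p : 0 < r₀ := by positivity
  unfold massDom
  split_ifs with h
  · have h1 := hQ.massIn_le_rpow hf hj hJ (s := r / r₀) (by positivity) ((div_le_one hr₀p).2 h)
    rw [← hr₀, mul_div_cancel₀ _ hr₀p.ne'] at h1
    have h2 : massIn f r * massIn f r
        ≤ (massConst μ₁ C₁ F₀ * (r / r₀) ^ massExponent μ₁) ^ 2 := by
      rw [← sq]; exact pow_le_pow_left₀ h0 h1 2
    calc _ ≤ (massConst μ₁ C₁ F₀ * (r / r₀) ^ massExponent μ₁) ^ 2 * (r ^ 2)⁻¹ := by gcongr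
      _ = _ := by
        have e : ((r / r₀) ^ massExponent μ₁) ^ 2
            = r₀⁻¹ ^ (2 * massExponent μ₁) * (r ^ (2 * massExponent μ₁ - 2) * r ^ 2) := by
          rw [← Real.rpow_natCast, ← Real.rpow_mul (by positivity), div_eq_inv_mul,
            Real.mul_rpow (by positivity) hr.le, ← Real.rpow_natCast r, ← Real.rpow_add hr]
          congr 2 <;> push_cast <;> ring
        rw [mul_pow, e]
        field_simp
  · have h1 := hf.isRadial.massIn_le r
    rw [hf.mass] at h1
    rw [← sq]
    gcongr

theorem CasimirAssumptions.integrableOn_massIn_mul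
    (hQ : CasimirAssumptions Q μ₁ μ₂ μ₃ C₁ C₂ C₃ C₄ F₀) {M' : ℝ} (hf : Admissible Q M f)
    (hg : Admissible Q M' g) :
    IntegrableOn (fun r => massIn f r * massIn g r * (r ^ 2)⁻¹) (Ioi 0) := by
  have hm : ∀ {f g : E3 × E3 → ℝ}, IsRadial f → IsRadial g →
      Measurable (fun r => massIn f r * massIn g r * (r ^ 2)⁻¹) := fun hf hg =>
    (hf.continuous_massIn.measurable.mul hg.continuous_massIn.measurable).mul (by fun_prop)
  have hsq : ∀ {M : ℝ} {f : E3 × E3 → ℝ}, Admissible Q M f →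
      IntegrableOn (fun r => massIn f r * massIn f r * (r ^ 2)⁻¹) (Ioi 0) := by
    intro M f hf
    have hj : 1 ≤ max 1 (casimirKinetic Q f) := le_max_left _ _
    refine Integrable.mono' (massDom_integral (C := massConst μ₁ C₁ F₀) (M := M)
      hQ.half_lt_massExponent
      (Real.rpow_pos_of_pos (zero_lt_one.trans_le hj) (-fieldExponent μ₁))).1
      (hm hf.isRadial hf.isRadial).aestronglyMeasurable ?_
    refine (ae_restrict_iff' measurableSet_Ioi).2 (ae_of_all _ fun r hr => ?_)
    rw [Real.norm_of_nonneg]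
    · exact hQ.massIn_sq_le_massDom hf hj (le_max_right _ _) hr
    · have := hf.isRadial.massIn_nonneg r
      positivity
  refine Integrable.mono' ((hsq hf).add (hsq hg))
    (hm hf.isRadial hg.isRadial).aestronglyMeasurable (ae_of_all _ fun r => ?_)
  have h1 := hf.isRadial.massIn_nonneg r
  have h2 := hg.isRadial.massIn_nonneg r
  rw [Real.norm_of_nonneg (by positivity)]
  simp only [Pi.add_apply]
  rw [← add_mul]
  gcongr
  nlinarith [sq_nonneg (massIn f r - massIn g r), mul_nonneg h1 h2]

/-- The exponent `fieldExponent` is below 1 when μ₁ < 3/2: gravity is of lower order than J, which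
is the source of coercivity. -/
theorem CasimirAssumptions.potEnergy_le
    (hQ : CasimirAssumptions Q μ₁ μ₂ μ₃ C₁ C₂ C₃ C₄ F₀) (hf : Admissible Q M f) {j : ℝ}
    (hj : 1 ≤ j) (hJ : casimirKinetic Q f ≤ j) :
    potEnergy f f ≤ (massConst μ₁ C₁ F₀ ^ 2 / (2 * massExponent μ₁ - 1) + M ^ 2)
      * j ^ fieldExponent μ₁ := by
  have hj0 : 0 < j := by linarith
  have h := massDom_integral (C := massConst μ₁ C₁ F₀) (M := M) hQ.half_lt_massExponent
    (Real.rpow_pos_of_pos hj0 (-fieldExponent μ₁))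
  rw [Real.rpow_neg hj0.le, inv_inv, ← Real.rpow_neg hj0.le] at h
  rw [← h.2]
  exact setIntegral_mono_on (hQ.integrableOn_massIn_mul hf hf) h.1 measurableSet_Ioi
    fun r hr => hQ.massIn_sq_le_massDom hf hj hJ hr

/-- `J` is bounded on sublevel sets of the energy-Casimir functional. -/
theorem CasimirAssumptions.exists_casimirKinetic_le
    (hQ : CasimirAssumptions Q μ₁ μ₂ μ₃ C₁ C₂ C₃ C₄ F₀) (M d : ℝ) :
    ∃ j : ℝ, 1 ≤ j ∧ ∀ f, Admissible Q M f → energyCasimir Q f ≤ d → casimirKinetic Q f ≤ j := by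
  set B := massConst μ₁ C₁ F₀ ^ 2 / (2 * massExponent μ₁ - 1) + M ^ 2 with hB
  have hγ : fieldExponent μ₁ < 1 := by
    unfold fieldExponent; linarith [hQ.mu1.2]
  have h1 : Tendsto (fun x : ℝ => B * x ^ (fieldExponent μ₁ - 1)) atTop (𝓝 0) := by
    have := (tendsto_rpow_neg_atTop (y := 1 - fieldExponent μ₁) (by linarith)).const_mul B
    simpa using this
  obtain ⟨X, hX⟩ := eventually_atTop.1 ((h1.eventually (gt_mem_nhds (zero_lt_one))).and
    (eventually_ge_atTop 1))
  -- Beyond X the field term satisfies B·J^γ ≤ J, so D ≥ J − J/2 = J/2; the threshold 2d then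
  -- contradicts D ≤ d.
  refine ⟨max (max X 1) (2 * d), le_max_of_le_left (le_max_right _ _), fun f hf hd => ?_⟩
  by_contra hcon
  push Not at hcon
  set x := casimirKinetic Q f with hx
  obtain ⟨hx1, hx2⟩ := max_lt_iff.1 hcon
  have hx1' := max_lt_iff.1 hx1
  have hb := (hX x hx1'.1.le).1
  have hx0 : 0 < x := by linarith [hx1'.2]
  have h2 := hQ.potEnergy_le hf hx1'.2.le le_rfl
  rw [← hB] at h2
  rw [hf.isRadial.energyCasimir_eq] at hd
  have h3 : B * x ^ fieldExponent μ₁ = (B * x ^ (fieldExponent μ₁ - 1)) * x := by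
    rw [Real.rpow_sub hx0, Real.rpow_one]; field_simp
  have h4 : (B * x ^ (fieldExponent μ₁ - 1)) * x ≤ 1 * x := by gcongr
  linarith

end

/-! ### Exact expansion of the energy-Casimir functional -/

section
variable {Q : ℝ → ℝ → ℝ} {μ₁ μ₂ μ₃ C₁ C₂ C₃ C₄ F₀ M : ℝ} {f g : E3 × E3 → ℝ}

theorem ae_fst_ne_zero : ∀ᵐ z : E3 × E3, z.1 ≠ 0 := by
  filter_upwards [ae_norm_fst_ne 0] with z hz h
  exact hz (by simp [h])

/-- The mutual potential energy of two radial densities. -/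
theorem IsRadial.integral_potential_mul (hf : IsRadial f) (hg : IsRadial g)
    (hi : IntegrableOn (fun r => massIn f r * massIn g r * (r ^ 2)⁻¹) (Ioi 0)) :
    Integrable (fun z => potential f z.1 * g z) ∧
      ∫ z, potential f z.1 * g z = -potEnergy f g := by
  set φ : ℝ → ℝ := fun s => massIn f s * (s ^ 2)⁻¹ with hφ
  have hφm : Measurable φ := hf.continuous_massIn.measurable.mul (by fun_prop)
  -- F is the integrand over pairs of a particle and a radius outside it. Integrating in the radius
  -- first gives −U_f g, integrating in phase space first gives m_f m_g/s².
  set F : (E3 × E3) × ℝ → ℝ := fun p =>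
    {p : (E3 × E3) × ℝ | ‖p.1.1‖ ≤ p.2}.indicator (fun p => g p.1 * φ p.2) p with hF
  have hFs : AEStronglyMeasurable F
      ((volume : Measure (E3 × E3)).prod (volume.restrict (Ioi 0))) := by
    refine AEStronglyMeasurable.indicator ?_ (measurableSet_le (by fun_prop) measurable_snd)
    exact hg.integrable.aestronglyMeasurable.comp_fst.mul
      hφm.aestronglyMeasurable.comp_snd
  have hslice : ∀ s : ℝ, (fun z => F (z, s)) = {z : E3 × E3 | ‖z.1‖ ≤ s}.indicator
      (fun z => g z * φ s) := fun s => rfl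
  have hFi : Integrable F ((volume : Measure (E3 × E3)).prod (volume.restrict (Ioi 0))) := by
    rw [integrable_prod_iff' hFs]
    refine ⟨ae_of_all _ fun s => ?_, ?_⟩
    · rw [hslice]
      exact (hg.integrable.mul_const _).indicator (measurableSet_norm_fst_le s)
    · have : ∀ s : ℝ, ∫ z, ‖F (z, s)‖ = massIn f s * massIn g s * (s ^ 2)⁻¹ := by
        intro s
        have h1 : ∫ z, ‖F (z, s)‖ = ∫ z, {z : E3 × E3 | ‖z.1‖ ≤ s}.indicator
            (fun z => g z * φ s) z := by
          refine integral_congr_ae ?_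
          filter_upwards [hg.nonneg] with z hz
          rw [← hslice, Real.norm_of_nonneg]
          have h0 : 0 ≤ g z * φ s := mul_nonneg hz (mul_nonneg (hf.massIn_nonneg s) (by positivity))
          simp only [hF, indicator]
          split_ifs
          · exact h0
          · exact le_rfl
        rw [h1, integral_indicator (measurableSet_norm_fst_le s), integral_mul_const, ← massIn]
        simp only [hφ]; ring
      simp only [this]
      exact hi
  have h1 : ∀ᵐ z : E3 × E3, ∫ s in Ioi (0:ℝ), F (z, s) = -(potential f z.1 * g z) := by
    filter_upwards [ae_fst_ne_zero] with z hz
    rw [hf.potential_eq_integral hz]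
    have : ∀ s : ℝ, F (z, s) = g z * (Ici ‖z.1‖).indicator φ s := by
      intro s; simp [hF, indicator]
    simp only [this]
    rw [integral_const_mul, setIntegral_indicator measurableSet_Ici]
    have : (Ioi (0:ℝ) ∩ Ici ‖z.1‖ : Set ℝ) = Ici ‖z.1‖ := by
      refine inter_eq_right.2 fun s hs => ?_
      exact lt_of_lt_of_le (norm_pos_iff.2 hz) hs
    rw [this, integral_Ici_eq_integral_Ioi]
    ring
  have h2 : ∀ s : ℝ, ∫ z, F (z, s) = massIn f s * massIn g s * (s ^ 2)⁻¹ := by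
    intro s
    rw [hslice, integral_indicator (measurableSet_norm_fst_le s), integral_mul_const, ← massIn]
    simp only [hφ]; ring
  refine ⟨?_, ?_⟩
  · have := hFi.integral_prod_left.neg.congr (g := fun z => potential f z.1 * g z) (by
      filter_upwards [h1] with z hz
      simp only [Pi.neg_apply]
      rw [hz, neg_neg])
    exact this
  · have h3 := integral_integral_swap (μ := (volume : Measure (E3 × E3)))
      (ν := volume.restrict (Ioi (0:ℝ))) (f := fun z s => F (z, s)) hFi
    simp only [h2] at h3
    rw [integral_congr_ae h1, integral_neg] at h3
    rw [potEnergy]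
    linarith

/-- `D` is expanded exactly around any state: the distance `d` plus the field part is
`D(f) - D(f₀)` plus the square of the field distance. -/
theorem CasimirAssumptions.totalDist_eq
    (hQ : CasimirAssumptions Q μ₁ μ₂ μ₃ C₁ C₂ C₃ C₄ F₀) (hf : Admissible Q M f)
    (hg : Admissible Q M g) :
    totalDist Q M f g = energyCasimir Q f - energyCasimir Q g
      + ∫ r in Ioi (0 : ℝ), (massIn f r - massIn g r) ^ 2 * (r ^ 2)⁻¹ := by
  have iff := hQ.integrableOn_massIn_mul hf hf
  have igf := hQ.integrableOn_massIn_mul hg hf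
  have igg := hQ.integrableOn_massIn_mul hg hg
  obtain ⟨p1, q1⟩ := hg.isRadial.integral_potential_mul hf.isRadial igf
  obtain ⟨p2, q2⟩ := hg.isRadial.integral_potential_mul hg.isRadial igg
  have hd : casimirDist Q M f g
      = (∫ z : E3 × E3, Q (f z) (angMom z.1 z.2)) - (∫ z : E3 × E3, Q (g z) (angMom z.1 z.2))
        + (1 / 2 * (∫ z : E3 × E3, ‖z.2‖ ^ 2 * f z) - 1 / 2 * (∫ z : E3 × E3, ‖z.2‖ ^ 2 * g z))
        + ((∫ z : E3 × E3, potential g z.1 * f z) - (∫ z : E3 × E3, potential g z.1 * g z)) := by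
    set q : (E3 × E3 → ℝ) → E3 × E3 → ℝ := fun f z => Q (f z) (angMom z.1 z.2) with hq
    set k : (E3 × E3 → ℝ) → E3 × E3 → ℝ := fun f z => ‖z.2‖ ^ 2 * f z with hk
    set p : (E3 × E3 → ℝ) → E3 × E3 → ℝ := fun f z => potential g z.1 * f z with hp
    have k1 : Integrable (fun z => q f z - q g z) := hf.casimir_finite.sub hg.casimir_finite
    have k2 : Integrable (fun z => 1 / 2 * (k f z - k g z)) :=
      (hf.kinetic_finite.sub hg.kinetic_finite).const_mul _
    have k3 : Integrable (fun z => p f z - p g z) := p1.sub p2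
    have k4 : Integrable (fun z => cutoffEnergy Q M g * (f z - g z)) :=
      (hf.integrable.sub hg.integrable).const_mul _
    have e : casimirDist Q M f g = ∫ z : E3 × E3, ((q f z - q g z) + 1 / 2 * (k f z - k g z))
        + ((p f z - p g z) - cutoffEnergy Q M g * (f z - g z)) := by
      refine integral_congr_ae (ae_of_all _ fun z => ?_)
      simp only [hq, hk, hp, particleEnergy]
      ring
    have k12 : Integrable (fun z => (q f z - q g z) + 1 / 2 * (k f z - k g z)) := k1.add k2
    have k34 : Integrable (fun z => (p f z - p g z) - cutoffEnergy Q M g * (f z - g z)) := k3.sub k4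
    -- The term with the cut-off energy is a multiple of M − M and disappears, so its particular
    -- value plays no role in this identity.
    rw [e, integral_add k12 k34, integral_add k1 k2, integral_sub k3 k4,
      integral_sub hf.casimir_finite hg.casimir_finite, integral_const_mul,
      integral_sub hf.kinetic_finite hg.kinetic_finite, integral_const_mul,
      integral_sub p1 p2, integral_sub hf.integrable hg.integrable, hf.mass, hg.mass]
    ring
  have hsq : ∫ r in Ioi (0 : ℝ), (massIn f r - massIn g r) ^ 2 * (r ^ 2)⁻¹
      = potEnergy f f - 2 * potEnergy g f + potEnergy g g := by
    have : ∀ r, (massIn f r - massIn g r) ^ 2 * (r ^ 2)⁻¹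
        = massIn f r * massIn f r * (r ^ 2)⁻¹ - 2 * (massIn g r * massIn f r * (r ^ 2)⁻¹)
          + massIn g r * massIn g r * (r ^ 2)⁻¹ := fun r => by ring
    simp only [this]
    rw [integral_add (by exact iff.sub (igf.const_mul 2)) igg, integral_sub iff (igf.const_mul 2),
      integral_const_mul]
    rfl
  rw [totalDist, hf.isRadial.integral_field_sub_sq hg.isRadial, hd, q1, q2,
    hf.isRadial.energyCasimir_eq, hg.isRadial.energyCasimir_eq, hsq]
  unfold casimirKinetic
  have := Real.pi_pos
  field_simp
  ring

/-- The two quantities differ by a square. Applied with g a minimizer, this turns closeness to that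
minimizer into closeness of D to its minimum. -/
theorem CasimirAssumptions.energyCasimir_sub_le_totalDist
    (hQ : CasimirAssumptions Q μ₁ μ₂ μ₃ C₁ C₂ C₃ C₄ F₀) (hf : Admissible Q M f)
    (hg : Admissible Q M g) : energyCasimir Q f - energyCasimir Q g ≤ totalDist Q M f g := by
  rw [hQ.totalDist_eq hf hg]
  have : 0 ≤ ∫ r in Ioi (0 : ℝ), (massIn f r - massIn g r) ^ 2 * (r ^ 2)⁻¹ :=
    integral_nonneg fun r => by simp only [Pi.zero_apply]; positivity
  linarith

end

/-! ### Dilations and monotonicity in the mass -/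

section
variable {Q : ℝ → ℝ → ℝ} {μ₁ μ₂ μ₃ C₁ C₂ C₃ C₄ F₀ M : ℝ} {f g : E3 × E3 → ℝ}

theorem continuous_angMom : Continuous (fun z : E3 × E3 => angMom z.1 z.2) := by
  unfold angMom
  fun_prop

/-- Q is controlled only on the closed quadrant; clamping both arguments gives a globally continuous
function that agrees with Q on it, suited to measurability and limit arguments. -/
theorem CasimirAssumptions.continuous_max
    (hQ : CasimirAssumptions Q μ₁ μ₂ μ₃ C₁ C₂ C₃ C₄ F₀) :
    Continuous (fun p : ℝ × ℝ => Q (max p.1 0) (max p.2 0)) := by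
  have h : ContinuousOn ((fun p : ℝ × ℝ => Q p.1 p.2) ∘ fun p : ℝ × ℝ => (max p.1 0, max p.2 0))
      univ :=
    hQ.continuousOn.comp (by fun_prop) fun p _ =>
      ⟨mem_Ici.2 (le_max_right _ _), mem_Ici.2 (le_max_right _ _)⟩
  exact continuousOn_univ.1 h

theorem CasimirAssumptions.aestronglyMeasurable
    (hQ : CasimirAssumptions Q μ₁ μ₂ μ₃ C₁ C₂ C₃ C₄ F₀)
    (hf : AEStronglyMeasurable f) (h0 : ∀ᵐ z, 0 ≤ f z) :
    AEStronglyMeasurable (fun z : E3 × E3 => Q (f z) (angMom z.1 z.2)) := by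
  have h : AEStronglyMeasurable (fun z : E3 × E3 => Q (max (f z) 0) (max (angMom z.1 z.2) 0)) :=
    hQ.continuous_max.comp_aestronglyMeasurable
      (hf.prodMk continuous_angMom.aestronglyMeasurable)
  refine h.congr ?_
  filter_upwards [h0] with z hz
  simp only [max_eq_left hz, max_eq_left (angMom_nonneg _ _)]

theorem CasimirAssumptions.zero (hQ : CasimirAssumptions Q μ₁ μ₂ μ₃ C₁ C₂ C₃ C₄ F₀) {L : ℝ}
    (hL : 0 ≤ L) : Q 0 L = 0 := by
  refine le_antisymm ?_ (hQ.nonneg 0 L le_rfl hL)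
  have h := hQ.q2 0 L le_rfl hQ.F0_pos.le hL
  have hμ := hQ.mu2.1
  rwa [Real.zero_rpow (by positivity), mul_zero] at h

theorem angMom_smul (a b : ℝ) (x v : E3) :
    angMom (a • x) (b • v) = (a * b) ^ 2 * angMom x v := by
  simp only [angMom, norm_smul, inner_smul_left, inner_smul_right, mul_pow, Real.norm_eq_abs, sq_abs,
    conj_trivial]
  ring

/-- Anisotropic dilation of phase space. -/
def dilate (a b : ℝ) (z : E3 × E3) : E3 × E3 := (a • z.1, b • z.2)

theorem measurableEmbedding_dilate {a b : ℝ} (ha : a ≠ 0) (hb : b ≠ 0) :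
    MeasurableEmbedding (dilate a b) :=
  ((Homeomorph.smulOfNeZero a ha).prodCongr (Homeomorph.smulOfNeZero b hb)).measurableEmbedding

theorem map_dilate {a b : ℝ} (ha : 0 < a) (hb : 0 < b) :
    (volume : Measure (E3 × E3)).map (dilate a b) = ENNReal.ofReal ((a * b) ^ 3)⁻¹ • volume := by
  have h1 : Measure.map (fun x : E3 => a • x) volume = ENNReal.ofReal (a ^ 3)⁻¹ • volume := by
    rw [Measure.map_addHaar_smul volume ha.ne']
    simp [abs_of_pos ha]
  have h2 : Measure.map (fun x : E3 => b • x) volume = ENNReal.ofReal (b ^ 3)⁻¹ • volume := by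
    rw [Measure.map_addHaar_smul volume hb.ne']
    simp [abs_of_pos hb]
  have h3 : dilate a b = Prod.map (fun x : E3 => a • x) (fun x : E3 => b • x) := rfl
  rw [h3, Measure.volume_eq_prod, ← Measure.map_prod_map _ _ (by fun_prop) (by fun_prop), h1, h2,
    Measure.prod_smul_left, Measure.prod_smul_right, smul_smul, ← ENNReal.ofReal_mul (by positivity)]
  congr 2
  rw [mul_pow, mul_inv]

theorem ae_dilate {a b : ℝ} (ha : 0 < a) (hb : 0 < b) {p : E3 × E3 → Prop} (h : ∀ᵐ z, p z) :
    ∀ᵐ z, p (dilate a b z) := by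
  have : ∀ᵐ z ∂((volume : Measure (E3 × E3)).map (dilate a b)), p z := by
    rw [map_dilate ha hb]
    exact Measure.ae_smul_measure h _
  exact ae_of_ae_map (measurableEmbedding_dilate ha.ne' hb.ne').measurable.aemeasurable this

theorem integral_dilate {a b : ℝ} (ha : 0 < a) (hb : 0 < b) (h : E3 × E3 → ℝ) :
    ∫ z, h (dilate a b z) = ((a * b) ^ 3)⁻¹ * ∫ z, h z := by
  rw [← (measurableEmbedding_dilate ha.ne' hb.ne').integral_map, map_dilate ha hb,
    integral_smul_measure, ENNReal.toReal_ofReal (by positivity), smul_eq_mul]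

theorem integrable_dilate {a b : ℝ} (ha : 0 < a) (hb : 0 < b) {h : E3 × E3 → ℝ}
    (hh : Integrable h) : Integrable (fun z => h (dilate a b z)) := by
  have := (measurableEmbedding_dilate ha.ne' hb.ne').integrable_map_iff
    (μ := (volume : Measure (E3 × E3))) (g := h)
  rw [map_dilate ha hb] at this
  exact this.1 (hh.smul_measure ENNReal.ofReal_ne_top)

theorem massIn_dilate {a b : ℝ} (ha : 0 < a) (hb : 0 < b) (A : ℝ) (g : E3 × E3 → ℝ) (r : ℝ) :
    massIn (fun z => A * g (dilate a b z)) r = A * ((a * b) ^ 3)⁻¹ * massIn g (a * r) := by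
  have h := integral_dilate ha hb ({z : E3 × E3 | ‖z.1‖ ≤ a * r}.indicator g)
  rw [massIn, massIn, ← integral_indicator (measurableSet_norm_fst_le _),
    ← integral_indicator (measurableSet_norm_fst_le _), mul_assoc, ← h, ← integral_const_mul]
  refine integral_congr_ae (ae_of_all _ fun z => ?_)
  have : ‖a • z.1‖ ≤ a * r ↔ ‖z.1‖ ≤ r := by
    rw [norm_smul, Real.norm_of_nonneg ha.le, mul_le_mul_iff_right₀ ha]
  simp [indicator, dilate, this]

theorem potEnergy_dilate {a b : ℝ} (ha : 0 < a) (hb : 0 < b) (A : ℝ) (g : E3 × E3 → ℝ) :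
    potEnergy (fun z => A * g (dilate a b z)) (fun z => A * g (dilate a b z))
      = (A * ((a * b) ^ 3)⁻¹) ^ 2 * a * potEnergy g g := by
  have h := integral_comp_mul_left_Ioi (fun r => massIn g r * massIn g r * (r ^ 2)⁻¹) 0 ha
  rw [mul_zero] at h
  have h2 : potEnergy g g = a * ∫ x in Ioi (0:ℝ), massIn g (a * x) * massIn g (a * x) * ((a * x) ^ 2)⁻¹ := by
    rw [h, smul_eq_mul, potEnergy]; field_simp
  rw [h2, ← integral_const_mul, ← integral_const_mul, potEnergy]
  refine integral_congr_ae (ae_of_all _ fun r => ?_)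
  simp only [massIn_dilate ha hb]
  field_simp

/-- Dilations act on the constraint set, and on the energy-Casimir functional. -/
theorem CasimirAssumptions.admissible_dilate
    (hQ : CasimirAssumptions Q μ₁ μ₂ μ₃ C₁ C₂ C₃ C₄ F₀) (hg : Admissible Q M g)
    {A a b κ : ℝ} (hA : 0 < A) (ha : 0 < a) (hb : 0 < b)
    (hκ : ∀ᵐ z : E3 × E3, Q (A * g (dilate a b z)) (angMom z.1 z.2)
      ≤ κ * Q (g (dilate a b z)) (angMom (dilate a b z).1 (dilate a b z).2)) :
    Admissible Q (A * ((a * b) ^ 3)⁻¹ * M) (fun z => A * g (dilate a b z)) ∧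
      energyCasimir Q (fun z => A * g (dilate a b z))
        ≤ ((a * b) ^ 3)⁻¹ * (κ * (∫ z, Q (g z) (angMom z.1 z.2))
            + A * (b ^ 2)⁻¹ * (1 / 2 * ∫ z, ‖z.2‖ ^ 2 * g z))
          - 1 / 2 * ((A * ((a * b) ^ 3)⁻¹) ^ 2 * a * potEnergy g g) := by
  have hnn : ∀ᵐ z, 0 ≤ A * g (dilate a b z) := by
    filter_upwards [ae_dilate ha hb hg.nonneg] with z hz
    exact mul_nonneg hA.le hz
  have hint : Integrable (fun z => A * g (dilate a b z)) :=
    (integrable_dilate ha hb hg.integrable).const_mul A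
  have hQi' := (integrable_dilate ha hb hg.casimir_finite).const_mul κ
  have hQi : Integrable (fun z : E3 × E3 => Q (A * g (dilate a b z)) (angMom z.1 z.2)) := by
    refine hQi'.mono' (hQ.aestronglyMeasurable hint.1 hnn) ?_
    filter_upwards [hκ, hQ.casimir_ae_nonneg hnn] with z hz hz0
    rw [Real.norm_of_nonneg hz0]
    exact hz
  have hk : ∀ z : E3 × E3, ‖z.2‖ ^ 2 * (A * g (dilate a b z))
      = A * (b ^ 2)⁻¹ * (‖(dilate a b z).2‖ ^ 2 * g (dilate a b z)) := by
    intro z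
    simp only [dilate, norm_smul, Real.norm_of_nonneg hb.le, mul_pow]
    field_simp
  have hadm : Admissible Q (A * ((a * b) ^ 3)⁻¹ * M) (fun z => A * g (dilate a b z)) := by
    refine ⟨hint, hnn, ?_, hQi, ?_, ?_⟩
    · rw [integral_const_mul, integral_dilate ha hb, hg.mass, mul_assoc]
    · simp only [hk]
      exact (integrable_dilate ha hb hg.kinetic_finite).const_mul _
    · intro B hB
      filter_upwards [ae_dilate ha hb (hg.symmetric B hB)] with z hz
      simp only [dilate] at hz ⊢
      rw [← hz, map_smul, map_smul]
  refine ⟨hadm, ?_⟩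
  rw [hadm.isRadial.energyCasimir_eq, potEnergy_dilate ha hb]
  have h1 : ∫ z : E3 × E3, Q (A * g (dilate a b z)) (angMom z.1 z.2)
      ≤ κ * (((a * b) ^ 3)⁻¹ * ∫ z, Q (g z) (angMom z.1 z.2)) := by
    rw [← integral_dilate ha hb (fun z => Q (g z) (angMom z.1 z.2)), ← integral_const_mul]
    exact integral_mono_ae hQi hQi' hκ
  have h2 : ∫ z : E3 × E3, ‖z.2‖ ^ 2 * (A * g (dilate a b z))
      = A * (b ^ 2)⁻¹ * (((a * b) ^ 3)⁻¹ * ∫ z, ‖z.2‖ ^ 2 * g z) := by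
    simp only [hk]
    rw [integral_const_mul, integral_dilate ha hb (fun z => ‖z.2‖ ^ 2 * g z)]
  unfold casimirKinetic
  rw [h2]
  linarith

/-- Negative energy can be lowered by increasing the mass. -/
theorem CasimirAssumptions.exists_lower
    (hQ : CasimirAssumptions Q μ₁ μ₂ μ₃ C₁ C₂ C₃ C₄ F₀) {M₀ : ℝ} (hg : Admissible Q M₀ g)
    (hM₀ : 0 < M₀) (hM : M₀ < M) (hD : energyCasimir Q g < 0) :
    ∃ f, Admissible Q M f ∧ energyCasimir Q f < energyCasimir Q g := by
  have hDg := hg.isRadial.energyCasimir_eq (Q := Q)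
  have hQn := integral_nonneg_of_ae (hQ.casimir_ae_nonneg hg.nonneg)
  have hKn := integral_nonneg_of_ae (kinetic_ae_nonneg hg.nonneg)
  rw [casimirKinetic] at hDg
  set JQ := ∫ z, Q (g z) (angMom z.1 z.2)
  set K := ∫ z : E3 × E3, ‖z.2‖ ^ 2 * g z
  by_cases hμ : μ₃ < 1 / 2
  -- Spread in space only, by the factor 1/a > 1. The Casimir and kinetic integrals scale by a⁻³,
  -- the mass likewise, and the field energy by a⁻⁵. The dilated argument has angular momentum a²L ≤
  -- L, so monotonicity of Q in L has the right direction.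
  · set a := (M₀ / M) ^ (1 / 3 : ℝ) with ha
    have hMp : 0 < M := hM₀.trans hM
    have ha0 : 0 < a := by positivity
    have ha3 : a ^ 3 = M₀ / M := by
      rw [ha, ← Real.rpow_natCast, ← Real.rpow_mul (by positivity)]; norm_num
    have ha1 : a < 1 := Real.rpow_lt_one (by positivity) ((div_lt_one hMp).2 hM) (by norm_num)
    have hκ : ∀ᵐ z : E3 × E3, Q (1 * g (dilate a 1 z)) (angMom z.1 z.2)
      ≤ 1 * Q (g (dilate a 1 z)) (angMom (dilate a 1 z).1 (dilate a 1 z).2) := by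
      filter_upwards [ae_dilate ha0 one_pos hg.nonneg] with z hz
      rw [one_mul, one_mul]
      refine hQ.q3_antitone hμ _ hz (angMom_nonneg _ _) (angMom_nonneg z.1 z.2) ?_
      rw [dilate, angMom_smul, mul_one]
      have := angMom_nonneg z.1 z.2
      have h2 : a ^ 2 ≤ 1 := pow_le_one₀ ha0.le ha1.le
      nlinarith
    obtain ⟨h1, h2⟩ := hQ.admissible_dilate hg one_pos ha0 one_pos hκ
    refine ⟨_, ?_, h2.trans_lt ?_⟩
    · convert h1 using 1
      rw [mul_one, ha3]; field_simp
    · have e : (1 * ((a * 1) ^ 3)⁻¹) ^ 2 * a = (a ^ 3)⁻¹ * (a ^ 2)⁻¹ := by field_simp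
      rw [e, mul_one]
      have i1 : 1 < (a ^ 3)⁻¹ := by
        rw [one_lt_inv₀ (by positivity)]; exact pow_lt_one₀ ha0.le ha1 (by norm_num)
      have i2 : 1 < (a ^ 2)⁻¹ := by
        rw [one_lt_inv₀ (by positivity)]; exact pow_lt_one₀ ha0.le ha1 (by norm_num)
      set u := (a ^ 3)⁻¹
      set w := (a ^ 2)⁻¹
      set p := potEnergy g g
      -- Negative total energy together with J ≥ 0 forces a positive field energy, which may
      -- therefore be multiplied by the larger factor.
      have hp : 0 < p := by
        have hQn' : 0 ≤ JQ := hQn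
        have hKn' : 0 ≤ K := hKn
        linarith
      have h3 : u * (JQ + 1 / 2 * K - 1 / 2 * (w * p)) ≤ u * energyCasimir Q g := by
        rw [hDg]
        have : p ≤ w * p := by nlinarith
        gcongr
      have h4 : u * energyCasimir Q g < energyCasimir Q g := by nlinarith
      norm_num
      linarith
  -- The map (x, v) ↦ (Ax, v/A) preserves volume and L. With amplitude factor A the mass scales by
  -- A, and the kinetic and field energies by A³; the Casimir integral scales by at most A^(1 +
  -- 1/μ₃) ≤ A³, because μ₃ ≥ 1/2. Hence the new energy is at most A³ D(g) < D(g).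
  · set A := M / M₀ with hA
    have hA1 : 1 < A := (one_lt_div hM₀).2 hM
    have hA0 : 0 < A := by linarith
    have hκ : ∀ᵐ z : E3 × E3, Q (A * g (dilate A A⁻¹ z)) (angMom z.1 z.2)
      ≤ A ^ 3 * Q (g (dilate A A⁻¹ z)) (angMom (dilate A A⁻¹ z).1 (dilate A A⁻¹ z).2) := by
      filter_upwards [ae_dilate hA0 (inv_pos.2 hA0) hg.nonneg] with z hz
      rw [show angMom (dilate A A⁻¹ z).1 (dilate A A⁻¹ z).2 = angMom z.1 z.2 by
        rw [dilate, angMom_smul, mul_inv_cancel₀ hA0.ne']; ring]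
      set c := g (dilate A A⁻¹ z)
      have h := hQ.q3 A⁻¹ (A * c) (angMom z.1 z.2) (by positivity) (inv_le_one_of_one_le₀ hA1.le)
        (by positivity) (angMom_nonneg _ _)
      rw [inv_mul_cancel_left₀ hA0.ne', Real.inv_rpow hA0.le, inv_mul_le_iff₀ (by positivity)] at h
      refine h.trans ?_
      have hQc := hQ.nonneg c _ hz (angMom_nonneg z.1 z.2)
      have : A ^ (1 + 1 / μ₃) ≤ A ^ 3 := by
        rw [← Real.rpow_natCast]
        refine Real.rpow_le_rpow_of_exponent_le hA1.le ?_
        have : 1 / μ₃ ≤ 2 := by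
          rw [div_le_iff₀ hQ.mu3.1]; linarith [not_lt.1 hμ]
        push_cast; linarith
      gcongr
    obtain ⟨h1, h2⟩ := hQ.admissible_dilate hg hA0 hA0 (inv_pos.2 hA0) hκ
    rw [mul_inv_cancel₀ hA0.ne'] at h1 h2
    refine ⟨_, ?_, h2.trans_lt ?_⟩
    · convert h1 using 1
      rw [hA]; field_simp
    · have e : ((1:ℝ) ^ 3)⁻¹ * (A ^ 3 * JQ + A * (A⁻¹ ^ 2)⁻¹ * (1 / 2 * K))
          - 1 / 2 * ((A * ((1:ℝ) ^ 3)⁻¹) ^ 2 * A * potEnergy g g) = A ^ 3 * energyCasimir Q g := by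
        rw [hDg]; field_simp
      rw [e]
      have : 1 < A ^ 3 := one_lt_pow₀ hA1 (by norm_num)
      nlinarith

end

/-! ### The minimum is negative -/

section
variable {Q : ℝ → ℝ → ℝ} {μ₁ μ₂ μ₃ C₁ C₂ C₃ C₄ F₀ M : ℝ} {f g : E3 × E3 → ℝ}

/-- Uniform distribution on a product of balls. -/
def boxDensity (A R P : ℝ) : E3 × E3 → ℝ :=
  {z : E3 × E3 | ‖z.1‖ ≤ R ∧ ‖z.2‖ ≤ P}.indicator fun _ => A

/-- For the field energy it suffices to keep the exterior r > R, where the mass function equals M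
and ∫M²/r² dr = M²/R. The restriction A ≤ F₀ places the amplitude in the range of (Q2). -/
theorem CasimirAssumptions.admissible_box
    (hQ : CasimirAssumptions Q μ₁ μ₂ μ₃ C₁ C₂ C₃ C₄ F₀) {A R P : ℝ} (hA : 0 < A) (hAF : A ≤ F₀)
    (hR : 0 < R) (hP : 0 < P) (hM : A * ((4 * Real.pi / 3) ^ 2 * R ^ 3 * P ^ 3) = M) :
    Admissible Q M (boxDensity A R P) ∧
      energyCasimir Q (boxDensity A R P)
        ≤ C₂ * A ^ (1 / μ₂) * M + 1 / 2 * (P ^ 2 * M) - 1 / 2 * (M ^ 2 * R⁻¹) := by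
  set S := {z : E3 × E3 | ‖z.1‖ ≤ R ∧ ‖z.2‖ ≤ P} with hS
  have hSm : MeasurableSet S := measurableSet_ball_prod R P
  have hSt := volume_ball_prod_lt_top R P
  have hSr := volume_real_ball_prod hR.le hP.le
  have hconst : ∀ c : ℝ, Integrable (S.indicator fun _ => c) := fun c =>
    (integrableOn_const hSt.ne).integrable_indicator hSm
  have hconsti : ∀ c : ℝ, ∫ z, S.indicator (fun _ => c) z
      = c * ((4 * Real.pi / 3) ^ 2 * R ^ 3 * P ^ 3) := fun c => by
    rw [integral_indicator hSm, setIntegral_const, hSr, smul_eq_mul, mul_comm]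
  have hnn : ∀ z, 0 ≤ boxDensity A R P z := fun z => indicator_nonneg (fun _ _ => hA.le) z
  have hQle : ∀ z : E3 × E3, Q (boxDensity A R P z) (angMom z.1 z.2)
      ≤ S.indicator (fun _ => C₂ * A ^ (1 + 1 / μ₂)) z := by
    intro z
    by_cases hz : z ∈ S
    · rw [boxDensity, indicator_of_mem hz, indicator_of_mem hz]
      exact hQ.q2 _ _ hA.le hAF (angMom_nonneg _ _)
    · rw [boxDensity, indicator_of_notMem hz, indicator_of_notMem hz, hQ.zero (angMom_nonneg _ _)]
  have hKle : ∀ z : E3 × E3, ‖z.2‖ ^ 2 * boxDensity A R P z ≤ S.indicator (fun _ => P ^ 2 * A) z := by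
    intro z
    by_cases hz : z ∈ S
    · rw [boxDensity, indicator_of_mem hz, indicator_of_mem hz]
      have := hz.2
      gcongr
    · rw [boxDensity, indicator_of_notMem hz, indicator_of_notMem hz, mul_zero]
  have hQi : Integrable (fun z : E3 × E3 => Q (boxDensity A R P z) (angMom z.1 z.2)) := by
    refine (hconst (C₂ * A ^ (1 + 1 / μ₂))).mono' (hQ.aestronglyMeasurable (hconst A).1 (ae_of_all _ hnn))
      (ae_of_all _ fun z => ?_)
    rw [Real.norm_of_nonneg (hQ.nonneg _ _ (hnn z) (angMom_nonneg _ _))]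
    exact hQle z
  have hKi : Integrable (fun z : E3 × E3 => ‖z.2‖ ^ 2 * boxDensity A R P z) := by
    refine (hconst (P ^ 2 * A)).mono' (AEStronglyMeasurable.mul (by fun_prop) (hconst A).1)
      (ae_of_all _ fun z => ?_)
    rw [Real.norm_of_nonneg (mul_nonneg (by positivity) (hnn z))]
    exact hKle z
  have hadm : Admissible Q M (boxDensity A R P) := by
    refine ⟨hconst A, ae_of_all _ hnn, (hconsti A).trans hM, hQi, hKi, fun B _ => ae_of_all _ fun z => ?_⟩
    simp [boxDensity, indicator]
  refine ⟨hadm, ?_⟩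
  have h1 : ∫ z : E3 × E3, Q (boxDensity A R P z) (angMom z.1 z.2) ≤ C₂ * A ^ (1 / μ₂) * M := by
    refine (integral_mono hQi (hconst _) hQle).trans_eq ?_
    rw [hconsti, ← hM, Real.rpow_add hA, Real.rpow_one]
    ring
  have h2 : ∫ z : E3 × E3, ‖z.2‖ ^ 2 * boxDensity A R P z ≤ P ^ 2 * M := by
    refine (integral_mono hKi (hconst _) hKle).trans_eq ?_
    rw [hconsti, ← hM]
    ring
  have h3 : M ^ 2 * R⁻¹ ≤ potEnergy (boxDensity A R P) (boxDensity A R P) := by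
    have hm : ∀ r ∈ Ioi R, massIn (boxDensity A R P) r = M := by
      intro r hr
      rw [← hadm.mass, massIn]
      refine setIntegral_eq_integral_of_forall_compl_eq_zero fun z hz => ?_
      refine indicator_of_notMem (fun h : z ∈ S => hz ?_) _
      exact h.1.trans (le_of_lt hr)
    have hi := hQ.integrableOn_massIn_mul hadm hadm
    calc M ^ 2 * R⁻¹ = ∫ r in Ioi R, M ^ 2 * (r ^ 2)⁻¹ := by
          rw [integral_const_mul, integral_Ioi_inv_sq hR]
      _ = ∫ r in Ioi R, massIn (boxDensity A R P) r * massIn (boxDensity A R P) r * (r ^ 2)⁻¹ := by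
          refine setIntegral_congr_fun measurableSet_Ioi fun r hr => ?_
          simp only [hm r hr]; ring
      _ ≤ _ := by
          refine setIntegral_mono_set hi (ae_of_all _ fun r => ?_)
            (LE.le.eventuallyLE (Ioi_subset_Ioi hR.le))
          have := hadm.isRadial.massIn_nonneg r
          simp only [Pi.zero_apply]
          positivity
  rw [hadm.isRadial.energyCasimir_eq, casimirKinetic]
  linarith

/-- Take boxes of radius R → ∞, velocity R^(−s) and amplitude a multiple of R^(−e), with e + 3s = 3
to keep the mass fixed. The Casimir part is of order R^(−e/μ₂) and the kinetic part of order
R^(−2s). The choices s = 3/4 − μ₂/6 and e = 3/4 + μ₂/2 give 2s > 1 and e > μ₂, both by μ₂ < 3/2, so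
both parts are beaten by the gravitational term of order 1/R. -/
theorem CasimirAssumptions.exists_negative
    (hQ : CasimirAssumptions Q μ₁ μ₂ μ₃ C₁ C₂ C₃ C₄ F₀) (hM : 0 < M) :
    ∃ f, Admissible Q M f ∧ energyCasimir Q f < 0 := by
  have hμ := hQ.mu2.1
  have hμ' := hQ.mu2.2
  set c := (4 * Real.pi / 3) ^ 2 with hc
  have hc0 : 0 < c := by positivity
  set s := 3 / 4 - μ₂ / 6 with hs
  set e := 3 / 4 + μ₂ / 2 with he
  have t1 : Tendsto (fun R : ℝ => C₂ * M * (M / c) ^ (1 / μ₂) * R ^ (-(e / μ₂ - 1))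
      + 1 / 2 * M * R ^ (-(2 * s - 1))) atTop (𝓝 0) := by
    have a1 : 0 < e / μ₂ - 1 := by
      rw [sub_pos, one_lt_div hμ, he]; linarith
    have a2 : 0 < 2 * s - 1 := by rw [hs]; linarith
    have := ((tendsto_rpow_neg_atTop a1).const_mul (C₂ * M * (M / c) ^ (1 / μ₂))).add
      ((tendsto_rpow_neg_atTop a2).const_mul (1 / 2 * M))
    simpa using this
  have t2 : Tendsto (fun R : ℝ => M / c * R ^ (-e)) atTop (𝓝 0) := by
    have := (tendsto_rpow_neg_atTop (show 0 < e by positivity)).const_mul (M / c)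
    simpa using this
  obtain ⟨R, ⟨h1, h2⟩, hR⟩ := (((t1.eventually (gt_mem_nhds (show 0 < M ^ 2 / 2 by positivity))).and
    (t2.eventually (gt_mem_nhds hQ.F0_pos))).and (eventually_gt_atTop 0)).exists
  have hmass : M / c * R ^ (-e) * (c * R ^ 3 * (R ^ (-s)) ^ 3) = M := by
    have : R ^ (-e) * (R ^ 3 * (R ^ (-s)) ^ 3) = 1 := by
      rw [← Real.rpow_natCast (R ^ (-s)), ← Real.rpow_mul hR.le, ← Real.rpow_natCast R,
        ← Real.rpow_add hR, ← Real.rpow_add hR, he, hs]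
      push_cast
      ring_nf
      exact Real.rpow_zero R
    calc _ = M / c * c * (R ^ (-e) * (R ^ 3 * (R ^ (-s)) ^ 3)) := by ring
      _ = M := by rw [this]; field_simp
  obtain ⟨hadm, hle⟩ := hQ.admissible_box (A := M / c * R ^ (-e)) (by positivity) h2.le hR
    (P := R ^ (-s)) (by positivity) hmass
  refine ⟨_, hadm, hle.trans_lt ?_⟩
  have e1 : (M / c * R ^ (-e)) ^ (1 / μ₂) = (M / c) ^ (1 / μ₂) * (R ^ (-(e / μ₂ - 1)) * R⁻¹) := by
    rw [Real.mul_rpow (by positivity) (by positivity), ← Real.rpow_mul hR.le, ← Real.rpow_neg_one R,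
      ← Real.rpow_add hR]
    congr 2; ring
  have e2 : (R ^ (-s)) ^ 2 = R ^ (-(2 * s - 1)) * R⁻¹ := by
    rw [← Real.rpow_natCast, ← Real.rpow_mul hR.le, ← Real.rpow_neg_one R, ← Real.rpow_add hR]
    congr 1; push_cast; ring
  rw [e1, e2]
  have : C₂ * ((M / c) ^ (1 / μ₂) * (R ^ (-(e / μ₂ - 1)) * R⁻¹)) * M
      + 1 / 2 * (R ^ (-(2 * s - 1)) * R⁻¹ * M) - 1 / 2 * (M ^ 2 * R⁻¹)
      = (C₂ * M * (M / c) ^ (1 / μ₂) * R ^ (-(e / μ₂ - 1))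
      + 1 / 2 * M * R ^ (-(2 * s - 1)) - M ^ 2 / 2) * R⁻¹ := by ring
  rw [this]
  exact mul_neg_of_neg_of_pos (by linarith) (by positivity)

end

/-! ### Almost everywhere limits from convexity and monotonicity -/

/-- Forward convex combinations of nonnegative functions converge almost everywhere: every
decreasing sequence of nonempty convex sets of nonnegative functions has a selection with an almost
everywhere convergent subsequence, with respect to the transformation `x ↦ exp (-x / 2)`. -/
theorem exists_tendsto_exp_of_convex {α : Type*} [MeasurableSpace α] (μ : Measure α)
    [IsFiniteMeasure μ] (C : ℕ → Set (α → ℝ)) (hconv : ∀ n, Convex ℝ (C n)) (hanti : Antitone C)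
    (hne : ∀ n, (C n).Nonempty)
    (hmeas : ∀ f ∈ C 0, AEStronglyMeasurable f μ ∧ ∀ᵐ x ∂μ, 0 ≤ f x) :
    ∃ (g : ℕ → α → ℝ) (G : α → ℝ), (∀ n, g n ∈ C n) ∧ Measurable G ∧
      ∀ᵐ x ∂μ, Tendsto (fun n => Real.exp (-(g n x) / 2)) atTop (𝓝 (G x)) := by
  -- The bounded convex functional ∫exp(−f) measures the position in the nested sets:
  -- near-minimizers of it are forced to be close to each other, as in the projection theorem.
  set I : (α → ℝ) → ℝ := fun f => ∫ x, Real.exp (-(f x)) ∂μ with hI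
  have hmeas' : ∀ n, ∀ f ∈ C n, AEStronglyMeasurable f μ ∧ ∀ᵐ x ∂μ, 0 ≤ f x := fun n f hf =>
    hmeas f (hanti (Nat.zero_le n) hf)
  have hint : ∀ c : ℝ, 0 ≤ c → ∀ n, ∀ f ∈ C n, Integrable (fun x => Real.exp (-(f x) * c)) μ := by
    intro c hc n f hf
    obtain ⟨h1, h2⟩ := hmeas' n f hf
    refine (integrable_const (1:ℝ)).mono'
      (Real.continuous_exp.comp_aestronglyMeasurable (h1.neg.mul_const c)) ?_
    filter_upwards [h2] with x hx
    rw [Real.norm_of_nonneg (Real.exp_pos _).le]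
    exact Real.exp_le_one_iff.2 (by nlinarith)
  have hI0 : ∀ f, 0 ≤ I f := fun f => integral_nonneg fun x => (Real.exp_pos _).le
  have hI1 : ∀ n, ∀ f ∈ C n, I f ≤ μ.real univ := by
    intro n f hf
    have h := hint 1 zero_le_one n f hf
    simp only [mul_one] at h
    calc I f ≤ ∫ _, (1:ℝ) ∂μ := by
          refine integral_mono_ae h (integrable_const _) ?_
          filter_upwards [(hmeas' n f hf).2] with x hx
          exact Real.exp_le_one_iff.2 (by linarith)
      _ = _ := by simp
  set J : ℕ → ℝ := fun n => sInf (I '' C n) with hJ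
  have hbdd : ∀ n, BddBelow (I '' C n) := fun n => ⟨0, by rintro _ ⟨f, -, rfl⟩; exact hI0 f⟩
  have hJmono : Monotone J := fun m n hmn =>
    csInf_le_csInf (hbdd m) ((hne n).image I) (image_mono (hanti hmn))
  have hJbdd : BddAbove (range J) := by
    refine ⟨μ.real univ, ?_⟩
    rintro _ ⟨n, rfl⟩
    obtain ⟨f, hf⟩ := hne n
    exact (csInf_le (hbdd n) (mem_image_of_mem I hf)).trans (hI1 n f hf)
  set j := ⨆ n, J n with hj
  have hJj : ∀ n, J n ≤ j := fun n => le_ciSup hJbdd n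
  have hJt : Tendsto J atTop (𝓝 j) := tendsto_atTop_ciSup hJmono hJbdd
  -- select near-minimizers along a subsequence
  have hsel : ∀ n : ℕ, ∃ N ≥ n, ∃ f ∈ C N, j - (1/4) ^ n ≤ J N ∧ I f ≤ J N + (1/4) ^ n := by
    intro n
    have hp : (0:ℝ) < (1/4) ^ n := by positivity
    obtain ⟨N, hN1, hN2⟩ := ((hJt.eventually (lt_mem_nhds (by linarith : j - (1/4:ℝ) ^ n < j))).and
      (eventually_ge_atTop n)).exists
    obtain ⟨_, ⟨f, hf, rfl⟩, hlt⟩ := exists_lt_of_csInf_lt ((hne N).image I)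
      (show sInf (I '' C N) < J N + (1/4) ^ n by simp only [hJ]; linarith)
    exact ⟨N, hN2, f, hf, hN1.le, hlt.le⟩
  choose N hN g hg hgJ hgI using hsel
  have hgn : ∀ n, g n ∈ C n := fun n => hanti (hN n) (hg n)
  set e : ℕ → α → ℝ := fun n x => Real.exp (-(g n x) / 2) with he
  have key : ∀ n, ∫ x, (e (n+1) x - e n x) ^ 2 ∂μ ≤ 8 * (1/4) ^ n := by
    intro n
    set K := min (N n) (N (n+1)) with hK
    have m1 : g n ∈ C K := hanti (min_le_left _ _) (hg n)
    have m2 : g (n+1) ∈ C K := hanti (min_le_right _ _) (hg (n+1))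
    have mm : (1/2:ℝ) • g n + (1/2:ℝ) • g (n+1) ∈ C K :=
      hconv K m1 m2 (by norm_num) (by norm_num) (by norm_num)
    have hlow : J K ≤ I ((1/2:ℝ) • g n + (1/2:ℝ) • g (n+1)) := csInf_le (hbdd K) (mem_image_of_mem I mm)
    have hp : (1/4:ℝ) ^ (n+1) ≤ (1/4) ^ n := by
      rw [pow_succ]; nlinarith [show (0:ℝ) < (1/4) ^ n by positivity]
    have hJK : j - (1/4) ^ n ≤ J K := by
      rcases min_choice (N n) (N (n+1)) with h | h
      · rw [hK, h]; exact hgJ n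
      · rw [hK, h]; linarith [hgJ (n+1)]
    have i1 := hint 1 zero_le_one _ _ m1
    have i2 := hint 1 zero_le_one _ _ m2
    have i3 := hint 1 zero_le_one _ _ mm
    simp only [mul_one] at i1 i2 i3
    -- Parallelogram identity: the product of exp(−g/2) and exp(−h/2) is exp(−(g + h)/2), the value
    -- at the midpoint. The midpoint lies in the larger of the two convex sets, so its functional is
    -- at least j − 4⁻ⁿ, while both ends are at most j plus an error of order 4⁻ⁿ.
    have e1 : ∫ x, (e (n+1) x - e n x) ^ 2 ∂μ
        = I (g (n+1)) + I (g n) - 2 * I ((1/2:ℝ) • g n + (1/2:ℝ) • g (n+1)) := by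
      simp only [hI]
      rw [← integral_add i2 i1, ← integral_const_mul, ← integral_sub (by exact i2.add i1) (i3.const_mul 2)]
      refine integral_congr_ae (ae_of_all _ fun x => ?_)
      have a1 : Real.exp (-(g (n+1) x)) = e (n+1) x ^ 2 := by
        simp only [he]; rw [← Real.exp_nat_mul]; congr 1; push_cast; ring
      have a2 : Real.exp (-(g n x)) = e n x ^ 2 := by
        simp only [he]; rw [← Real.exp_nat_mul]; congr 1; push_cast; ring
      have a3 : Real.exp (-(((1/2:ℝ) • g n + (1/2:ℝ) • g (n+1)) x)) = e n x * e (n+1) x := by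
        simp only [he]; rw [← Real.exp_add]; congr 1
        simp only [Pi.add_apply, Pi.smul_apply, smul_eq_mul]; ring
      simp only [a1, a2, a3]
      ring
    rw [e1]
    have hp0 : (0:ℝ) < (1/4) ^ n := by positivity
    linarith [hgI n, hgI (n+1), hJj (N n), hJj (N (n+1))]
  have hem : ∀ n, AEStronglyMeasurable (e n) μ := fun n => by
    have := (hint (1/2) (by norm_num) n _ (hgn n)).1
    refine this.congr (ae_of_all _ fun x => ?_)
    simp only [he]; congr 1; ring
  have heb : ∀ n, ∀ᵐ x ∂μ, ‖e n x‖ ≤ 1 := fun n => by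
    filter_upwards [(hmeas' n _ (hgn n)).2] with x hx
    rw [Real.norm_of_nonneg (Real.exp_pos _).le]
    exact Real.exp_le_one_iff.2 (by linarith)
  -- summability of the increments
  have hdi : ∀ n, Integrable (fun x => |e (n+1) x - e n x|) μ := fun n => by
    refine (integrable_const (2:ℝ)).mono' (((hem (n+1)).sub (hem n)).norm) ?_
    filter_upwards [heb n, heb (n+1)] with x h1 h2
    rw [Real.norm_eq_abs, abs_abs]
    rw [Real.norm_eq_abs] at h1 h2
    exact (abs_sub _ _).trans (by linarith)
  have hdi2 : ∀ n, Integrable (fun x => (e (n+1) x - e n x) ^ 2) μ := fun n => by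
    refine (integrable_const (4:ℝ)).mono' (((hem (n+1)).sub (hem n)).pow 2) ?_
    filter_upwards [heb n, heb (n+1)] with x h1 h2
    rw [Real.norm_eq_abs, abs_le] at h1 h2
    rw [Real.norm_eq_abs, abs_le]
    constructor <;> nlinarith
  have hd1 : ∀ n, ∫ x, |e (n+1) x - e n x| ∂μ ≤ (μ.real univ + 8) * (1/2) ^ n := by
    intro n
    have hp : (0:ℝ) < (1/2) ^ n := by positivity
    -- The inequality a ≤ 2⁻ⁿ + 2ⁿa² turns the L² bound of order 4⁻ⁿ into an L¹ bound of order 2⁻ⁿ.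
    -- The increments are then summable almost everywhere.
    have hpw : ∀ x, |e (n+1) x - e n x| ≤ (1/2) ^ n + ((1/2:ℝ) ^ n)⁻¹ * (e (n+1) x - e n x) ^ 2 := by
      intro x
      rw [← sq_abs (e (n+1) x - e n x)]
      set a := |e (n+1) x - e n x|
      have ha : 0 ≤ a := abs_nonneg _
      rw [← sub_nonneg]
      have : (1/2:ℝ) ^ n + ((1/2:ℝ) ^ n)⁻¹ * a ^ 2 - a
        = ((1/2:ℝ) ^ n)⁻¹ * (((1/2:ℝ) ^ n - a / 2) ^ 2 + 3 / 4 * a ^ 2) := by field_simp; ring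
      rw [this]; positivity
    calc _ ≤ ∫ x, ((1/2:ℝ) ^ n + ((1/2:ℝ) ^ n)⁻¹ * (e (n+1) x - e n x) ^ 2) ∂μ :=
          integral_mono (hdi n) ((integrable_const _).add ((hdi2 n).const_mul _)) hpw
      _ = μ.real univ * (1/2) ^ n + ((1/2:ℝ) ^ n)⁻¹ * ∫ x, (e (n+1) x - e n x) ^ 2 ∂μ := by
          rw [integral_add (integrable_const _) ((hdi2 n).const_mul _), integral_const,
            integral_const_mul, smul_eq_mul]
      _ ≤ μ.real univ * (1/2) ^ n + ((1/2:ℝ) ^ n)⁻¹ * (8 * (1/4) ^ n) := by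
          gcongr; exact key n
      _ = _ := by
          have : (1/4:ℝ) ^ n = (1/2) ^ n * (1/2) ^ n := by rw [← mul_pow]; norm_num
          rw [this]; field_simp
  have hsum : ∀ᵐ x ∂μ, Summable (fun n => |e (n+1) x - e n x|) := by
    have hlt : ∫⁻ x, ∑' n, ENNReal.ofReal |e (n+1) x - e n x| ∂μ ≠ ∞ := by
      rw [lintegral_tsum fun n => (hdi n).1.aemeasurable.ennreal_ofReal]
      have : ∀ n, ∫⁻ x, ENNReal.ofReal |e (n+1) x - e n x| ∂μ
          ≤ ENNReal.ofReal ((μ.real univ + 8) * (1/2) ^ n) := by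
        intro n
        rw [← ofReal_integral_eq_lintegral_ofReal (hdi n) (ae_of_all _ fun x => abs_nonneg _)]
        exact ENNReal.ofReal_le_ofReal (hd1 n)
      refine ne_top_of_le_ne_top ?_ (ENNReal.tsum_le_tsum this)
      have hs : Summable (fun n : ℕ => (μ.real univ + 8) * (1/2:ℝ) ^ n) :=
        (summable_geometric_of_lt_one (by norm_num) (by norm_num)).mul_left _
      exact hs.tsum_ofReal_ne_top
    have := ae_lt_top' (AEMeasurable.tsum fun n => (hdi n).1.aemeasurable.ennreal_ofReal) hlt
    filter_upwards [this] with x hx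
    have h2 := ENNReal.summable_toReal hx.ne
    simpa [ENNReal.toReal_ofReal (abs_nonneg _)] using h2
  have hconvg : ∀ᵐ x ∂μ, ∃ l, Tendsto (fun n => e n x) atTop (𝓝 l) := by
    filter_upwards [hsum] with x hx
    have : CauchySeq (fun n => e n x) := by
      refine cauchySeq_of_summable_dist ?_
      refine hx.congr fun n => ?_
      rw [dist_comm, Real.dist_eq]
    exact cauchySeq_tendsto_of_complete this
  obtain ⟨G, hG, hGt⟩ := measurable_limit_of_tendsto_metrizable_ae (fun n => (hem n).aemeasurable) hconvg
  exact ⟨g, G, hgn, hG, hGt⟩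

/-- Fatou's lemma for integrable nonnegative real functions. -/
theorem integrable_of_tendsto_ae {α : Type*} [MeasurableSpace α] {μ : Measure α} {F : ℕ → α → ℝ}
    {f : α → ℝ} {c : ℕ → ℝ} {C : ℝ} (hF : ∀ n, Integrable (F n) μ) (h0 : ∀ n, ∀ᵐ x ∂μ, 0 ≤ F n x)
    (hlim : ∀ᵐ x ∂μ, Tendsto (fun n => F n x) atTop (𝓝 (f x))) (hc : ∀ n, ∫ x, F n x ∂μ ≤ c n)
    (hC : Tendsto c atTop (𝓝 C)) : Integrable f μ ∧ ∫ x, f x ∂μ ≤ C := by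
  have hfm : AEStronglyMeasurable f μ := aestronglyMeasurable_of_tendsto_ae _ (fun n => (hF n).1) hlim
  have h0' := ae_all_iff.2 h0
  have hf0 : ∀ᵐ x ∂μ, 0 ≤ f x := by
    filter_upwards [hlim, h0'] with x hx h
    exact ge_of_tendsto' hx h
  have h1 : ∫⁻ x, ENNReal.ofReal (f x) ∂μ ≤ ENNReal.ofReal C := by
    calc ∫⁻ x, ENNReal.ofReal (f x) ∂μ
        = ∫⁻ x, liminf (fun n => ENNReal.ofReal (F n x)) atTop ∂μ := by
          refine lintegral_congr_ae ?_
          filter_upwards [hlim] with x hx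
          exact ((ENNReal.tendsto_ofReal hx).liminf_eq).symm
      _ ≤ liminf (fun n => ∫⁻ x, ENNReal.ofReal (F n x) ∂μ) atTop :=
          lintegral_liminf_le' fun n => (hF n).1.aemeasurable.ennreal_ofReal
      _ ≤ liminf (fun n => ENNReal.ofReal (c n)) atTop := by
          refine liminf_le_liminf (Eventually.of_forall fun n => ?_)
          rw [← ofReal_integral_eq_lintegral_ofReal (hF n) (h0 n)]
          exact ENNReal.ofReal_le_ofReal (hc n)
      _ = ENNReal.ofReal C := (ENNReal.tendsto_ofReal hC).liminf_eq
  have hC0 : 0 ≤ C := ge_of_tendsto' hC fun n => (integral_nonneg_of_ae (h0 n)).trans (hc n)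
  refine ⟨⟨hfm, ?_⟩, ?_⟩
  · rw [hasFiniteIntegral_iff_ofReal hf0]
    exact h1.trans_lt ENNReal.ofReal_lt_top
  · rw [integral_eq_lintegral_of_nonneg_ae hf0 hfm]
    exact (ENNReal.toReal_mono ENNReal.ofReal_ne_top h1).trans_eq (ENNReal.toReal_ofReal hC0)

/-- Pointwise convergence of monotone functions on a dense set to a continuous limit. -/
theorem tendsto_of_monotone_of_dense {F : ℕ → ℝ → ℝ} {f : ℝ → ℝ} (hF : ∀ n, Monotone (F n))
    (hf : Continuous f) {q : ℕ → ℝ} (hq : DenseRange q)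
    (h : ∀ i, Tendsto (fun n => F n (q i)) atTop (𝓝 (f (q i)))) (r : ℝ) :
    Tendsto (fun n => F n r) atTop (𝓝 (f r)) := by
  rw [tendsto_order]
  constructor
  · intro a ha
    have h1 : ∀ᶠ s in 𝓝 r, a < f s := hf.continuousAt.eventually (lt_mem_nhds ha)
    obtain ⟨δ, hδ, hs⟩ := Metric.eventually_nhds_iff.1 h1
    obtain ⟨i, hi⟩ := hq.exists_mem_open isOpen_Ioo (nonempty_Ioo.2 (show r - δ < r by linarith))
    have h2 : a < f (q i) := hs (by rw [Real.dist_eq, abs_lt]; constructor <;> linarith [hi.1, hi.2])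
    filter_upwards [(h i).eventually (lt_mem_nhds h2)] with n hn
    exact hn.trans_le (hF n hi.2.le)
  · intro a ha
    have h1 : ∀ᶠ s in 𝓝 r, f s < a := hf.continuousAt.eventually (gt_mem_nhds ha)
    obtain ⟨δ, hδ, hs⟩ := Metric.eventually_nhds_iff.1 h1
    obtain ⟨i, hi⟩ := hq.exists_mem_open isOpen_Ioo (nonempty_Ioo.2 (show r < r + δ by linarith))
    have h2 : f (q i) < a := hs (by rw [Real.dist_eq, abs_lt]; constructor <;> linarith [hi.1, hi.2])
    filter_upwards [(h i).eventually (gt_mem_nhds h2)] with n hn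
    exact (hF n hi.1.le).trans_lt hn

/-! ### Convexity of the constraints, convergence of masses and fields -/

section
variable {Q : ℝ → ℝ → ℝ} {μ₁ μ₂ μ₃ C₁ C₂ C₃ C₄ F₀ M : ℝ} {f g : E3 × E3 → ℝ}

theorem CasimirAssumptions.convexOn (hQ : CasimirAssumptions Q μ₁ μ₂ μ₃ C₁ C₂ C₃ C₄ F₀) {L : ℝ}
    (hL : 0 ≤ L) : ConvexOn ℝ (Ici 0) (fun f => Q f L) := by
  have hder : ∀ x ∈ Ioi (0:ℝ), deriv (fun f => Q f L) x = dQ Q x L := fun x hx => by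
    rw [dQ, derivWithin_of_mem_nhds (Ici_mem_nhds hx)]
  have hev : ∀ x ∈ Ioi (0:ℝ), deriv (fun f => Q f L) =ᶠ[𝓝 x] fun f => dQ Q f L := fun x hx => by
    filter_upwards [Ioi_mem_nhds hx] with y hy
    exact hder y hy
  refine convexOn_of_deriv2_nonneg (convex_Ici 0) (hQ.differentiableOn L hL).continuousOn ?_ ?_ ?_
  · exact (hQ.differentiableOn L hL).mono interior_subset
  · rw [interior_Ici]
    exact (hQ.differentiableOn_dQ L hL).congr hder
  · rw [interior_Ici]
    intro x hx
    have h : deriv^[2] (fun f => Q f L) x = d2Q Q x L := by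
      simp only [Function.iterate_succ, Function.iterate_zero, Function.comp_def, id]
      rw [(hev x hx).deriv_eq]
      rfl
    rw [h]
    exact (hQ.q4 x L hx hL).le

/-- Convexity of Q in f and linearity of the other constraints. The concave field term is left out:
it is controlled through the masses, which depend linearly on f. -/
theorem CasimirAssumptions.admissible_convex
    (hQ : CasimirAssumptions Q μ₁ μ₂ μ₃ C₁ C₂ C₃ C₄ F₀) (hf : Admissible Q M f)
    (hg : Admissible Q M g) {a b : ℝ} (ha : 0 ≤ a) (hb : 0 ≤ b) (hab : a + b = 1) :
    Admissible Q M (a • f + b • g) ∧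
      casimirKinetic Q (a • f + b • g) ≤ a * casimirKinetic Q f + b * casimirKinetic Q g := by
  have hint : Integrable (a • f + b • g) := (hf.integrable.smul a).add (hg.integrable.smul b)
  have hnn : ∀ᵐ z, 0 ≤ (a • f + b • g) z := by
    filter_upwards [hf.nonneg, hg.nonneg] with z h1 h2
    simp only [Pi.add_apply, Pi.smul_apply, smul_eq_mul]
    positivity
  have hQi' : Integrable (fun z : E3 × E3 => a * Q (f z) (angMom z.1 z.2)
      + b * Q (g z) (angMom z.1 z.2)) :=
    (hf.casimir_finite.const_mul a).add (hg.casimir_finite.const_mul b)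
  have hle : ∀ᵐ z : E3 × E3, Q ((a • f + b • g) z) (angMom z.1 z.2)
      ≤ a * Q (f z) (angMom z.1 z.2) + b * Q (g z) (angMom z.1 z.2) := by
    filter_upwards [hf.nonneg, hg.nonneg] with z h1 h2
    exact (hQ.convexOn (angMom_nonneg z.1 z.2)).2 h1 h2 ha hb hab
  have hQi : Integrable (fun z : E3 × E3 => Q ((a • f + b • g) z) (angMom z.1 z.2)) := by
    refine hQi'.mono' (hQ.aestronglyMeasurable hint.1 hnn) ?_
    filter_upwards [hle, hQ.casimir_ae_nonneg hnn] with z h1 h2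
    rw [Real.norm_of_nonneg h2]
    exact h1
  have hk : (fun z : E3 × E3 => ‖z.2‖ ^ 2 * (a • f + b • g) z)
      = fun z => a * (‖z.2‖ ^ 2 * f z) + b * (‖z.2‖ ^ 2 * g z) := by
    ext z; simp only [Pi.add_apply, Pi.smul_apply, smul_eq_mul]; ring
  have hki : Integrable (fun z : E3 × E3 => ‖z.2‖ ^ 2 * (a • f + b • g) z) := by
    rw [hk]; exact (hf.kinetic_finite.const_mul a).add (hg.kinetic_finite.const_mul b)
  refine ⟨⟨hint, hnn, ?_, hQi, hki, ?_⟩, ?_⟩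
  · simp only [Pi.add_apply, Pi.smul_apply, smul_eq_mul]
    rw [integral_add (hf.integrable.const_mul a) (hg.integrable.const_mul b), integral_const_mul,
      integral_const_mul, hf.mass, hg.mass, ← add_mul, hab, one_mul]
  · intro A hA
    filter_upwards [hf.symmetric A hA, hg.symmetric A hA] with z h1 h2
    simp only [Pi.add_apply, Pi.smul_apply, h1, h2]
  · have h1 := integral_mono_ae hQi hQi' hle
    rw [integral_add (hf.casimir_finite.const_mul a) (hg.casimir_finite.const_mul b),
      integral_const_mul, integral_const_mul] at h1
    have h2 : ∫ z : E3 × E3, ‖z.2‖ ^ 2 * (a • f + b • g) z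
        = a * (∫ z : E3 × E3, ‖z.2‖ ^ 2 * f z) + b * ∫ z : E3 × E3, ‖z.2‖ ^ 2 * g z := by
      rw [hk, integral_add (hf.kinetic_finite.const_mul a) (hg.kinetic_finite.const_mul b),
        integral_const_mul, integral_const_mul]
    unfold casimirKinetic
    rw [h2]
    linarith

theorem massIn_convex (hf : Integrable f) (hg : Integrable g) (a b r : ℝ) :
    massIn (a • f + b • g) r = a * massIn f r + b * massIn g r := by
  simp only [massIn, Pi.add_apply, Pi.smul_apply, smul_eq_mul]
  rw [integral_add (hf.const_mul a).integrableOn (hg.const_mul b).integrableOn, integral_const_mul,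
    integral_const_mul]

/-- Almost everywhere convergence with bounded `J` implies convergence of the masses. -/
theorem CasimirAssumptions.tendsto_massIn
    (hQ : CasimirAssumptions Q μ₁ μ₂ μ₃ C₁ C₂ C₃ C₄ F₀) {G : ℕ → E3 × E3 → ℝ} {M' j : ℝ}
    (hG : ∀ n, Admissible Q M (G n)) (hg : Admissible Q M' g)
    (hGj : ∀ n, casimirKinetic Q (G n) ≤ j) (hgj : casimirKinetic Q g ≤ j)
    (hlim : ∀ᵐ z, Tendsto (fun n => G n z) atTop (𝓝 (g z))) (r : ℝ) :
    Tendsto (fun n => massIn (G n) r) atTop (𝓝 (massIn g r)) := by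
  have hμ := hQ.mu1.1
  have hC := hQ.C1_pos
  -- The truncation error at height and velocity both equal to x, uniform over all densities with J
  -- ≤ j.
  have ht : Tendsto (fun x : ℝ => 2 * j / x ^ 2 + j / (C₁ * x ^ (1 / μ₁))) atTop (𝓝 0) := by
    have h1 : Tendsto (fun x : ℝ => x ^ 2) atTop atTop := tendsto_pow_atTop (by norm_num)
    have h2 : Tendsto (fun x : ℝ => C₁ * x ^ (1 / μ₁)) atTop atTop :=
      (tendsto_rpow_atTop (by positivity)).const_mul_atTop hC
    simpa using (h1.const_div_atTop (2 * j)).add (h2.const_div_atTop j)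
  rw [Metric.tendsto_atTop]
  intro ε hε
  obtain ⟨A, ⟨h1, h2⟩, h3⟩ := (((ht.eventually (gt_mem_nhds (show 0 < ε / 3 by positivity))).and
    (eventually_ge_atTop F₀)).and (eventually_gt_atTop 0)).exists
  have hbound : ∀ {M : ℝ} {f : E3 × E3 → ℝ}, Admissible Q M f → casimirKinetic Q f ≤ j →
      |massIn f r - massTrunc A A f r| ≤ ε / 3 := by
    intro M f hf hfj
    have k1 := hQ.massIn_le_massTrunc hf h2 h3 r
    have k2 := massTrunc_le_massIn hf.isRadial A A r
    have k3 : (∫ z, ‖z.2‖ ^ 2 * f z) / A ^ 2 ≤ 2 * j / A ^ 2 := by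
      have := hQ.kinetic_le hf.nonneg
      gcongr; linarith
    have k4 : (∫ z, Q (f z) (angMom z.1 z.2)) / (C₁ * A ^ (1 / μ₁)) ≤ j / (C₁ * A ^ (1 / μ₁)) := by
      have := casimir_le_casimirKinetic (Q := Q) hf.nonneg
      gcongr; linarith
    rw [abs_of_nonneg (by linarith)]
    linarith
  -- The truncated densities are bounded by A on a set of finite measure, so dominated convergence
  -- applies; no domination of the densities themselves is available.
  have htr : Tendsto (fun n => massTrunc A A (G n) r) atTop (𝓝 (massTrunc A A g r)) := by
    have hfin : IsFiniteMeasure ((volume : Measure (E3 × E3)).restrict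
        {z : E3 × E3 | ‖z.1‖ ≤ r ∧ ‖z.2‖ ≤ A}) := ⟨by
      rw [Measure.restrict_apply_univ]; exact volume_ball_prod_lt_top r A⟩
    refine tendsto_integral_of_dominated_convergence (fun _ => A) (fun n => ?_) (integrable_const _)
      (fun n => ?_) ?_
    · exact (integrableOn_min (hG n).integrable A r A).1
    · filter_upwards [ae_restrict_of_ae (hG n).nonneg] with z hz
      rw [Real.norm_of_nonneg (le_min hz h3.le)]
      exact min_le_right _ _
    · filter_upwards [ae_restrict_of_ae hlim] with z hz
      exact hz.min tendsto_const_nhds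
  obtain ⟨N, hN⟩ := Metric.tendsto_atTop.1 htr (ε / 3) (by positivity)
  refine ⟨N, fun n hn => ?_⟩
  have b1 := hbound (hG n) (hGj n)
  have b2 := hbound hg hgj
  have b3 := hN n hn
  rw [Real.dist_eq] at b3 ⊢
  rw [abs_le] at b1 b2
  rw [abs_lt] at b3 ⊢
  constructor <;> linarith

/-- Convergence of the masses implies strong convergence of the fields. -/
theorem CasimirAssumptions.tendsto_field
    (hQ : CasimirAssumptions Q μ₁ μ₂ μ₃ C₁ C₂ C₃ C₄ F₀) {G : ℕ → E3 × E3 → ℝ} {j : ℝ} (hj : 1 ≤ j)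
    (hG : ∀ n, Admissible Q M (G n)) (hg : IsRadial g)
    (hGj : ∀ n, casimirKinetic Q (G n) ≤ j)
    (hlim : ∀ r, Tendsto (fun n => massIn (G n) r) atTop (𝓝 (massIn g r))) :
    Tendsto (fun n => potEnergy (G n) (G n)) atTop (𝓝 (potEnergy g g)) ∧
    Tendsto (fun n => ∫ r in Ioi (0 : ℝ), (massIn (G n) r - massIn g r) ^ 2 * (r ^ 2)⁻¹) atTop
      (𝓝 0) := by
  set dom := massDom (massConst μ₁ C₁ F₀) (massExponent μ₁) M (j ^ (-fieldExponent μ₁)) with hdom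
  have hdi : IntegrableOn dom (Ioi 0) := (massDom_integral hQ.half_lt_massExponent
    (Real.rpow_pos_of_pos (zero_lt_one.trans_le hj) _)).1
  have hGd : ∀ n, ∀ r ∈ Ioi (0:ℝ), massIn (G n) r * massIn (G n) r * (r ^ 2)⁻¹ ≤ dom r :=
    fun n r hr => hQ.massIn_sq_le_massDom (hG n) hj (hGj n) hr
  -- The majorant is inherited by the limit pointwise, so no constraint on J or on the total mass of
  -- g has to be imposed here.
  have hgd : ∀ r ∈ Ioi (0:ℝ), massIn g r * massIn g r * (r ^ 2)⁻¹ ≤ dom r := fun r hr =>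
    le_of_tendsto' (((hlim r).mul (hlim r)).mul_const _) fun n => hGd n r hr
  have hmG : ∀ n, Measurable (massIn (G n)) := fun n => (hG n).isRadial.continuous_massIn.measurable
  have hmg : Measurable (massIn g) := hg.continuous_massIn.measurable
  have hminv : Measurable (fun r : ℝ => (r ^ 2)⁻¹) := by fun_prop
  constructor
  · refine tendsto_integral_of_dominated_convergence dom
      (fun n => (((hmG n).mul (hmG n)).mul hminv).aestronglyMeasurable) hdi (fun n => ?_)
      (ae_of_all _ fun r => ((hlim r).mul (hlim r)).mul_const _)
    refine (ae_restrict_iff' measurableSet_Ioi).2 (ae_of_all _ fun r hr => ?_)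
    rw [Real.norm_of_nonneg (mul_nonneg (mul_self_nonneg _) (by positivity))]
    exact hGd n r hr
  · have := tendsto_integral_of_dominated_convergence (μ := volume.restrict (Ioi (0:ℝ)))
      (F := fun n r => (massIn (G n) r - massIn g r) ^ 2 * (r ^ 2)⁻¹) (f := fun _ => 0)
      (fun r => 4 * dom r)
      (fun n => ((((hmG n).sub hmg).pow_const 2).mul hminv).aestronglyMeasurable)
      (hdi.const_mul 4) (fun n => ?_) (ae_of_all _ fun r => ?_)
    · simpa using this
    · refine (ae_restrict_iff' measurableSet_Ioi).2 (ae_of_all _ fun r hr => ?_)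
      rw [Real.norm_of_nonneg (by positivity)]
      have h1 := hGd n r hr
      have h2 := hgd r hr
      have h3 : (massIn (G n) r - massIn g r) ^ 2 * (r ^ 2)⁻¹
          ≤ 2 * (massIn (G n) r * massIn (G n) r * (r ^ 2)⁻¹)
            + 2 * (massIn g r * massIn g r * (r ^ 2)⁻¹) := by
        have h4 : 0 ≤ (massIn (G n) r + massIn g r) ^ 2 * (r ^ 2)⁻¹ := by positivity
        linarith [show (massIn (G n) r + massIn g r) ^ 2 * (r ^ 2)⁻¹
          = 2 * (massIn (G n) r * massIn (G n) r * (r ^ 2)⁻¹)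
            + 2 * (massIn g r * massIn g r * (r ^ 2)⁻¹)
            - (massIn (G n) r - massIn g r) ^ 2 * (r ^ 2)⁻¹ by ring]
      linarith
    · have := (((hlim r).sub_const (massIn g r)).pow 2).mul_const (r ^ 2)⁻¹
      simpa using this

/-- Admissible densities with controlled `J` and controlled masses. -/
def controlled (Q : ℝ → ℝ → ℝ) (M j : ℝ) (q m : ℕ → ℝ) (n : ℕ) : Set (E3 × E3 → ℝ) :=
  {h | Admissible Q M h ∧ casimirKinetic Q h ≤ j + 1 / ((n : ℝ) + 1) ∧
    ∀ i ≤ n, |massIn h (q i) - m i| ≤ 1 / ((n : ℝ) + 1)}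

theorem CasimirAssumptions.convex_controlled
    (hQ : CasimirAssumptions Q μ₁ μ₂ μ₃ C₁ C₂ C₃ C₄ F₀) (M j : ℝ) (q m : ℕ → ℝ) (n : ℕ) :
    Convex ℝ (controlled Q M j q m n) := by
  rintro f ⟨hf, hfj, hfm⟩ g ⟨hg, hgj, hgm⟩ a b ha hb hab
  obtain ⟨h1, h2⟩ := hQ.admissible_convex hf hg ha hb hab
  refine ⟨h1, ?_, fun i hi => ?_⟩
  · have : a * (j + 1 / ((n : ℝ) + 1)) + b * (j + 1 / ((n : ℝ) + 1)) = j + 1 / ((n : ℝ) + 1) := by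
      rw [← add_mul, hab, one_mul]
    nlinarith
  · rw [massIn_convex hf.integrable hg.integrable]
    have e : a * massIn f (q i) + b * massIn g (q i) - m i
        = a * (massIn f (q i) - m i) + b * (massIn g (q i) - m i) := by
      linear_combination (-(m i)) * hab.symm
    rw [e]
    calc _ ≤ |a * (massIn f (q i) - m i)| + |b * (massIn g (q i) - m i)| := abs_add_le _ _
      _ = a * |massIn f (q i) - m i| + b * |massIn g (q i) - m i| := by
          rw [abs_mul, abs_mul, abs_of_nonneg ha, abs_of_nonneg hb]
      _ ≤ a * (1 / ((n : ℝ) + 1)) + b * (1 / ((n : ℝ) + 1)) := by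
          gcongr
          · exact hfm i hi
          · exact hgm i hi
      _ = _ := by rw [← add_mul, hab, one_mul]

theorem antitone_controlled (Q : ℝ → ℝ → ℝ) (M j : ℝ) (q m : ℕ → ℝ) :
    Antitone (controlled Q M j q m) := by
  rintro n k hnk h ⟨h1, h2, h3⟩
  have hle : 1 / ((k : ℝ) + 1) ≤ 1 / ((n : ℝ) + 1) := by
    have : (n : ℝ) ≤ k := by exact_mod_cast hnk
    gcongr
  exact ⟨h1, h2.trans (by gcongr), fun i hi => (h3 i (hi.trans hnk)).trans hle⟩

end

/-! ### Compactness of minimizing sequences and variational stability -/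

section
variable {Q : ℝ → ℝ → ℝ} {μ₁ μ₂ μ₃ C₁ C₂ C₃ C₄ F₀ M : ℝ} {f g : E3 × E3 → ℝ}

/-- A selection of controlled densities that converges almost everywhere. -/
theorem CasimirAssumptions.exists_limit
    (hQ : CasimirAssumptions Q μ₁ μ₂ μ₃ C₁ C₂ C₃ C₄ F₀) {j : ℝ} {q m : ℕ → ℝ}
    (hne : ∀ n, (controlled Q M j q m n).Nonempty) :
    ∃ (G : ℕ → E3 × E3 → ℝ) (g : E3 × E3 → ℝ), (∀ n, G n ∈ controlled Q M j q m n) ∧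
      ∀ᵐ z, Tendsto (fun n => G n z) atTop (𝓝 (g z)) := by
  -- The selection lemma needs a finite measure; a finite measure with the same null sets suffices,
  -- since only convergence almost everywhere is wanted.
  set μ := (volume : Measure (E3 × E3)).toFinite with hμ
  have hac : μ ≪ volume := toFinite_absolutelyContinuous _
  have hac' : (volume : Measure (E3 × E3)) ≪ μ := absolutelyContinuous_toFinite _
  obtain ⟨G, E, hG, -, hE⟩ := exists_tendsto_exp_of_convex μ (controlled Q M j q m)
    (hQ.convex_controlled M j q m) (antitone_controlled Q M j q m) hne
    (fun f hf => ⟨hf.1.integrable.1.mono_ac hac, hac.ae_le hf.1.nonneg⟩)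
  have hE' : ∀ᵐ z : E3 × E3, Tendsto (fun n => Real.exp (-(G n z) / 2)) atTop (𝓝 (E z)) :=
    hac'.ae_le hE
  -- A zero limit of exp(−G/2) would mean G → ∞. Fatou's lemma and the fixed mass M exclude this
  -- almost everywhere, after which −2 log recovers the limit of G.
  have hfin : ∀ᵐ z : E3 × E3, liminf (fun n => ENNReal.ofReal (G n z)) atTop < ∞ := by
    have hm : ∀ n, AEMeasurable (fun z => ENNReal.ofReal (G n z)) := fun n =>
      (hG n).1.integrable.1.aemeasurable.ennreal_ofReal
    have hml : AEMeasurable (fun z => liminf (fun n => ENNReal.ofReal (G n z)) atTop) := by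
      refine ⟨_, Measurable.liminf fun n => (hm n).measurable_mk, ?_⟩
      filter_upwards [ae_all_iff.2 fun n => (hm n).ae_eq_mk] with z hz
      simp only [hz]
    refine ae_lt_top' hml ?_
    refine ne_top_of_le_ne_top ?_ (lintegral_liminf_le' fun n =>
      (hG n).1.integrable.1.aemeasurable.ennreal_ofReal)
    have : ∀ n, ∫⁻ z, ENNReal.ofReal (G n z) = ENNReal.ofReal M := fun n => by
      rw [← ofReal_integral_eq_lintegral_ofReal (hG n).1.integrable (hG n).1.nonneg, (hG n).1.mass]
    simp only [this, liminf_const]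
    exact ENNReal.ofReal_ne_top
  refine ⟨G, fun z => -2 * Real.log (E z), hG, ?_⟩
  filter_upwards [hE', hfin] with z h1 h2
  have hpos : 0 ≤ E z := ge_of_tendsto' h1 fun n => (Real.exp_pos _).le
  rcases hpos.eq_or_lt with h0 | h0
  · exfalso
    rw [← h0] at h1
    have h3 : Tendsto (fun n => -(G n z) / 2) atTop atBot := by
      have := Real.tendsto_exp_comp_nhds_zero.1 h1
      exact this
    have h4 : Tendsto (fun n => G n z) atTop atTop := by
      have := (tendsto_neg_atBot_atTop.comp h3).const_mul_atTop (show (0:ℝ) < 2 by norm_num)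
      refine this.congr fun n => ?_
      simp only [Function.comp]; ring
    have h5 := (ENNReal.tendsto_ofReal_atTop.comp h4).liminf_eq
    simp only [Function.comp_def] at h5
    rw [h5] at h2
    exact lt_irrefl _ h2
  · have h3 := ((Real.continuousAt_log h0.ne').tendsto.comp h1).const_mul (-2)
    refine h3.congr fun n => ?_
    simp only [Function.comp, Real.log_exp]
    ring

/-- The limit is admissible, possibly with less mass, and `J` does not increase. -/
theorem CasimirAssumptions.limit_admissible
    (hQ : CasimirAssumptions Q μ₁ μ₂ μ₃ C₁ C₂ C₃ C₄ F₀) {j : ℝ} {c : ℕ → ℝ}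
    {G : ℕ → E3 × E3 → ℝ} (hG : ∀ n, Admissible Q M (G n))
    (hGj : ∀ n, casimirKinetic Q (G n) ≤ c n) (hc : Tendsto c atTop (𝓝 j))
    (hlim : ∀ᵐ z, Tendsto (fun n => G n z) atTop (𝓝 (g z))) :
    Admissible Q (∫ z, g z) g ∧ ∫ z, g z ≤ M ∧ casimirKinetic Q g ≤ j := by
  have hall : ∀ᵐ z, ∀ n, 0 ≤ G n z := ae_all_iff.2 fun n => (hG n).nonneg
  have hnn : ∀ᵐ z, 0 ≤ g z := by
    filter_upwards [hlim, hall] with z h1 h2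
    exact ge_of_tendsto' h1 h2
  obtain ⟨hgi, hgM⟩ := integrable_of_tendsto_ae (fun n => (hG n).integrable) (fun n => (hG n).nonneg)
    hlim (fun n => (hG n).mass.le) tendsto_const_nhds
  have hQl : ∀ᵐ z : E3 × E3, Tendsto (fun n => Q (G n z) (angMom z.1 z.2)) atTop
      (𝓝 (Q (g z) (angMom z.1 z.2))) := by
    filter_upwards [hlim, hall, hnn] with z h1 h2 h3
    have h4 := (hQ.continuous_max.tendsto (g z, angMom z.1 z.2)).comp
      (h1.prodMk_nhds (tendsto_const_nhds (x := angMom z.1 z.2)))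
    simp only [Function.comp_def, max_eq_left h3, max_eq_left (angMom_nonneg z.1 z.2)] at h4
    refine h4.congr fun n => ?_
    rw [max_eq_left (h2 n)]
  have hFl : ∀ᵐ z : E3 × E3, Tendsto
      (fun n => Q (G n z) (angMom z.1 z.2) + 1 / 2 * (‖z.2‖ ^ 2 * G n z)) atTop
      (𝓝 (Q (g z) (angMom z.1 z.2) + 1 / 2 * (‖z.2‖ ^ 2 * g z))) := by
    filter_upwards [hlim, hQl] with z h1 h2
    exact h2.add ((h1.const_mul _).const_mul _)
  obtain ⟨hJi, hJ⟩ := integrable_of_tendsto_ae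
    (F := fun n z => Q (G n z) (angMom z.1 z.2) + 1 / 2 * (‖z.2‖ ^ 2 * G n z)) (c := c) (C := j)
    (fun n => (hG n).casimir_finite.add ((hG n).kinetic_finite.const_mul _))
    (fun n => by
      filter_upwards [hQ.casimir_ae_nonneg (hG n).nonneg, (hG n).nonneg] with z h1 h2
      positivity) hFl
    (fun n => by
      rw [integral_add (hG n).casimir_finite ((hG n).kinetic_finite.const_mul _), integral_const_mul]
      exact hGj n) hc
  have hQi : Integrable (fun z : E3 × E3 => Q (g z) (angMom z.1 z.2)) := by
    refine hJi.mono' (hQ.aestronglyMeasurable hgi.1 hnn) ?_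
    filter_upwards [hQ.casimir_ae_nonneg hnn, hnn] with z h1 h2
    rw [Real.norm_of_nonneg h1]
    have : 0 ≤ 1 / 2 * (‖z.2‖ ^ 2 * g z) := by positivity
    linarith
  have hKi : Integrable (fun z : E3 × E3 => ‖z.2‖ ^ 2 * g z) := by
    have := (hJi.sub hQi).const_mul 2
    refine this.congr (ae_of_all _ fun z => ?_)
    simp only [Pi.sub_apply]; ring
  refine ⟨⟨hgi, hnn, rfl, hQi, hKi, fun A hA => ?_⟩, hgM, ?_⟩
  · have h1 : ∀ᵐ z : E3 × E3, ∀ n, G n (A z.1, A z.2) = G n z :=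
      ae_all_iff.2 fun n => (hG n).symmetric A hA
    have h2 := (measurePreserving_rotation A).quasiMeasurePreserving.ae hlim
    filter_upwards [h1, h2, hlim] with z h1 h2 h3
    refine tendsto_nhds_unique h2 (h3.congr fun n => ?_)
    exact (h1 n).symm
  · rw [integral_add hQi (hKi.const_mul _), integral_const_mul] at hJ
    exact hJ

/-- Minimizing sequences approach the set of minimizers. -/
theorem CasimirAssumptions.exists_totalDist_lt
    (hQ : CasimirAssumptions Q μ₁ μ₂ μ₃ C₁ C₂ C₃ C₄ F₀) (hM : 0 < M) {fm : E3 × E3 → ℝ}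
    (hfm : fm ∈ minimizers Q M) {G : ℕ → E3 × E3 → ℝ} (hG : ∀ n, Admissible Q M (G n))
    (hlim : Tendsto (fun n => energyCasimir Q (G n)) atTop (𝓝 (energyCasimir Q fm)))
    {ε : ℝ} (hε : 0 < ε) : ∃ n, ∃ f₀ ∈ minimizers Q M, totalDist Q M (G n) f₀ < ε := by
  obtain ⟨d, hd⟩ := hlim.bddAbove_range
  obtain ⟨jm, hjm, hJ⟩ := hQ.exists_casimirKinetic_le M d
  have hGJ : ∀ n, casimirKinetic Q (G n) ≤ jm := fun n => hJ _ (hG n) (hd ⟨n, rfl⟩)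
  set q : ℕ → ℝ := TopologicalSpace.denseSeq ℝ with hq
  have hqd : DenseRange q := TopologicalSpace.denseRange_denseSeq ℝ
  -- By Tychonoff's theorem one subsequence serves for J and for the masses at all radii of a
  -- countable dense set.
  have hcomp : IsCompact (Icc (0:ℝ) jm ×ˢ (univ.pi fun _ : ℕ => Icc (0:ℝ) M)) :=
    isCompact_Icc.prod (isCompact_univ_pi fun _ => isCompact_Icc)
  obtain ⟨⟨j, m⟩, -, φ, hφ, hφl⟩ := hcomp.tendsto_subseq
    (x := fun n => (casimirKinetic Q (G n), fun i => massIn (G n) (q i))) fun n =>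
    ⟨⟨hQ.casimirKinetic_nonneg (hG n).nonneg, hGJ n⟩, fun i _ =>
      ⟨(hG n).isRadial.massIn_nonneg _, (hG n).mass ▸ (hG n).isRadial.massIn_le _⟩⟩
  have hj : Tendsto (fun n => casimirKinetic Q (G (φ n))) atTop (𝓝 j) :=
    (continuous_fst.tendsto _).comp hφl
  have hm : ∀ i, Tendsto (fun n => massIn (G (φ n)) (q i)) atTop (𝓝 (m i)) := fun i =>
    (((continuous_apply i).comp continuous_snd).tendsto _).comp hφl
  have hne : ∀ n, (controlled Q M j q m n).Nonempty := by
    intro n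
    have hp : 0 < 1 / ((n : ℝ) + 1) := by positivity
    have h1 : ∀ᶠ k in atTop, casimirKinetic Q (G (φ k)) < j + 1 / ((n : ℝ) + 1) :=
      hj.eventually (gt_mem_nhds (by linarith))
    have h2 : ∀ᶠ k in atTop, ∀ i ∈ Iic n, |massIn (G (φ k)) (q i) - m i| ≤ 1 / ((n : ℝ) + 1) := by
      rw [eventually_all_finite (finite_Iic n)]
      intro i _
      filter_upwards [Metric.tendsto_nhds.1 (hm i) _ hp] with k hk
      rw [Real.dist_eq] at hk
      exact hk.le
    obtain ⟨k, hk1, hk2⟩ := (h1.and h2).exists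
    exact ⟨G (φ k), hG _, hk1.le, fun i hi => hk2 i hi⟩
  obtain ⟨H, g, hH, hHg⟩ := hQ.exists_limit hne
  have hct : Tendsto (fun n : ℕ => j + 1 / ((n : ℝ) + 1)) atTop (𝓝 j) := by
    simpa using tendsto_one_div_add_atTop_nhds_zero_nat.const_add j
  obtain ⟨hgA, hgM, hgj⟩ := hQ.limit_admissible (fun n => (hH n).1) (fun n => (hH n).2.1) hct hHg
  have hHm := hQ.tendsto_massIn (j := j + 1) (fun n => (hH n).1) hgA (fun n => (hH n).2.1.trans (by
    have : 1 / ((n : ℝ) + 1) ≤ 1 := by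
      rw [div_le_one (by positivity)]; linarith [Nat.cast_nonneg (α := ℝ) n]
    linarith)) (by linarith) hHg
  have hmg : ∀ i, massIn g (q i) = m i := by
    intro i
    refine tendsto_nhds_unique (hHm (q i)) ?_
    rw [tendsto_iff_norm_sub_tendsto_zero]
    refine squeeze_zero' (Eventually.of_forall fun n => norm_nonneg _) ?_
      tendsto_one_div_add_atTop_nhds_zero_nat
    filter_upwards [eventually_ge_atTop i] with n hn
    exact (hH n).2.2 i hn
  -- The limit g was built from H, an auxiliary selection, yet the masses of the original
  -- subsequence converge to those of g on the dense set; monotonicity and continuity of the mass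
  -- function extend this to every radius.
  have hGm := tendsto_of_monotone_of_dense (fun n => (hG (φ n)).isRadial.massIn_mono)
    hgA.isRadial.continuous_massIn hqd (fun i => by rw [hmg i]; exact hm i)
  obtain ⟨hpot, hfield⟩ := hQ.tendsto_field hjm (fun n => hG (φ n)) hgA.isRadial
    (fun n => hGJ (φ n)) hGm
  have hDl := hlim.comp hφ.tendsto_atTop
  -- The field energies converge, so the minimum is j minus the field energy of g. As J(g) ≤ j, D(g)
  -- does not exceed the minimum.
  have hDeq : energyCasimir Q fm = j - 1 / 2 * potEnergy g g := by
    refine tendsto_nhds_unique hDl ((hj.sub (hpot.const_mul _)).congr fun n => ?_)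
    exact ((hG (φ n)).isRadial.energyCasimir_eq).symm
  have hDg : energyCasimir Q g ≤ energyCasimir Q fm := by
    rw [hgA.isRadial.energyCasimir_eq, hDeq]; linarith
  have hneg : energyCasimir Q fm < 0 := by
    obtain ⟨h, hh, hh0⟩ := hQ.exists_negative hM
    exact (hfm.2 h hh).trans_lt hh0
  -- A limit without mass would have no field energy, hence D(g) ≥ 0, against the negative minimum.
  have hM0 : 0 < ∫ z, g z := by
    refine lt_of_le_of_ne (integral_nonneg_of_ae hgA.nonneg) fun h0 => ?_
    have hz : ∀ r, massIn g r = 0 := fun r =>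
      le_antisymm ((hgA.isRadial.massIn_le r).trans_eq h0.symm) (hgA.isRadial.massIn_nonneg r)
    have hp : potEnergy g g = 0 := by simp [potEnergy, hz]
    have := hQ.casimirKinetic_nonneg hgA.nonneg
    rw [hgA.isRadial.energyCasimir_eq, hp] at hDg
    linarith
  -- If mass were lost, restoring it by a dilation would push the energy strictly below the minimum.
  have hmass : ∫ z, g z = M := by
    by_contra hne'
    obtain ⟨h, hh, hlt⟩ := hQ.exists_lower hgA hM0 (lt_of_le_of_ne hgM hne') (hDg.trans_lt hneg)
    linarith [hfm.2 h hh]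
  rw [hmass] at hgA
  have hgmin : g ∈ minimizers Q M := ⟨hgA, fun h hh => hDg.trans (hfm.2 h hh)⟩
  have hDg' : energyCasimir Q g = energyCasimir Q fm := le_antisymm hDg (hfm.2 g hgA)
  have htot : Tendsto (fun n => totalDist Q M (G (φ n)) g) atTop (𝓝 0) := by
    have h1 := (hDl.sub_const (energyCasimir Q g)).add hfield
    rw [hDg', sub_self, zero_add] at h1
    refine h1.congr fun n => ?_
    rw [hQ.totalDist_eq (hG (φ n)) hgA, hDg']
    rfl
  obtain ⟨n, hn⟩ := (htot.eventually (gt_mem_nhds hε)).exists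
  exact ⟨φ n, g, hgmin, hn⟩

/-- Stability with respect to any class of evolutions that conserve the energy-Casimir functional. -/
theorem CasimirAssumptions.exists_delta
    (hQ : CasimirAssumptions Q μ₁ μ₂ μ₃ C₁ C₂ C₃ C₄ F₀) (hM : 0 < M) {ε : ℝ} (hε : 0 < ε) :
    ∃ δ : ℝ, 0 < δ ∧ ∀ f g, Admissible Q M f → Admissible Q M g →
      energyCasimir Q g = energyCasimir Q f → distToMinimizers Q M f < (δ : EReal) →
      distToMinimizers Q M g < (ε : EReal) := by
  by_cases hne : (minimizers Q M).Nonempty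
  · obtain ⟨fm, hfm⟩ := hne
    by_contra hcon
    push Not at hcon
    have hδ : ∀ n : ℕ, 0 < 1 / ((n : ℝ) + 1) := fun n => by positivity
    choose f g hf hg hD hlt hge using fun n : ℕ => hcon _ (hδ n)
    have hsmall : ∀ n, energyCasimir Q (g n) < energyCasimir Q fm + 1 / ((n : ℝ) + 1) := by
      intro n
      have h := hlt n
      simp only [distToMinimizers, iInf_lt_iff] at h
      obtain ⟨f₀, hf₀, h⟩ := h
      have h1 : totalDist Q M (f n) f₀ < 1 / ((n : ℝ) + 1) := by exact_mod_cast h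
      have h2 := hQ.energyCasimir_sub_le_totalDist (hf n) hf₀.1
      have h3 := hf₀.2 fm hfm.1
      rw [hD n]
      linarith
    have hlim : Tendsto (fun n => energyCasimir Q (g n)) atTop (𝓝 (energyCasimir Q fm)) := by
      refine tendsto_of_tendsto_of_tendsto_of_le_of_le tendsto_const_nhds
        (h := fun n : ℕ => energyCasimir Q fm + 1 / ((n : ℝ) + 1)) ?_
        (fun n => hfm.2 _ (hg n)) (fun n => (hsmall n).le)
      simpa using tendsto_one_div_add_atTop_nhds_zero_nat.const_add (energyCasimir Q fm)
    obtain ⟨n, f₀, hf₀, h⟩ := hQ.exists_totalDist_lt hM hfm hg hlim hε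
    refine absurd (hge n) (not_le.2 ?_)
    refine (iInf₂_le f₀ hf₀).trans_lt ?_
    exact_mod_cast h
  -- Without minimizers the infimum is +∞ and the smallness assumption cannot hold, so any δ will
  -- do.
  · refine ⟨1, one_pos, fun f g _ _ _ h => ?_⟩
    rw [not_nonempty_iff_eq_empty] at hne
    simp [distToMinimizers, hne] at h

end

/-! ### Integration by parts and the divergence-free Vlasov field -/

theorem integral_fderiv_eq_zero {E : Type*} [NormedAddCommGroup E] [NormedSpace ℝ E]
    [FiniteDimensional ℝ E] [MeasurableSpace E] [BorelSpace E] {μ : Measure E}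
    [μ.IsAddHaarMeasure] {G : E → ℝ} (hG : ContDiff ℝ 1 G) (hc : HasCompactSupport G) (e : E) :
    ∫ x, fderiv ℝ G x e ∂μ = 0 := by
  have hi : Integrable (fun x => fderiv ℝ G x e) μ :=
    ((hG.continuous_fderiv one_ne_zero).clm_apply continuous_const).integrable_of_hasCompactSupport
      (hc.fderiv_apply ℝ e)
  have h := integral_mul_fderiv_eq_neg_fderiv_mul_of_integrable (μ := μ) (v := e)
    (f := fun _ : E => (1 : ℝ)) (g := G) (by simp) (by simpa using hi)
    (by simpa using hG.continuous.integrable_of_hasCompactSupport hc)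
    (by fun_prop) (fun x _ => hG.differentiable one_ne_zero x)
  simpa using h

theorem fderiv_prodMk_left {G : E3 × E3 → ℝ} (hG : Differentiable ℝ G) (x v e : E3) :
    fderiv ℝ (fun y => G (y, v)) x e = fderiv ℝ G (x, v) (e, 0) := by
  have h := (hG (x, v)).hasFDerivAt.comp x (f := fun y => (y, v)) (hasFDerivAt_prodMk_left x v)
  have h2 : fderiv ℝ (fun y => G (y, v)) x = _ := h.fderiv
  rw [h2]
  simp

theorem fderiv_prodMk_right {G : E3 × E3 → ℝ} (hG : Differentiable ℝ G) (x v e : E3) :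
    fderiv ℝ (fun w => G (x, w)) v e = fderiv ℝ G (x, v) (0, e) := by
  have h := (hG (x, v)).hasFDerivAt.comp v (hasFDerivAt_prodMk_right x v)
  have h2 : fderiv ℝ (fun w => G (x, w)) v = _ := h.fderiv
  rw [h2]
  simp

theorem hasCompactSupport_slice_left {G : E3 × E3 → ℝ} (hc : HasCompactSupport G) (v : E3) :
    HasCompactSupport (fun y => G (y, v)) :=
  HasCompactSupport.intro (hc.image continuous_fst) fun x hx =>
    image_eq_zero_of_notMem_tsupport fun h => hx ⟨(x, v), h, rfl⟩

theorem hasCompactSupport_slice_right {G : E3 × E3 → ℝ} (hc : HasCompactSupport G) (x : E3) :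
    HasCompactSupport (fun w => G (x, w)) :=
  HasCompactSupport.intro (hc.image continuous_snd) fun v hv =>
    image_eq_zero_of_notMem_tsupport fun h => hv ⟨(x, v), h, rfl⟩

/-- The Vlasov vector field is divergence free. -/
theorem integral_fderiv_vlasov {G : E3 × E3 → ℝ} (hG : ContDiff ℝ 1 G) (hc : HasCompactSupport G)
    {F : E3 → E3} (hF : Continuous F) :
    Integrable (fun z : E3 × E3 => fderiv ℝ G z (z.2, -F z.1)) ∧
    ∫ z : E3 × E3, fderiv ℝ G z (z.2, -F z.1) = 0 := by
  have hd := hG.differentiable one_ne_zero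
  have hcd := hG.continuous_fderiv one_ne_zero
  have hcs : HasCompactSupport (fderiv ℝ G) := hc.fderiv ℝ
  have hint : ∀ w : E3 × E3 → E3 × E3, Continuous w →
      Integrable (fun z => fderiv ℝ G z (w z)) := fun w hw =>
    (hcd.clm_apply hw).integrable_of_hasCompactSupport
      (hcs.mono' fun z hz => subset_tsupport _ fun h0 => hz (by
        show fderiv ℝ G z (w z) = 0
        rw [h0]; rfl))
  have h1 : Integrable (fun z : E3 × E3 => fderiv ℝ G z (z.2, 0)) := hint _ (by fun_prop)
  have h2 : Integrable (fun z : E3 × E3 => fderiv ℝ G z (0, -F z.1)) := hint _ (by fun_prop)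
  refine ⟨hint _ (by fun_prop), ?_⟩
  -- The transport part is constant in x for fixed v, and the force part is constant in v for fixed
  -- x. Each integrates to zero over its own slices.
  have hs : ∀ z : E3 × E3, fderiv ℝ G z (z.2, -F z.1)
      = fderiv ℝ G z (z.2, 0) + fderiv ℝ G z (0, -F z.1) := fun z => by
    rw [← map_add]; simp
  simp only [hs]
  rw [integral_add h1 h2]
  have e1 : ∫ z : E3 × E3, fderiv ℝ G z (z.2, 0) = 0 := by
    rw [Measure.volume_eq_prod] at h1 ⊢
    rw [integral_prod_symm _ h1]
    refine integral_eq_zero_of_ae (Eventually.of_forall fun v => ?_)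
    show ∫ x, fderiv ℝ G (x, v) (v, 0) = 0
    simp only [← fderiv_prodMk_left hd]
    exact integral_fderiv_eq_zero (hG.comp (contDiff_prodMk_left v))
      (hasCompactSupport_slice_left hc v) v
  have e2 : ∫ z : E3 × E3, fderiv ℝ G z (0, -F z.1) = 0 := by
    rw [Measure.volume_eq_prod] at h2 ⊢
    rw [integral_prod _ h2]
    refine integral_eq_zero_of_ae (Eventually.of_forall fun x => ?_)
    show ∫ v, fderiv ℝ G (x, v) (0, -F x) = 0
    simp only [← fderiv_prodMk_right hd]
    exact integral_fderiv_eq_zero (hG.comp (contDiff_prodMk_right x))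
      (hasCompactSupport_slice_right hc x) _
  rw [e1, e2, add_zero]

/-! ### Functions of class `C¹` on a time slab -/

section Slab

variable {E : Type*} [NormedAddCommGroup E] [NormedSpace ℝ E] {τ : ℝ} {G : ℝ → E → ℝ}

/-- `G` is of class `C¹` on `[0, τ] × E`. -/
def SlabC1 (τ : ℝ) (G : ℝ → E → ℝ) : Prop :=
  ContDiffOn ℝ 1 (fun p : ℝ × E => G p.1 p.2) (Icc 0 τ ×ˢ univ)

theorem SlabC1.contDiff (hG : SlabC1 τ G) {s : ℝ} (hs : s ∈ Icc 0 τ) : ContDiff ℝ 1 (G s) := by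
  have h : ContDiffOn ℝ 1 (fun p : ℝ × E => G p.1 p.2) (Icc 0 τ ×ˢ univ) := hG
  have h2 := h.comp (s := univ) (f := fun z : E => (s, z)) (by fun_prop) fun z _ => ⟨hs, mem_univ _⟩
  exact contDiffOn_univ.1 h2

theorem SlabC1.hasFDerivAt (hG : SlabC1 τ G) {s : ℝ} (hs : s ∈ Ioo 0 τ) (z : E) :
    HasFDerivAt (fun p : ℝ × E => G p.1 p.2)
      (fderivWithin ℝ (fun p : ℝ × E => G p.1 p.2) (Icc 0 τ ×ˢ univ) (s, z)) (s, z) := by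
  have h : ContDiffOn ℝ 1 (fun p : ℝ × E => G p.1 p.2) (Icc 0 τ ×ˢ univ) := hG
  have hn : Icc 0 τ ×ˢ (univ : Set E) ∈ 𝓝 (s, z) :=
    prod_mem_nhds (Icc_mem_nhds hs.1 hs.2) univ_mem
  exact ((h.differentiableOn one_ne_zero) (s, z)
    ⟨Ioo_subset_Icc_self hs, mem_univ _⟩).hasFDerivWithinAt.hasFDerivAt hn

theorem SlabC1.uniqueDiffOn (hτ : 0 < τ) : UniqueDiffOn ℝ (Icc 0 τ ×ˢ (univ : Set E)) :=
  (uniqueDiffOn_Icc hτ).prod uniqueDiffOn_univ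

theorem SlabC1.continuousOn_fderivWithin (hG : SlabC1 τ G) (hτ : 0 < τ) :
    ContinuousOn (fderivWithin ℝ (fun p : ℝ × E => G p.1 p.2) (Icc 0 τ ×ˢ univ))
      (Icc 0 τ ×ˢ univ) :=
  ContDiffOn.continuousOn_fderivWithin hG (SlabC1.uniqueDiffOn hτ) le_rfl

theorem SlabC1.hasDerivAt (hG : SlabC1 τ G) {s : ℝ} (hs : s ∈ Ioo 0 τ) (z : E) :
    HasDerivAt (fun r => G r z)
      (fderivWithin ℝ (fun p : ℝ × E => G p.1 p.2) (Icc 0 τ ×ˢ univ) (s, z) (1, 0)) s := by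
  have h := (hG.hasFDerivAt hs z).comp_hasDerivAt s
    (f := fun r => (r, z)) ((hasDerivAt_id s).prodMk (hasDerivAt_const s z))
  exact h

theorem SlabC1.fderiv_eq (hG : SlabC1 τ G) {s : ℝ} (hs : s ∈ Ioo 0 τ) (z e : E) :
    fderiv ℝ (G s) z e
      = fderivWithin ℝ (fun p : ℝ × E => G p.1 p.2) (Icc 0 τ ×ˢ univ) (s, z) (0, e) := by
  have h := (hG.hasFDerivAt hs z).comp z (hasFDerivAt_prodMk_right s z)
  have h2 : fderiv ℝ (G s) z = _ := h.fderiv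
  rw [h2]
  simp

theorem SlabC1.continuousOn (hG : SlabC1 τ G) :
    ContinuousOn (fun p : ℝ × E => G p.1 p.2) (Icc 0 τ ×ˢ univ) := ContDiffOn.continuousOn hG

theorem SlabC1.mul {H : ℝ → E → ℝ} (hG : SlabC1 τ G) (hH : SlabC1 τ H) :
    SlabC1 τ (fun s z => G s z * H s z) := ContDiffOn.mul hG hH

theorem SlabC1.sub {H : ℝ → E → ℝ} (hG : SlabC1 τ G) (hH : SlabC1 τ H) :
    SlabC1 τ (fun s z => G s z - H s z) := ContDiffOn.sub hG hH

theorem SlabC1.const {g : E → ℝ} (hg : ContDiff ℝ 1 g) : SlabC1 τ (fun _ => g) :=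
  (hg.comp contDiff_snd).contDiffOn

theorem SlabC1.comp_left (hG : SlabC1 τ G) {b : ℝ → ℝ} (hb : ContDiff ℝ 1 b) :
    SlabC1 τ (fun s z => b (G s z)) := hb.comp_contDiffOn hG

theorem SlabC1.comp_right {E' : Type*} [NormedAddCommGroup E'] [NormedSpace ℝ E']
    (hG : SlabC1 τ G) {k : E' → E} (hk : ContDiff ℝ 1 k) :
    SlabC1 τ (fun s z => G s (k z)) :=
  ContDiffOn.comp (g := fun p : ℝ × E => G p.1 p.2) (f := fun p : ℝ × E' => (p.1, k p.2)) hG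
    (by fun_prop) fun _ hp => ⟨hp.1, mem_univ _⟩

variable [MeasurableSpace E] [BorelSpace E] [FiniteDimensional ℝ E] {μ : Measure E}
  [IsFiniteMeasureOnCompacts μ]

theorem SlabC1.continuousOn_integral (hG : SlabC1 τ G) {R : ℝ}
    (hR : ∀ s ∈ Icc 0 τ, ∀ z, R < ‖z‖ → G s z = 0) :
    ContinuousOn (fun s => ∫ z, G s z ∂μ) (Icc 0 τ) :=
  haveI : ProperSpace E := FiniteDimensional.proper ℝ E
  continuousOn_integral_of_compact_support (isCompact_closedBall (0 : E) R) hG.continuousOn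
    fun s z hs hz => hR s hs z (by simpa using hz)

theorem SlabC1.hasDerivAt_integral (hG : SlabC1 τ G) {R : ℝ}
    (hR : ∀ s ∈ Icc 0 τ, ∀ z, R < ‖z‖ → G s z = 0) {s : ℝ} (hs : s ∈ Ioo 0 τ) :
    Integrable (fun z => deriv (fun r => G r z) s) μ ∧
    HasDerivAt (fun r => ∫ z, G r z ∂μ) (∫ z, deriv (fun r => G r z) s ∂μ) s := by
  have : ProperSpace E := FiniteDimensional.proper ℝ E
  have hτ : 0 < τ := hs.1.trans hs.2
  have hcont := hG.continuousOn_fderivWithin hτ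
  obtain ⟨C, hC⟩ := ((isCompact_Icc (a := (0:ℝ)) (b := τ)).prod
    (isCompact_closedBall (0 : E) R)).exists_bound_of_continuousOn
    ((hcont.clm_apply (continuousOn_const (c := ((1 : ℝ), (0 : E))))).mono
      (prod_mono_right (subset_univ _)))
  have hz0 : ∀ r ∈ Ioo 0 τ, ∀ z, R < ‖z‖ → deriv (fun r => G r z) r = 0 := fun r hr z hz => by
    have : (fun r => G r z) =ᶠ[𝓝 r] fun _ => 0 := by
      filter_upwards [Icc_mem_nhds hr.1 hr.2] with u hu using hR u hu z hz
    rw [this.deriv_eq]; simp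
  have hmem : ∀ {r}, r ∈ Ioo 0 τ → r ∈ Icc 0 τ := fun h => Ioo_subset_Icc_self h
  refine hasDerivAt_integral_of_dominated_loc_of_deriv_le (F := G)
    (F' := fun r z => deriv (fun r => G r z) r) (s := Ioo 0 τ)
    (bound := (Metric.closedBall (0 : E) R).indicator fun _ => C)
    (Ioo_mem_nhds hs.1 hs.2) ?_ ?_ ?_ ?_ ?_ ?_
  · filter_upwards [Icc_mem_nhds hs.1 hs.2] with r hr
      using (hG.contDiff hr).continuous.aestronglyMeasurable
  · exact (hG.contDiff (hmem hs)).continuous.integrable_of_hasCompactSupport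
      (HasCompactSupport.intro (isCompact_closedBall (0 : E) R)
        fun z hz => hR s (hmem hs) z (by simpa using hz))
  · have : Continuous fun z => deriv (fun r => G r z) s := by
      have h1 : (fun z => deriv (fun r => G r z) s) = fun z =>
        fderivWithin ℝ (fun p : ℝ × E => G p.1 p.2) (Icc 0 τ ×ˢ univ) (s, z) (1, 0) :=
        funext fun z => (hG.hasDerivAt hs z).deriv
      rw [h1]
      have h2 : ContinuousOn (fun z =>
        fderivWithin ℝ (fun p : ℝ × E => G p.1 p.2) (Icc 0 τ ×ˢ univ) (s, z)) univ :=
        hcont.comp (f := fun z : E => (s, z)) (by fun_prop) fun z _ => ⟨hmem hs, mem_univ _⟩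
      exact (continuousOn_univ.1 h2).clm_apply continuous_const
    exact this.aestronglyMeasurable
  · refine Eventually.of_forall fun z r hr => ?_
    by_cases hz : z ∈ Metric.closedBall (0 : E) R
    · rw [indicator_of_mem hz, (hG.hasDerivAt hr z).deriv]
      exact hC (r, z) ⟨hmem hr, hz⟩
    · rw [indicator_of_notMem hz, hz0 r hr z (by simpa using hz), norm_zero]
  · exact (integrable_indicator_iff Metric.isClosed_closedBall.measurableSet).2
      (integrableOn_const (isCompact_closedBall (0 : E) R).measure_lt_top.ne)
  · exact Eventually.of_forall fun z r hr => (hG.hasDerivAt hr z).differentiableAt.hasDerivAt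

end Slab

/-- Grönwall's inequality: exp(−Cs)y(s) is nonincreasing. Differentiability is asked only in the
open interval, since time derivatives at the end points of the slab are not used. -/
theorem nonpos_of_deriv_le_mul {y y' : ℝ → ℝ} {τ C : ℝ} (hτ : 0 ≤ τ)
    (hc : ContinuousOn y (Icc 0 τ)) (hd : ∀ s ∈ Ioo 0 τ, HasDerivAt y (y' s) s)
    (hle : ∀ s ∈ Ioo 0 τ, y' s ≤ C * y s) (h0 : y 0 ≤ 0) : y τ ≤ 0 := by
  have hd2 : ∀ s ∈ Ioo 0 τ, HasDerivAt (fun s => Real.exp (-C * s) * y s)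
      (Real.exp (-C * s) * (y' s - C * y s)) s := fun s hs => by
    refine (((hasDerivAt_id s).const_mul (-C)).exp.mul (hd s hs)).congr_deriv ?_
    simp only [id]
    ring
  have ha : AntitoneOn (fun s => Real.exp (-C * s) * y s) (Icc 0 τ) := by
    refine antitoneOn_of_deriv_nonpos (convex_Icc 0 τ) (by fun_prop) ?_ ?_
    · rw [interior_Icc]
      exact fun s hs => (hd2 s hs).differentiableAt.differentiableWithinAt
    · rw [interior_Icc]
      intro s hs
      rw [(hd2 s hs).deriv]
      exact mul_nonpos_of_nonneg_of_nonpos (Real.exp_pos _).le (by linarith [hle s hs])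
  have h := ha (left_mem_Icc.2 hτ) (right_mem_Icc.2 hτ) hτ
  simp only [mul_zero, Real.exp_zero, one_mul] at h
  have hp := Real.exp_pos (-C * τ)
  by_contra hn
  push Not at hn
  nlinarith [mul_pos hp hn]

theorem eq_of_deriv_eq_zero {y : ℝ → ℝ} {τ : ℝ} (hτ : 0 ≤ τ)
    (hc : ContinuousOn y (Icc 0 τ)) (hd : ∀ s ∈ Ioo 0 τ, HasDerivAt y 0 s) : y τ = y 0 := by
  have h1 := nonpos_of_deriv_le_mul (y := fun s => y s - y 0) (y' := fun _ => 0) (C := 0) hτ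
    (by fun_prop) (fun s hs => (hd s hs).sub_const _) (by simp) (by simp)
  have h2 := nonpos_of_deriv_le_mul (y := fun s => y 0 - y s) (y' := fun _ => 0) (C := 0) hτ
    (by fun_prop) (fun s hs => by simpa using (hd s hs).const_sub (y 0)) (by simp) (by simp)
  linarith

/-! ### Derivatives along the Vlasov field -/

/-- The derivative of `G` along the characteristics `x' = v`, `v' = -F(x)` at time `s`. -/
def matDeriv (F : E3 → E3) (G : ℝ → E3 × E3 → ℝ) (s : ℝ) (z : E3 × E3) : ℝ :=
  deriv (fun r => G r z) s + fderiv ℝ (G s) z (z.2, -F z.1)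

variable {τ : ℝ} {G H : ℝ → E3 × E3 → ℝ} {F : E3 → E3}

theorem SlabC1.matDeriv_mul (hG : SlabC1 τ G) (hH : SlabC1 τ H) {s : ℝ} (hs : s ∈ Ioo 0 τ)
    (z : E3 × E3) :
    matDeriv F (fun r w => G r w * H r w) s z
      = matDeriv F G s z * H s z + G s z * matDeriv F H s z := by
  have hs' := Ioo_subset_Icc_self hs
  have h1 := (hG.hasDerivAt hs z).differentiableAt
  have h2 := (hH.hasDerivAt hs z).differentiableAt
  have h3 := (hG.contDiff hs').differentiable one_ne_zero z
  have h4 := (hH.contDiff hs').differentiable one_ne_zero z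
  have e1 : deriv (fun r => G r z * H r z) s = _ := deriv_mul h1 h2
  have e2 : fderiv ℝ (fun w => G s w * H s w) z = _ := fderiv_mul h3 h4
  simp only [matDeriv, e1, e2]
  simp only [add_apply, smul_apply, smul_eq_mul]
  ring

theorem SlabC1.matDeriv_sub (hG : SlabC1 τ G) (hH : SlabC1 τ H) {s : ℝ} (hs : s ∈ Ioo 0 τ)
    (z : E3 × E3) :
    matDeriv F (fun r w => G r w - H r w) s z = matDeriv F G s z - matDeriv F H s z := by
  have hs' := Ioo_subset_Icc_self hs
  have h1 := (hG.hasDerivAt hs z).differentiableAt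
  have h2 := (hH.hasDerivAt hs z).differentiableAt
  have h3 := (hG.contDiff hs').differentiable one_ne_zero z
  have h4 := (hH.contDiff hs').differentiable one_ne_zero z
  have e1 : deriv (fun r => G r z - H r z) s = _ := deriv_sub h1 h2
  have e2 : fderiv ℝ (fun w => G s w - H s w) z = _ := fderiv_sub h3 h4
  simp only [matDeriv, e1, e2]
  simp only [sub_apply]
  ring

theorem SlabC1.matDeriv_comp (hG : SlabC1 τ G) {b : ℝ → ℝ} (hb : ContDiff ℝ 1 b) {s : ℝ}
    (hs : s ∈ Ioo 0 τ) (z : E3 × E3) :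
    matDeriv F (fun r w => b (G r w)) s z = deriv b (G s z) * matDeriv F G s z := by
  have hs' := Ioo_subset_Icc_self hs
  have h1 := (hG.hasDerivAt hs z).differentiableAt.hasDerivAt
  have h3 := ((hG.contDiff hs').differentiable one_ne_zero z).hasFDerivAt
  have h5 := (hb.differentiable one_ne_zero (G s z)).hasDerivAt
  have e1 : deriv (fun r => b (G r z)) s = _ := (h5.comp s (h := fun r => G r z) h1).deriv
  have e2 : fderiv ℝ (fun w => b (G s w)) z = _ := (h5.comp_hasFDerivAt z h3).fderiv
  simp only [matDeriv, e1, e2]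
  simp only [smul_apply, smul_eq_mul]
  ring

theorem matDeriv_const (g : E3 × E3 → ℝ) (s : ℝ) (z : E3 × E3) :
    matDeriv F (fun _ => g) s z = fderiv ℝ g z (z.2, -F z.1) := by
  simp [matDeriv]

theorem SlabC1.matDeriv_eq (hG : SlabC1 τ G) {s : ℝ} (hs : s ∈ Ioo 0 τ) (z : E3 × E3) :
    matDeriv F G s z = fderivWithin ℝ (fun p : ℝ × (E3 × E3) => G p.1 p.2) (Icc 0 τ ×ˢ univ)
      (s, z) (1, (z.2, -F z.1)) := by
  rw [matDeriv, (hG.hasDerivAt hs z).deriv, hG.fderiv_eq hs, ← map_add]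
  simp

theorem SlabC1.hasDerivAt_integral_matDeriv (hG : SlabC1 τ G) {R : ℝ}
    (hR : ∀ s ∈ Icc 0 τ, ∀ z, R < ‖z‖ → G s z = 0) {s : ℝ} (hs : s ∈ Ioo 0 τ)
    (hF : Continuous F) :
    Integrable (matDeriv F G s) ∧
    HasDerivAt (fun r => ∫ z, G r z) (∫ z, matDeriv F G s z) s := by
  have hs' := Ioo_subset_Icc_self hs
  obtain ⟨i1, h1⟩ := hG.hasDerivAt_integral (μ := (volume : Measure (E3 × E3))) hR hs
  have hc : HasCompactSupport (G s) := HasCompactSupport.intro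
    (isCompact_closedBall (0 : E3 × E3) R) fun z hz => hR s hs' z (by simpa using hz)
  obtain ⟨i2, h2⟩ := integral_fderiv_vlasov (hG.contDiff hs') hc hF
  refine ⟨i1.add i2, h1.congr_deriv ?_⟩
  have : ∫ z, matDeriv F G s z = _ := integral_add i1 i2
  rw [this, h2, add_zero]

/-- `f` solves the Vlasov equation with the force field `-F` on `[0, τ]`. -/
structure Transported (τ : ℝ) (f : ℝ → E3 × E3 → ℝ) (F : ℝ → E3 → E3) : Prop where
  pos : 0 < τ
  slab : SlabC1 τ f
  continuous : ∀ s ∈ Icc 0 τ, Continuous (F s)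
  eq_zero : ∀ s ∈ Ioo 0 τ, ∀ z, matDeriv (F s) f s z = 0

theorem Transported.mono {f : ℝ → E3 × E3 → ℝ} {F : ℝ → E3 → E3} (h : Transported τ f F) {t : ℝ}
    (ht : 0 < t) (htτ : t ≤ τ) : Transported t f F where
  pos := ht
  slab := ContDiffOn.mono h.slab (prod_mono_left (Icc_subset_Icc_right htτ))
  continuous s hs := h.continuous s ⟨hs.1, hs.2.trans htτ⟩
  eq_zero s hs := h.eq_zero s ⟨hs.1, hs.2.trans_le htτ⟩

/-- Squaring the positive part removes its kink at 0, which yields a C¹ cut-off profile with an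
explicit derivative. -/
theorem hasDerivAt_max_sq (y : ℝ) : HasDerivAt (fun y : ℝ => max y 0 ^ 2) (2 * max y 0) y := by
  rcases lt_trichotomy y 0 with h | h | h
  · rw [max_eq_right h.le, mul_zero]
    refine (hasDerivAt_const y (0 : ℝ)).congr_of_eventuallyEq ?_
    filter_upwards [Iio_mem_nhds h] with u hu
    simp [max_eq_right ((mem_Iio.1 hu).le)]
  · subst h
    rw [max_self, mul_zero, hasDerivAt_iff_isLittleO_nhds_zero]
    have : (fun u : ℝ => u ^ 2) =o[𝓝 0] fun u => u := by
      simpa using Asymptotics.isLittleO_pow_id (𝕜 := ℝ) (n := 2) (by norm_num)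
    refine (Asymptotics.IsBigO.of_bound 1 (Eventually.of_forall fun u => ?_)).trans_isLittleO this
    simp only [zero_add, max_self, smul_zero, sub_zero, one_mul, Real.norm_eq_abs, abs_pow, sq_abs,
      zero_pow two_ne_zero]
    rcases le_total u 0 with h | h
    · rw [max_eq_right h]; simpa using sq_nonneg u
    · rw [max_eq_left h]
  · rw [max_eq_left h.le]
    have h2 := (hasDerivAt_pow 2 y)
    refine (h2.congr_deriv (by simp)).congr_of_eventuallyEq ?_
    filter_upwards [Ioi_mem_nhds h] with u hu
    rw [max_eq_left ((mem_Ioi.1 hu).le)]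

theorem contDiff_max_sq : ContDiff ℝ 1 (fun y : ℝ => max y 0 ^ 2) := by
  rw [contDiff_one_iff_deriv]
  refine ⟨fun y => (hasDerivAt_max_sq y).differentiableAt, ?_⟩
  have : deriv (fun y : ℝ => max y 0 ^ 2) = fun y => 2 * max y 0 :=
    funext fun y => (hasDerivAt_max_sq y).deriv
  rw [this]
  fun_prop

/-! ### Propagation of compact support -/

/-- A cut-off function whose support shrinks faster than particles can move. -/
def coneCutoff (τ K c : ℝ) (z₀ : E3 × E3) (s : ℝ) (z : E3 × E3) : ℝ :=
  max ((1 + K * (τ - s)) ^ 2 - ‖z.2 - z₀.2‖ ^ 2) 0 ^ 2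
    * max ((1 + c * (τ - s)) ^ 2 - ‖z.1 - z₀.1‖ ^ 2) 0 ^ 2

theorem contDiff_coneCutoff (τ K c : ℝ) (z₀ : E3 × E3) :
    ContDiff ℝ 1 (fun p : ℝ × (E3 × E3) => coneCutoff τ K c z₀ p.1 p.2) := by
  unfold coneCutoff
  refine (contDiff_max_sq.comp (ContDiff.sub (by fun_prop) (ContDiff.norm_sq ℝ ?_))).mul
    (contDiff_max_sq.comp (ContDiff.sub (by fun_prop) (ContDiff.norm_sq ℝ ?_))) <;> fun_prop

/-- Along characteristics v moves with speed at most K, and on the support of the velocity factor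
‖v‖ ≤ ‖v₀‖ + 1 + Kτ ≤ c, so x moves with speed at most c. The two radii shrink at exactly these
rates, hence neither factor can increase. -/
theorem matDeriv_coneCutoff_nonpos {τ K c : ℝ} {z₀ : E3 × E3} {s : ℝ} (hs : s ∈ Ioo 0 τ)
    (hK : ∀ x, ‖F x‖ ≤ K) (hc : ‖z₀.2‖ + 1 + K * τ ≤ c) (z : E3 × E3) :
    matDeriv F (coneCutoff τ K c z₀) s z ≤ 0 := by
  have hK0 : 0 ≤ K := (norm_nonneg _).trans (hK 0)
  have hsl : SlabC1 τ (coneCutoff τ K c z₀) := (contDiff_coneCutoff τ K c z₀).contDiffOn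
  rw [hsl.matDeriv_eq hs]
  -- The derivative in the space-time direction (1, v, −F) is computed on a straight line through
  -- (s, z), where the cut-off is a product of functions of one variable.
  have hl : HasDerivAt (fun h : ℝ => ((s + h, z + h • (z.2, -F z.1)) : ℝ × (E3 × E3)))
      (1, (z.2, -F z.1)) 0 := by
    refine HasDerivAt.prodMk ?_ ?_
    · simpa using (hasDerivAt_id (0:ℝ)).const_add s
    · simpa using ((hasDerivAt_id (0:ℝ)).smul_const (z.2, -F z.1)).const_add z
  have h1 := (hsl.hasFDerivAt hs z).comp_hasDerivAt_of_eq 0 hl (by simp)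
  have ha : HasDerivAt (fun h : ℝ => (1 + K * (τ - (s + h))) ^ 2 - ‖z.2 + h • (-F z.1) - z₀.2‖ ^ 2)
      (-2 * K * (1 + K * (τ - s)) + 2 * inner ℝ (z.2 - z₀.2) (F z.1)) 0 := by
    have e1 : HasDerivAt (fun h : ℝ => 1 + K * (τ - (s + h))) (-K) 0 := by
      simpa using ((((hasDerivAt_id (0:ℝ)).const_add s).const_sub τ).const_mul K).const_add 1
    have e2 : HasDerivAt (fun h : ℝ => z.2 + h • (-F z.1) - z₀.2) (-F z.1) 0 := by
      simpa using (((hasDerivAt_id (0:ℝ)).smul_const (-F z.1)).const_add z.2).sub_const z₀.2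
    refine ((e1.pow 2).sub e2.norm_sq).congr_deriv ?_
    simp [inner_neg_right]
    ring
  have hb : HasDerivAt (fun h : ℝ => (1 + c * (τ - (s + h))) ^ 2 - ‖z.1 + h • z.2 - z₀.1‖ ^ 2)
      (-2 * c * (1 + c * (τ - s)) - 2 * inner ℝ (z.1 - z₀.1) z.2) 0 := by
    have e1 : HasDerivAt (fun h : ℝ => 1 + c * (τ - (s + h))) (-c) 0 := by
      simpa using ((((hasDerivAt_id (0:ℝ)).const_add s).const_sub τ).const_mul c).const_add 1
    have e2 : HasDerivAt (fun h : ℝ => z.1 + h • z.2 - z₀.1) z.2 0 := by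
      simpa using (((hasDerivAt_id (0:ℝ)).smul_const z.2).const_add z.1).sub_const z₀.1
    refine ((e1.pow 2).sub e2.norm_sq).congr_deriv ?_
    simp
    ring
  have h2 := ((hasDerivAt_max_sq _).comp 0 ha).mul ((hasDerivAt_max_sq _).comp 0 hb)
  rw [h1.unique h2]
  simp only [Function.comp_apply, add_zero, zero_smul]
  have hKs : 0 ≤ K * (τ - s) := mul_nonneg hK0 (by linarith [hs.2])
  have hKτ : K * (τ - s) ≤ K * τ := by nlinarith [hs.1]
  have hc0 : 0 ≤ c := by linarith [norm_nonneg z₀.2, hs.2, mul_nonneg hK0 (hs.1.trans hs.2).le]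
  have hcs : 0 ≤ c * (τ - s) := mul_nonneg hc0 (by linarith [hs.2])
  set A := (1 + K * (τ - s)) ^ 2 - ‖z.2 - z₀.2‖ ^ 2 with hA
  set B := (1 + c * (τ - s)) ^ 2 - ‖z.1 - z₀.1‖ ^ 2 with hB
  rcases le_or_gt A 0 with hA0 | hA0
  · simp [max_eq_right hA0]
  rcases le_or_gt B 0 with hB0 | hB0
  · simp [max_eq_right hB0]
  rw [max_eq_left hA0.le, max_eq_left hB0.le]
  have hA1 : ‖z.2 - z₀.2‖ ≤ 1 + K * (τ - s) := abs_le_of_sq_le_sq' (by linarith) (by linarith) |>.2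
  have hB1 : ‖z.1 - z₀.1‖ ≤ 1 + c * (τ - s) := abs_le_of_sq_le_sq' (by linarith) (by linarith) |>.2
  have hv : ‖z.2‖ ≤ c := by
    have := norm_le_norm_add_norm_sub' z.2 z₀.2
    linarith
  have i1 : inner ℝ (z.2 - z₀.2) (F z.1) ≤ (1 + K * (τ - s)) * K :=
    (real_inner_le_norm _ _).trans (mul_le_mul hA1 (hK _) (norm_nonneg _) (by linarith))
  have i2 : -inner ℝ (z.1 - z₀.1) z.2 ≤ (1 + c * (τ - s)) * c := by
    have := abs_real_inner_le_norm (z.1 - z₀.1) z.2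
    exact (neg_le_abs _).trans (this.trans (mul_le_mul hB1 hv (norm_nonneg _) (by linarith)))
  have j1 : 2 * A * (-2 * K * (1 + K * (τ - s)) + 2 * inner ℝ (z.2 - z₀.2) (F z.1)) ≤ 0 :=
    mul_nonpos_of_nonneg_of_nonpos (by positivity) (by linarith)
  have j2 : 2 * B * (-2 * c * (1 + c * (τ - s)) - 2 * inner ℝ (z.1 - z₀.1) z.2) ≤ 0 :=
    mul_nonpos_of_nonneg_of_nonpos (by positivity) (by linarith)
  exact add_nonpos (mul_nonpos_of_nonpos_of_nonneg j1 (sq_nonneg _))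
    (mul_nonpos_of_nonneg_of_nonpos (sq_nonneg _) j2)

variable {f : ℝ → E3 × E3 → ℝ} {Φ : ℝ → E3 → E3}

/-- The integral of f² times the cut-off centred at z₀ is nonincreasing in time. It starts at zero,
because at time 0 the cut-off lives outside the ball of radius P. At time τ the cut-off equals 1 at
z₀, so continuity forces f(τ, z₀) = 0. -/
theorem Transported.eq_zero_of_lt (h : Transported τ f Φ) {K P : ℝ}
    (hK : ∀ s ∈ Icc 0 τ, ∀ x, ‖Φ s x‖ ≤ K) (hP : ∀ z, P < ‖z‖ → f 0 z = 0) {z₀ : E3 × E3}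
    (hz : P + 1 + K * τ < ‖z₀.2‖ ∨ P + 1 + (‖z₀.2‖ + 1 + K * τ) * τ < ‖z₀.1‖) :
    f τ z₀ = 0 := by
  have hτ := h.pos
  have hK0 : 0 ≤ K := (norm_nonneg _).trans (hK 0 (left_mem_Icc.2 hτ.le) 0)
  set c := ‖z₀.2‖ + 1 + K * τ with hc
  have hc0 : 0 ≤ c := by positivity
  have hsl : SlabC1 τ (coneCutoff τ K c z₀) := (contDiff_coneCutoff τ K c z₀).contDiffOn
  have hff : SlabC1 τ (fun s z => f s z ^ 2) := h.slab.comp_left (b := fun y => y ^ 2) (by fun_prop)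
  have hG := hff.mul hsl
  -- the support of the cut-off function
  have hvan : ∀ s ∈ Icc 0 τ, ∀ z, 1 + K * τ < ‖z.2 - z₀.2‖ ∨ 1 + c * τ < ‖z.1 - z₀.1‖ →
      coneCutoff τ K c z₀ s z = 0 := by
    intro s hs z hz
    have aux : ∀ k a : ℝ, 0 ≤ k → 1 + k * τ < a → max ((1 + k * (τ - s)) ^ 2 - a ^ 2) 0 = 0 := by
      intro k a hk ha
      refine max_eq_right (sub_nonpos.2 ?_)
      have : 0 ≤ k * (τ - s) := mul_nonneg hk (by linarith [hs.2])
      exact pow_le_pow_left₀ (by linarith) (by nlinarith [hs.1]) 2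
    rcases hz with hz | hz
    · rw [coneCutoff, aux K _ hK0 hz]; simp
    · rw [coneCutoff, aux c _ hc0 hz]; simp
  have hR : ∀ s ∈ Icc 0 τ, ∀ z, ‖z₀‖ + (1 + K * τ) + (1 + c * τ) < ‖z‖ →
      f s z ^ 2 * coneCutoff τ K c z₀ s z = 0 := by
    intro s hs z hz
    have h0 : 0 ≤ K * τ := by positivity
    have h0' : 0 ≤ c * τ := by positivity
    rw [hvan s hs z, mul_zero]
    by_contra! hn
    have a1 := norm_le_norm_add_norm_sub' z.1 z₀.1
    have a2 := norm_le_norm_add_norm_sub' z.2 z₀.2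
    have b1 := norm_fst_le z₀
    have b2 := norm_snd_le z₀
    rw [Prod.norm_def (x := z)] at hz
    rcases lt_max_iff.1 hz with h | h <;> linarith
  have hy := nonpos_of_deriv_le_mul (C := 0) hτ.le
    (hG.continuousOn_integral (μ := (volume : Measure (E3 × E3))) hR)
    (fun s hs => (hG.hasDerivAt_integral_matDeriv hR hs
      (h.continuous s (Ioo_subset_Icc_self hs))).2)
    (fun s hs => by
      rw [zero_mul]
      refine integral_nonpos fun z => ?_
      rw [hff.matDeriv_mul hsl hs, h.slab.matDeriv_comp (b := fun y => y ^ 2) (by fun_prop) hs,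
        h.eq_zero s hs, mul_zero, zero_mul, zero_add]
      exact mul_nonpos_of_nonneg_of_nonpos (sq_nonneg _)
        (matDeriv_coneCutoff_nonpos hs (hK s (Ioo_subset_Icc_self hs)) le_rfl z))
    (by
      refine integral_nonpos fun z => le_of_eq ?_
      show f 0 z ^ 2 * coneCutoff τ K c z₀ 0 z = 0
      by_cases hz' : P < ‖z‖
      · rw [hP z hz']; ring
      · push Not at hz'
        rw [hvan 0 (left_mem_Icc.2 hτ.le) z, mul_zero]
        have a1 := norm_sub_norm_le z₀.1 z.1
        have a2 := norm_sub_norm_le z₀.2 z.2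
        have b1 := norm_fst_le z
        have b2 := norm_snd_le z
        rw [norm_sub_rev z.1, norm_sub_rev z.2]
        rcases hz with hz | hz
        · left; linarith
        · right; linarith)
  have hcont : Continuous fun z => f τ z ^ 2 * coneCutoff τ K c z₀ τ z :=
    (hG.contDiff (right_mem_Icc.2 hτ.le)).continuous
  have hnn : ∀ z, 0 ≤ f τ z ^ 2 * coneCutoff τ K c z₀ τ z := fun z => by
    unfold coneCutoff; positivity
  have hint : Integrable fun z => f τ z ^ 2 * coneCutoff τ K c z₀ τ z :=
    hcont.integrable_of_hasCompactSupport (HasCompactSupport.intro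
      (isCompact_closedBall (0 : E3 × E3) _) fun z hz => hR τ (right_mem_Icc.2 hτ.le) z
        (by simpa using hz))
  have h0 := (integral_eq_zero_iff_of_nonneg hnn hint).1 (le_antisymm hy (integral_nonneg hnn))
  have h1 := (hcont.ae_eq_iff_eq volume continuous_const).1 h0
  have h2 : f τ z₀ ^ 2 * coneCutoff τ K c z₀ τ z₀ = 0 := congrFun h1 z₀
  simpa [coneCutoff] using h2

/-- Velocities are bounded first, by V = P + 1 + Kτ; for ‖v₀‖ ≤ V the cone speed is at most V + 1 +
Kτ, which bounds the positions. Shorter times are covered by restricting the solution to [0, s]. -/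
theorem Transported.exists_support (h : Transported τ f Φ) {K : ℝ}
    (hK : ∀ s ∈ Icc 0 τ, ∀ x, ‖Φ s x‖ ≤ K) (hc : HasCompactSupport (f 0)) :
    ∃ R : ℝ, 0 < R ∧ ∀ s ∈ Icc 0 τ, ∀ z, R < ‖z‖ → f s z = 0 := by
  have hτ := h.pos
  have hK0 : 0 ≤ K := (norm_nonneg _).trans (hK 0 (left_mem_Icc.2 hτ.le) 0)
  obtain ⟨P, hP0, hP⟩ := hc.isCompact.isBounded.exists_pos_norm_le
  have hP' : ∀ z, P < ‖z‖ → f 0 z = 0 := fun z hz =>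
    image_eq_zero_of_notMem_tsupport fun hm => absurd (hP z hm) (not_le.2 hz)
  set V := P + 1 + K * τ with hV
  have hV0 : 0 < V := by positivity
  refine ⟨max V (P + 1 + (V + 1 + K * τ) * τ), lt_max_of_lt_left hV0, fun s hs z hz => ?_⟩
  rcases hs.1.eq_or_lt with rfl | hs0
  · exact hP' z (lt_of_le_of_lt (by nlinarith [mul_nonneg hK0 hτ.le])
      (lt_of_le_of_lt (le_max_left _ _) hz))
  · refine (h.mono hs0 hs.2).eq_zero_of_lt (fun r hr => hK r ⟨hr.1, hr.2.trans hs.2⟩) hP' ?_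
    have hKs : K * s ≤ K * τ := mul_le_mul_of_nonneg_left hs.2 hK0
    by_cases hv : V < ‖z.2‖
    · left; linarith
    · right
      push Not at hv
      have h1 : P + 1 + (V + 1 + K * τ) * τ < ‖z.1‖ := by
        rw [Prod.norm_def] at hz
        rcases lt_max_iff.1 hz with h | h
        · exact (le_max_right _ _).trans_lt h
        · exact absurd ((le_max_left _ _).trans_lt h) (not_lt.2 hv)
      have h2 : (‖z.2‖ + 1 + K * s) * s ≤ (V + 1 + K * τ) * τ :=
        mul_le_mul (by linarith) hs.2 hs.1 (by positivity)
      linarith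

/-! ### Interior gradient estimate for Newtonian potentials -/

theorem integrable_of_eq_zero_of_lt {E : Type*} [NormedAddCommGroup E] [ProperSpace E]
    [MeasurableSpace E] [OpensMeasurableSpace E] {μ : Measure E} [IsFiniteMeasureOnCompacts μ]
    {g : E → ℝ} (hg : Continuous g) {R : ℝ} (h : ∀ y, R < ‖y‖ → g y = 0) : Integrable g μ :=
  hg.integrable_of_hasCompactSupport (HasCompactSupport.intro
    (isCompact_closedBall (0 : E) R) fun z hz => h z (by simpa using hz))

/-- Cauchy–Schwarz inequality from the discriminant of the nonnegative quadratic t ↦ ∫(f + tg)². -/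
theorem sq_integral_mul_le {α : Type*} [MeasurableSpace α] {μ : Measure α} {f g : α → ℝ}
    (hf : Integrable (fun x => f x ^ 2) μ) (hg : Integrable (fun x => g x ^ 2) μ)
    (hfg : Integrable (fun x => f x * g x) μ) :
    (∫ x, f x * g x ∂μ) ^ 2 ≤ (∫ x, f x ^ 2 ∂μ) * ∫ x, g x ^ 2 ∂μ := by
  have h : ∀ t : ℝ, 0 ≤ (∫ x, g x ^ 2 ∂μ) * (t * t) + (2 * ∫ x, f x * g x ∂μ) * t
      + ∫ x, f x ^ 2 ∂μ := fun t => by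
    have h1 : Integrable (fun x => t * t * g x ^ 2 + 2 * t * (f x * g x)) μ :=
      (hg.const_mul _).add (hfg.const_mul _)
    have h2 : ∫ x, (f x + t * g x) ^ 2 ∂μ = (∫ x, g x ^ 2 ∂μ) * (t * t)
        + (2 * ∫ x, f x * g x ∂μ) * t + ∫ x, f x ^ 2 ∂μ := by
      have : ∀ x, (f x + t * g x) ^ 2 = (t * t * g x ^ 2 + 2 * t * (f x * g x)) + f x ^ 2 :=
        fun x => by ring
      simp only [this]
      rw [integral_add h1 hf, integral_add (hg.const_mul _) (hfg.const_mul _),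
        integral_const_mul, integral_const_mul]
      ring
    rw [← h2]
    exact integral_nonneg fun x => sq_nonneg _
  have hd := discrim_le_zero h
  unfold discrim at hd
  linarith

theorem integrableOn_ball_inv_norm_sq (r : ℝ) :
    IntegrableOn (fun y : E3 => (‖y‖ ^ 2)⁻¹) (Metric.ball 0 r) := by
  refine (integrableOn_fun_norm_addHaar (volume : Measure E3) (f := fun s : ℝ => (s ^ 2)⁻¹)).2 ?_
  have h : IntegrableOn (fun _ : ℝ => (1 : ℝ)) (Ioo 0 r) := integrableOn_const measure_Ioo_lt_top.ne
  refine h.congr_fun (fun s hs => ?_) measurableSet_Ioo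
  have hs0 : (0:ℝ) < s := hs.1
  simp only [finrank_euclideanSpace, Fintype.card_fin, smul_eq_mul]
  field_simp

/-- In three dimensions 1/|y| is locally square integrable. For ‖y‖ ≤ R and ‖x‖ ≤ r the kernel may
be cut off at radius R + r + 1 without effect, and Cauchy–Schwarz applies with a constant
independent of x and ρ. -/
theorem sq_integral_div_norm_sub_le (R r : ℝ) : ∃ κ : ℝ, 0 ≤ κ ∧ ∀ ρ : E3 → ℝ, Continuous ρ →
    (∀ y, R < ‖y‖ → ρ y = 0) → ∀ x, ‖x‖ ≤ r →
    (∫ y, ρ y / ‖x - y‖) ^ 2 ≤ κ * ∫ y, ρ y ^ 2 := by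
  obtain ⟨k, hk⟩ : ∃ k : E3 → ℝ,
    k = (Metric.ball (0 : E3) (R + r + 1)).indicator fun y => ‖y‖⁻¹ := ⟨_, rfl⟩
  have hk2 : Integrable (fun y => k y ^ 2) := by
    have : (fun y => k y ^ 2)
        = (Metric.ball (0 : E3) (R + r + 1)).indicator fun y => (‖y‖ ^ 2)⁻¹ := by
      ext y
      by_cases hy : y ∈ Metric.ball (0 : E3) (R + r + 1)
      · rw [hk, indicator_of_mem hy, indicator_of_mem hy, inv_pow]
      · rw [hk, indicator_of_notMem hy, indicator_of_notMem hy]; norm_num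
    rw [this]
    exact (integrable_indicator_iff Metric.isOpen_ball.measurableSet).2
      (integrableOn_ball_inv_norm_sq _)
  refine ⟨∫ y, k y ^ 2, integral_nonneg fun y => sq_nonneg _, fun ρ hρ hR x hx => ?_⟩
  have hρ2 : Integrable (fun y => ρ y ^ 2) := integrable_of_eq_zero_of_lt (R := R) (by fun_prop)
    fun y hy => by rw [hR y hy]; norm_num
  have e : ∀ y, ρ y / ‖x - y‖ = ρ y * k (x - y) := fun y => by
    by_cases hy : R < ‖y‖
    · simp [hR y hy]
    · have : x - y ∈ Metric.ball (0 : E3) (R + r + 1) := by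
        rw [mem_ball_zero_iff]
        have := norm_sub_le x y
        linarith
      rw [hk, indicator_of_mem this, div_eq_mul_inv]
  simp only [e]
  have hk2' : Integrable (fun y => k (x - y) ^ 2) := hk2.comp_sub_left x
  have hkm : AEStronglyMeasurable (fun y => k (x - y)) := by
    have : Measurable k := hk ▸ (measurable_norm.inv).indicator Metric.isOpen_ball.measurableSet
    exact (this.comp (measurable_const.sub measurable_id)).aestronglyMeasurable
  have hi : Integrable (fun y => ρ y * k (x - y)) := by
    refine (hρ2.add hk2').mono (hρ.aestronglyMeasurable.mul hkm) (Eventually.of_forall fun y => ?_)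
    simp only [Pi.add_apply, Real.norm_eq_abs, abs_mul]
    rw [abs_of_nonneg (by positivity : 0 ≤ ρ y ^ 2 + k (x - y) ^ 2)]
    nlinarith [sq_nonneg (|ρ y| - |k (x - y)|), sq_abs (ρ y), sq_abs (k (x - y))]
  refine (sq_integral_mul_le hρ2 hk2' hi).trans (le_of_eq ?_)
  rw [integral_sub_left_eq_self (fun y => k y ^ 2) volume x, mul_comm]

/-- Interior estimate for the gradient, in one direction. -/
theorem integral_mul_fderiv_sq {χ W : E3 → ℝ} (hχ : ContDiff ℝ 2 χ) (hc : HasCompactSupport χ)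
    (hW : ContDiff ℝ 2 W) (e : E3) :
    ∫ x, χ x * fderiv ℝ W x e ^ 2
      = ∫ x, (1 / 2 * fderiv ℝ (fderiv ℝ χ) x e e * W x ^ 2
        - χ x * W x * fderiv ℝ (fderiv ℝ W) x e e) := by
  have hχ1 : ContDiff ℝ 1 χ := hχ.of_le (by norm_num)
  have hW1 : ContDiff ℝ 1 W := hW.of_le (by norm_num)
  have hdχ : ContDiff ℝ 1 (fderiv ℝ χ) := hχ.fderiv_right (by norm_num)
  have hdW : ContDiff ℝ 1 (fderiv ℝ W) := hW.fderiv_right (by norm_num)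
  have hdχe : ContDiff ℝ 1 (fun x => fderiv ℝ χ x e) := hdχ.clm_apply contDiff_const
  have hdWe : ContDiff ℝ 1 (fun x => fderiv ℝ W x e) := hdW.clm_apply contDiff_const
  have hce : HasCompactSupport (fun x => fderiv ℝ χ x e) := hc.fderiv_apply ℝ e
  have d1 : ∀ x, fderiv ℝ (fun x => χ x * (W x * fderiv ℝ W x e)) x e
      = χ x * fderiv ℝ W x e ^ 2 + (χ x * W x * fderiv ℝ (fderiv ℝ W) x e e
        + fderiv ℝ χ x e * (W x * fderiv ℝ W x e)) := fun x => by
    have h1 := (hχ1.differentiable one_ne_zero x).hasFDerivAt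
    have h2 := (hW1.differentiable one_ne_zero x).hasFDerivAt
    have h3 := ((hdW.differentiable one_ne_zero x).hasFDerivAt).clm_apply (hasFDerivAt_const e x)
    have h4 : fderiv ℝ (fun x => χ x * (W x * fderiv ℝ W x e)) x = _ := (h1.mul (h2.mul h3)).fderiv
    rw [h4]
    simp
    ring
  have d2 : ∀ x, fderiv ℝ (fun x => fderiv ℝ χ x e * (W x * W x)) x e
      = fderiv ℝ (fderiv ℝ χ) x e e * W x ^ 2
        + 2 * (fderiv ℝ χ x e * (W x * fderiv ℝ W x e)) := fun x => by
    have h2 := (hW1.differentiable one_ne_zero x).hasFDerivAt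
    have h3 := ((hdχ.differentiable one_ne_zero x).hasFDerivAt).clm_apply (hasFDerivAt_const e x)
    have h4 : fderiv ℝ (fun x => fderiv ℝ χ x e * (W x * W x)) x = _ := (h3.mul (h2.mul h2)).fderiv
    rw [h4]
    simp
    ring
  -- The derivatives of χ W ∂W and of ∂χ W² both integrate to zero; eliminating the common term ∂χ W
  -- ∂W gives the identity.
  have z1 := integral_fderiv_eq_zero (μ := volume) (hχ1.mul (hW1.mul hdWe)) hc.mul_right e
  have z2 := integral_fderiv_eq_zero (μ := volume) (hdχe.mul (hW1.mul hW1)) hce.mul_right e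
  simp only [d1] at z1
  simp only [d2] at z2
  have cW := hW.continuous
  have cχ := hχ.continuous
  have cWe := hdWe.continuous
  have cχe := hdχe.continuous
  have cWee : Continuous fun x => fderiv ℝ (fderiv ℝ W) x e e :=
    ((hdW.continuous_fderiv one_ne_zero).clm_apply continuous_const).clm_apply continuous_const
  have cχee : Continuous fun x => fderiv ℝ (fderiv ℝ χ) x e e :=
    ((hdχ.continuous_fderiv one_ne_zero).clm_apply continuous_const).clm_apply continuous_const
  have hcee : HasCompactSupport fun x => fderiv ℝ (fderiv ℝ χ) x e e :=
    ((hc.fderiv ℝ).fderiv_apply ℝ e).comp_left (g := fun l : E3 →L[ℝ] ℝ => l e) rfl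
  have i1 : Integrable fun x => χ x * fderiv ℝ W x e ^ 2 :=
    (cχ.mul (cWe.pow 2)).integrable_of_hasCompactSupport hc.mul_right
  have i2 : Integrable fun x => χ x * W x * fderiv ℝ (fderiv ℝ W) x e e :=
    ((cχ.mul cW).mul cWee).integrable_of_hasCompactSupport (hc.mul_right.mul_right)
  have i3 : Integrable fun x => fderiv ℝ χ x e * (W x * fderiv ℝ W x e) :=
    (cχe.mul (cW.mul cWe)).integrable_of_hasCompactSupport hce.mul_right
  have i4 : Integrable fun x => fderiv ℝ (fderiv ℝ χ) x e e * W x ^ 2 :=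
    (cχee.mul (cW.pow 2)).integrable_of_hasCompactSupport hcee.mul_right
  have i5 : Integrable fun x => χ x * W x * fderiv ℝ (fderiv ℝ W) x e e
      + fderiv ℝ χ x e * (W x * fderiv ℝ W x e) := i2.add i3
  rw [integral_add i1 i5, integral_add i2 i3] at z1
  rw [integral_add i4 (i3.const_mul 2), integral_const_mul] at z2
  have i6 : Integrable fun x => 1 / 2 * fderiv ℝ (fderiv ℝ χ) x e e * W x ^ 2 := by
    simpa only [mul_assoc] using i4.const_mul (1 / 2)
  rw [integral_sub i6 i2]
  simp only [mul_assoc (1 / 2 : ℝ)]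
  rw [integral_const_mul]
  linarith

theorem laplacian_eq_sum (W : E3 → ℝ) {ι : Type*} [Fintype ι] (b : OrthonormalBasis ι ℝ E3)
    (x : E3) : Laplacian.laplacian W x = ∑ i, fderiv ℝ (fderiv ℝ W) x (b i) (b i) := by
  rw [InnerProductSpace.laplacian_eq_iteratedFDeriv_orthonormalBasis W b]
  simp [iteratedFDeriv_two_apply]

/-- The Laplacian is a trace, computable in any orthonormal basis: the standard one on the left and
its image under A on the right. -/
theorem laplacian_comp_isometry {W : E3 → ℝ} (hW : ContDiff ℝ 2 W) (A : E3 ≃ₗᵢ[ℝ] E3) (x : E3) :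
    Laplacian.laplacian (fun y => W (A y)) x = Laplacian.laplacian W (A x) := by
  set b := EuclideanSpace.basisFun (Fin 3) ℝ
  rw [laplacian_eq_sum _ b, laplacian_eq_sum _ (b.map A)]
  have h1 : ∀ y, fderiv ℝ (fun y => W (A y)) y = (fderiv ℝ W (A y)).comp
      (A : E3 →L[ℝ] E3) := fun y =>
    (((hW.differentiable two_ne_zero) (A y)).hasFDerivAt.comp y
      (A : E3 →L[ℝ] E3).hasFDerivAt).fderiv
  have hdW : ContDiff ℝ 1 (fderiv ℝ W) := hW.fderiv_right (by norm_num)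
  refine Finset.sum_congr rfl fun i _ => ?_
  have h2 : fderiv ℝ (fderiv ℝ (fun y => W (A y))) x (b i) (b i)
      = fderiv ℝ (fun y => fderiv ℝ W (A y) (A (b i))) x (b i) := by
    have h3 : DifferentiableAt ℝ (fderiv ℝ (fun y => W (A y))) x := by
      have : ContDiff ℝ 1 (fderiv ℝ (fun y => W (A y))) :=
        (hW.comp A.contDiff).fderiv_right (by norm_num)
      exact this.differentiable one_ne_zero x
    have h4 := (h3.hasFDerivAt.clm_apply (hasFDerivAt_const (b i) x)).fderiv
    have h5 : (fun y => fderiv ℝ (fun y => W (A y)) y (b i))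
        = fun y => fderiv ℝ W (A y) (A (b i)) := funext fun y => by rw [h1 y]; rfl
    rw [← h5, h4]
    simp
  rw [h2]
  have h6 := (((hdW.differentiable one_ne_zero (A x)).hasFDerivAt.comp x
    (A : E3 →L[ℝ] E3).hasFDerivAt).clm_apply (hasFDerivAt_const (A (b i)) x)).fderiv
  have h7 : fderiv ℝ (fun y => fderiv ℝ W (A y) (A (b i))) x = _ := h6
  rw [h7]
  simp

/-- Interior gradient estimate for Newtonian potentials. -/
theorem exists_integral_gradient_sq_le {R : ℝ} (hR : 0 < R) : ∃ C : ℝ, 0 ≤ C ∧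
    ∀ ρ W : E3 → ℝ, Continuous ρ → (∀ y, R < ‖y‖ → ρ y = 0) → ContDiff ℝ 2 W →
    (∀ x, W x = -∫ y, ρ y / ‖x - y‖) →
    (∀ x, Laplacian.laplacian W x = 4 * Real.pi * ρ x) →
    ∫ x in Metric.closedBall 0 R, ‖gradient W x‖ ^ 2 ≤ C * ∫ y, ρ y ^ 2 := by
  let B : ContDiffBump (0 : E3) := ⟨R, R + 1, hR, by linarith⟩
  set χ : E3 → ℝ := fun x => B x with hχdef
  have hχ : ContDiff ℝ 2 χ := B.contDiff
  have hc : HasCompactSupport χ := B.hasCompactSupport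
  set b := EuclideanSpace.basisFun (Fin 3) ℝ
  have hdχ : ContDiff ℝ 1 (fderiv ℝ χ) := hχ.fderiv_right (by norm_num)
  have cχee : ∀ e, Continuous fun x => fderiv ℝ (fderiv ℝ χ) x e e := fun e =>
    ((hdχ.continuous_fderiv one_ne_zero).clm_apply continuous_const).clm_apply continuous_const
  have hcee : ∀ e, HasCompactSupport fun x => fderiv ℝ (fderiv ℝ χ) x e e := fun e =>
    ((hc.fderiv ℝ).fderiv_apply ℝ e).comp_left (g := fun l : E3 →L[ℝ] ℝ => l e) rfl
  obtain ⟨κ, hκ0, hκ⟩ := sq_integral_div_norm_sub_le R (R + 1)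
  set D : E3 → ℝ := fun x => |∑ i, 1 / 2 * fderiv ℝ (fderiv ℝ χ) x (b i) (b i)| with hD
  have hsub : ∀ x, R + 1 < ‖x‖ → χ x = 0 := fun x hx => B.zero_of_le_dist (by
    rw [dist_zero_right]; exact hx.le)
  have hχnn : ∀ x, 0 ≤ χ x := fun x => B.nonneg
  have hχ1 : ∀ x, χ x ≤ 1 := fun x => B.le_one
  have hDc : Continuous D := by
    refine (continuous_finsetSum _ fun i _ => ?_).abs
    exact continuous_const.mul (cχee (b i))
  have hχ0 : ∀ x, R + 1 < ‖x‖ → D x = 0 := fun x hx => by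
    have : ∀ e, fderiv ℝ (fderiv ℝ χ) x e e = 0 := fun e => by
      have hn : x ∉ tsupport χ := by
        rw [B.tsupport_eq]; simpa using hx
      have hn2 : x ∉ tsupport (fderiv ℝ (fderiv ℝ χ)) := fun h =>
        hn (tsupport_fderiv_subset ℝ (tsupport_fderiv_subset ℝ h))
      rw [image_eq_zero_of_notMem_tsupport hn2]; rfl
    simp [hD, this]
  have hDs : HasCompactSupport D := HasCompactSupport.intro
    (isCompact_closedBall (0 : E3) (R + 1)) fun z hz => hχ0 z (by simpa using hz)
  have iD : Integrable D := hDc.integrable_of_hasCompactSupport hDs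
  have iχ : Integrable χ := hχ.continuous.integrable_of_hasCompactSupport hc
  set N0 := ∫ x, (D x + 2 * Real.pi * χ x) with hN0
  have iN : Integrable fun x => D x + 2 * Real.pi * χ x := iD.add (iχ.const_mul _)
  have hN00 : 0 ≤ N0 := integral_nonneg fun x =>
    add_nonneg (abs_nonneg _) (mul_nonneg (by positivity) (hχnn x))
  refine ⟨N0 * κ + 2 * Real.pi, by positivity, fun ρ W hρ hρR hW hWρ hΔ => ?_⟩
  set N := ∫ y, ρ y ^ 2 with hN
  have hW1 : ContDiff ℝ 1 W := hW.of_le (by norm_num)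
  have hdW : ContDiff ℝ 1 (fderiv ℝ W) := hW.fderiv_right (by norm_num)
  have cWe : ∀ e, Continuous fun x => fderiv ℝ W x e := fun e =>
    (hdW.clm_apply contDiff_const).continuous
  have cWee : ∀ e, Continuous fun x => fderiv ℝ (fderiv ℝ W) x e e := fun e =>
    ((hdW.continuous_fderiv one_ne_zero).clm_apply continuous_const).clm_apply continuous_const
  have hgrad : ∀ x, ‖gradient W x‖ ^ 2 = ∑ i, fderiv ℝ W x (b i) ^ 2 := fun x => by
    rw [← b.sum_sq_norm_inner_right]
    refine Finset.sum_congr rfl fun i _ => ?_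
    rw [inner_gradient_right]
    simp
  have iχW : ∀ i, Integrable fun x => χ x * fderiv ℝ W x (b i) ^ 2 := fun i =>
    (hχ.continuous.mul ((cWe _).pow 2)).integrable_of_hasCompactSupport hc.mul_right
  have s1 : ∫ x in Metric.closedBall 0 R, ‖gradient W x‖ ^ 2
      ≤ ∫ x, χ x * ‖gradient W x‖ ^ 2 := by
    have i1 : Integrable fun x => χ x * ‖gradient W x‖ ^ 2 := by
      simp only [hgrad, Finset.mul_sum]
      exact integrable_finsetSum _ fun i _ => iχW i
    calc ∫ x in Metric.closedBall 0 R, ‖gradient W x‖ ^ 2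
        = ∫ x in Metric.closedBall 0 R, χ x * ‖gradient W x‖ ^ 2 := by
          refine setIntegral_congr_fun Metric.isClosed_closedBall.measurableSet fun x hx => ?_
          have : χ x = 1 := B.one_of_mem_closedBall hx
          simp [this]
      _ ≤ _ := setIntegral_le_integral i1 (Eventually.of_forall fun x =>
          mul_nonneg (hχnn x) (sq_nonneg _))
  have iR : ∀ i, Integrable fun x => 1 / 2 * fderiv ℝ (fderiv ℝ χ) x (b i) (b i) * W x ^ 2
        - χ x * W x * fderiv ℝ (fderiv ℝ W) x (b i) (b i) := fun i => by
    refine Integrable.sub ?_ ?_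
    · exact ((continuous_const.mul (cχee _)).mul (hW.continuous.pow 2)).integrable_of_hasCompactSupport
        ((hcee _).mul_left.mul_right)
    · exact ((hχ.continuous.mul hW.continuous).mul (cWee _)).integrable_of_hasCompactSupport
        (hc.mul_right.mul_right)
  -- Summing the directional identities over an orthonormal basis produces the Laplacian of W, which
  -- Poisson's equation replaces by 4πρ. No derivative of W remains.
  have s2 : ∫ x, χ x * ‖gradient W x‖ ^ 2
      = ∫ x, ((∑ i, 1 / 2 * fderiv ℝ (fderiv ℝ χ) x (b i) (b i)) * W x ^ 2
        - 4 * Real.pi * (χ x * (W x * ρ x))) := by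
    simp only [hgrad, Finset.mul_sum]
    rw [integral_finsetSum _ fun i _ => iχW i]
    simp only [integral_mul_fderiv_sq hχ hc hW]
    rw [← integral_finsetSum _ fun i _ => iR i]
    refine integral_congr_ae (Eventually.of_forall fun x => ?_)
    simp only
    rw [Finset.sum_sub_distrib, ← Finset.mul_sum, ← laplacian_eq_sum W b, hΔ, Finset.sum_mul]
    ring
  have iρ : Integrable fun x => ρ x ^ 2 := integrable_of_eq_zero_of_lt (R := R) (by fun_prop)
    fun y hy => by rw [hρR y hy]; norm_num
  have hNnn : 0 ≤ N := integral_nonneg fun x => sq_nonneg _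
  -- On the support of χ the potential satisfies W² ≤ κN, and the product Wρ is split by 2|Wρ| ≤ W²
  -- + ρ².
  have hpt : ∀ x, (∑ i, 1 / 2 * fderiv ℝ (fderiv ℝ χ) x (b i) (b i)) * W x ^ 2
        - 4 * Real.pi * (χ x * (W x * ρ x))
      ≤ (D x + 2 * Real.pi * χ x) * (κ * N) + 2 * Real.pi * ρ x ^ 2 := fun x => by
    have hpi := Real.pi_pos
    by_cases hx : R + 1 < ‖x‖
    · have h0 := hχ0 x hx
      have h0' : (∑ i, 1 / 2 * fderiv ℝ (fderiv ℝ χ) x (b i) (b i)) = 0 := abs_eq_zero.1 h0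
      rw [h0, h0', hsub x hx]
      have : 0 ≤ 2 * Real.pi * ρ x ^ 2 := by positivity
      simpa using this
    · have hWx : W x ^ 2 ≤ κ * N := by
        rw [hWρ x, neg_sq]
        exact hκ ρ hρ hρR x (not_lt.1 hx)
      have a1 : (∑ i, 1 / 2 * fderiv ℝ (fderiv ℝ χ) x (b i) (b i)) * W x ^ 2 ≤ D x * (κ * N) :=
        mul_le_mul (le_abs_self _) hWx (sq_nonneg _) (abs_nonneg _)
      have a2 : -(W x * ρ x) ≤ 1 / 2 * (κ * N) + 1 / 2 * ρ x ^ 2 := by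
        nlinarith [sq_nonneg (W x + ρ x)]
      have a3 : χ x * -(W x * ρ x) ≤ χ x * (1 / 2 * (κ * N)) + 1 / 2 * ρ x ^ 2 := by
        nlinarith [mul_le_mul_of_nonneg_left a2 (hχnn x), hχ1 x, sq_nonneg (ρ x),
          mul_nonneg (sub_nonneg.2 (hχ1 x)) (sq_nonneg (ρ x))]
      nlinarith [mul_le_mul_of_nonneg_left a3 hpi.le]
  have hi1 : Integrable fun x => (D x + 2 * Real.pi * χ x) * (κ * N) := iN.mul_const _
  have hi2 : Integrable fun x => 2 * Real.pi * ρ x ^ 2 := iρ.const_mul _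
  have hi3 : Integrable fun x => (∑ i, 1 / 2 * fderiv ℝ (fderiv ℝ χ) x (b i) (b i)) * W x ^ 2
        - 4 * Real.pi * (χ x * (W x * ρ x)) := by
    refine Integrable.sub ?_ (Integrable.const_mul ?_ _)
    · simp only [Finset.sum_mul]
      exact integrable_finsetSum _ fun i _ =>
        ((continuous_const.mul (cχee _)).mul (hW.continuous.pow 2)).integrable_of_hasCompactSupport
        ((hcee _).mul_left.mul_right)
    · exact (hχ.continuous.mul (hW.continuous.mul hρ)).integrable_of_hasCompactSupport hc.mul_right
  calc _ ≤ _ := s1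
    _ = _ := s2
    _ ≤ ∫ x, ((D x + 2 * Real.pi * χ x) * (κ * N) + 2 * Real.pi * ρ x ^ 2) :=
      integral_mono hi3 (hi1.add hi2) hpt
    _ = (N0 * κ + 2 * Real.pi) * N := by
      rw [integral_add hi1 hi2, integral_mul_const, integral_const_mul]
      ring

/-! ### Propagation of spherical symmetry -/

theorem Icc_subset_timeInterval {T : EReal} {t : ℝ} (ht : t ∈ timeInterval T) :
    Icc 0 t ⊆ timeInterval T := fun _ hs =>
  ⟨hs.1, lt_of_le_of_lt (EReal.coe_le_coe_iff.2 hs.2) ht.2⟩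

theorem continuous_gradient {W : E3 → ℝ} (hW : ContDiff ℝ 2 W) : Continuous (gradient W) :=
  (InnerProductSpace.toDual ℝ E3).symm.continuous.comp (hW.continuous_fderiv two_ne_zero)

variable {T : EReal} {f : ℝ → E3 × E3 → ℝ} {t : ℝ}

theorem IsClassicalSolution.slab (hf : IsClassicalSolution T f) (ht : t ∈ timeInterval T) :
    SlabC1 t f := ContDiffOn.mono hf.contDiffOn (prod_mono_left (Icc_subset_timeInterval ht))

theorem IsClassicalSolution.transported (hf : IsClassicalSolution T f) (ht : t ∈ timeInterval T)
    (h0 : 0 < t) : Transported t f (fun s => field (f s)) where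
  pos := h0
  slab := hf.slab ht
  continuous s hs := continuous_gradient (hf.contDiff_potential s (Icc_subset_timeInterval ht hs))
  eq_zero s hs := by
    rintro ⟨x, v⟩
    have hs' := Icc_subset_timeInterval ht (Ioo_subset_Icc_self hs)
    have h := hf.vlasov s hs' x v
    have hd := ((hf.slab ht).contDiff (Ioo_subset_Icc_self hs)).differentiable one_ne_zero
    rw [derivWithin_of_mem_nhds (mem_of_superset (Icc_mem_nhds hs.1 hs.2)
      (Icc_subset_timeInterval ht)), inner_gradient_right, inner_gradient_right,
      fderiv_prodMk_left hd, fderiv_prodMk_right hd] at h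
    have e : ((v, -field (f s) x) : E3 × E3) = (v, 0) - (0, field (f s) x) := by simp
    rw [matDeriv, e, map_sub]
    simp only [conj_trivial] at h
    linarith

theorem potential_comp_rotation (g : E3 × E3 → ℝ) (A : E3 ≃ₗᵢ[ℝ] E3) (x : E3) :
    ∫ y, density g (A y) / ‖x - y‖ = -potential g (A x) := by
  rw [potential, neg_neg, ← A.measurePreserving.integral_comp
    A.toHomeomorph.measurableEmbedding
    (fun y => density g y / ‖A x - y‖)]
  refine integral_congr_ae (Eventually.of_forall fun y => ?_)
  simp only
  rw [← map_sub, A.norm_map]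

theorem density_eq_zero_of_lt {g : E3 × E3 → ℝ} {R : ℝ} (hR : ∀ z, R < ‖z‖ → g z = 0) {x : E3}
    (hx : R < ‖x‖) : density g x = 0 :=
  integral_eq_zero_of_ae (Eventually.of_forall fun v =>
    hR (x, v) (hx.trans_le (norm_fst_le (x, v))))

/-- Cauchy–Schwarz in v over the ball of radius R that contains all velocities, followed by
integration in x. -/
theorem integral_density_sq_le {h : E3 × E3 → ℝ} (hc : Continuous h) {R : ℝ}
    (hR : ∀ z, R < ‖z‖ → h z = 0) (hd : Continuous (density h)) :
    ∫ x, density h x ^ 2 ≤ volume.real (Metric.closedBall (0 : E3) R) * ∫ z, h z ^ 2 := by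
  have i2 : Integrable (fun z => h z ^ 2) := integrable_of_eq_zero_of_lt (R := R) (by fun_prop)
    fun z hz => by rw [hR z hz]; norm_num
  have hpt : ∀ x, density h x ^ 2
      ≤ volume.real (Metric.closedBall (0 : E3) R) * ∫ v, h (x, v) ^ 2 := fun x => by
    have hv : ∀ v, R < ‖v‖ → h (x, v) = 0 := fun v hv =>
      hR _ (hv.trans_le (norm_snd_le (x, v)))
    have hcx : Continuous fun v => h (x, v) := by fun_prop
    have j1 : Integrable fun v => h (x, v) := integrable_of_eq_zero_of_lt hcx hv
    have j2 : Integrable fun v => h (x, v) ^ 2 := integrable_of_eq_zero_of_lt (R := R)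
      (by fun_prop) fun v hv' => by rw [hv v hv']; norm_num
    have e : density h x = ∫ v in Metric.closedBall (0 : E3) R, h (x, v) :=
      (setIntegral_eq_integral_of_forall_compl_eq_zero fun v hv' => hv v (by simpa using hv')).symm
    have hcs := sq_integral_mul_le (μ := volume.restrict (Metric.closedBall (0 : E3) R))
      (f := fun _ => 1) (g := fun v => h (x, v))
      (by
        simp only [one_pow]
        exact integrableOn_const (isCompact_closedBall (0 : E3) R).measure_lt_top.ne)
      j2.integrableOn (by simpa only [one_mul] using j1.integrableOn.integrable)
    simp only [one_mul, one_pow] at hcs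
    rw [← e] at hcs
    refine hcs.trans (mul_le_mul (by simp [measureReal_def]) ?_ (integral_nonneg fun _ => sq_nonneg _)
      measureReal_nonneg)
    exact setIntegral_le_integral j2 (Eventually.of_forall fun _ => sq_nonneg _)
  have i3 : Integrable fun x => ∫ v, h (x, v) ^ 2 := by
    rw [Measure.volume_eq_prod] at i2
    exact i2.integral_prod_left
  have i1 : Integrable fun x => density h x ^ 2 := integrable_of_eq_zero_of_lt (R := R)
    (by fun_prop) fun x hx => by rw [density_eq_zero_of_lt hR hx]; norm_num
  refine (integral_mono i1 (i3.const_mul _) hpt).trans (le_of_eq ?_)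
  rw [integral_const_mul, Measure.volume_eq_prod, integral_prod _ (by
    rw [Measure.volume_eq_prod] at i2; exact i2)]

/-- The right-hand side is the failure of the field to commute with A, the source term in the
transport equation for f − f∘A; the left-hand side makes it accessible to estimates for the
potential difference. -/
theorem gradient_sub_comp_isometry {U : E3 → ℝ} (hU : Differentiable ℝ U) (A : E3 ≃ₗᵢ[ℝ] E3)
    (x : E3) : A (gradient (fun y => U y - U (A y)) x) = A (gradient U x) - gradient U (A x) := by
  have h1 : fderiv ℝ (fun y => U y - U (A y)) x = _ := ((hU x).hasFDerivAt.sub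
    ((hU (A x)).hasFDerivAt.comp x (A : E3 →L[ℝ] E3).hasFDerivAt)).fderiv
  have h2 : gradient (fun y => U y - U (A y)) x = gradient U x - A.symm (gradient U (A x)) := by
    refine ext_inner_right ℝ fun w => ?_
    rw [inner_gradient_left, h1, inner_sub_left, inner_gradient_left]
    have : inner ℝ (A.symm (gradient U (A x))) w = inner ℝ (gradient U (A x)) (A w) := by
      rw [← A.inner_map_map, A.apply_symm_apply]
    rw [this, inner_gradient_left]
    simp
  rw [h2, map_sub, A.apply_symm_apply]

/-- U − U∘A is the Newtonian potential of ρ − ρ∘A, so the interior estimate applies to it. The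
asymmetry of the field is thereby controlled in L² by the asymmetry of f, which closes a Grönwall
argument. -/
theorem IsClassicalSolution.integral_gradient_sq_le (hf : IsClassicalSolution T f) {R : ℝ}
    (hR0 : 0 < R) : ∃ C : ℝ, 0 ≤ C ∧ ∀ s ∈ timeInterval T, Continuous (f s) →
      (∀ z, R < ‖z‖ → f s z = 0) → ∀ A : E3 ≃ₗᵢ[ℝ] E3,
      ∫ x in Metric.closedBall 0 R, ‖gradient (fun y => potential (f s) y
        - potential (f s) (A y)) x‖ ^ 2 ≤ C * ∫ z, (f s z - f s (A z.1, A z.2)) ^ 2 := by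
  obtain ⟨C, hC0, hC⟩ := exists_integral_gradient_sq_le hR0
  refine ⟨C * volume.real (Metric.closedBall (0 : E3) R), by positivity,
    fun s hs hc hR A => ?_⟩
  have hdc : Continuous (density (f s)) := by
    have := hf.contDiffOn_density.continuousOn.comp (s := univ) (f := fun x : E3 => (s, x))
      (by fun_prop) fun x _ => ⟨hs, mem_univ _⟩
    exact continuousOn_univ.1 this
  have hU := hf.contDiff_potential s hs
  have hUA : ContDiff ℝ 2 fun y => potential (f s) (A y) := hU.comp A.contDiff
  have hden : density (fun z => f s z - f s (A z.1, A z.2))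
      = fun x => density (f s) x - density (f s) (A x) := by
    ext x
    have e : ∫ v, f s (A x, A v) = density (f s) (A x) :=
      A.measurePreserving.integral_comp A.toHomeomorph.measurableEmbedding
        (fun v => f s (A x, v))
    have i : Integrable fun v => f s (A x, A v) :=
      A.measurePreserving.integrable_comp_of_integrable (hf.density_exists s hs (A x))
    rw [← e]
    exact integral_sub (hf.density_exists s hs x) i
  have hRA : ∀ z : E3 × E3, R < ‖z‖ → f s z - f s (A z.1, A z.2) = 0 := fun z hz => by
    rw [hR z hz, hR _ (by rw [Prod.norm_def] at hz ⊢; simpa using hz), sub_zero]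
  have h1 := hC (fun x => density (f s) x - density (f s) (A x))
    (fun y => potential (f s) y - potential (f s) (A y))
    (hdc.sub (hdc.comp A.continuous))
    (fun y hy => by
      rw [density_eq_zero_of_lt hR hy, density_eq_zero_of_lt hR (by rwa [A.norm_map]), sub_zero])
    (hU.sub hUA)
    (fun x => by
      simp only [sub_div]
      have i : Integrable fun y => density (f s) (A y) / ‖x - y‖ := by
        have := A.measurePreserving.integrable_comp_of_integrable (hf.potential_exists s hs (A x))
        refine this.congr (Eventually.of_forall fun y => ?_)
        simp only [Function.comp_apply]
        rw [← map_sub, A.norm_map]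
      rw [integral_sub (hf.potential_exists s hs x) i, potential_comp_rotation, potential]
      ring)
    (fun x => by
      have e : (fun y => potential (f s) y - potential (f s) (A y))
          = potential (f s) - fun y => potential (f s) (A y) := rfl
      rw [e, ContDiffAt.laplacian_sub hU.contDiffAt hUA.contDiffAt,
        laplacian_comp_isometry hU, hf.poisson s hs, hf.poisson s hs]
      ring)
  have h2 := integral_density_sq_le (h := fun z => f s z - f s (A z.1, A z.2)) (by fun_prop) hRA
    (by rw [hden]; exact hdc.sub (hdc.comp A.continuous))
  rw [hden] at h2
  refine h1.trans ?_
  rw [mul_assoc]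
  exact mul_le_mul_of_nonneg_left h2 hC0

/-- Symmetries of the initial datum are propagated. -/
theorem IsClassicalSolution.comp_isometry_eq (hf : IsClassicalSolution T f)
    (ht : t ∈ timeInterval T) (h0 : 0 < t) {R : ℝ} (hR0 : 0 < R)
    (hR : ∀ s ∈ Icc 0 t, ∀ z, R < ‖z‖ → f s z = 0) (A : E3 ≃ₗᵢ[ℝ] E3)
    (hA : ∀ z : E3 × E3, f 0 (A z.1, A z.2) = f 0 z) (z : E3 × E3) :
    f t (A z.1, A z.2) = f t z := by
  have htr := hf.transported ht h0
  have hsl := htr.slab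
  have hslA : SlabC1 t fun s (z : E3 × E3) => f s (A z.1, A z.2) := hsl.comp_right
    (k := fun z : E3 × E3 => (A z.1, A z.2)) (by fun_prop)
  have hh := hsl.sub hslA
  have hhh := hh.mul hh
  have hRh : ∀ s ∈ Icc 0 t, ∀ z : E3 × E3, R < ‖z‖ → f s z - f s (A z.1, A z.2) = 0 :=
    fun s hs z hz => by
      rw [hR s hs z hz, hR s hs _ (by rw [Prod.norm_def] at hz ⊢; simpa using hz), sub_zero]
  have hRhh : ∀ s ∈ Icc 0 t, ∀ z : E3 × E3, R < ‖z‖ →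
      (f s z - f s (A z.1, A z.2)) * (f s z - f s (A z.1, A z.2)) = 0 :=
    fun s hs z hz => by rw [hRh s hs z hz, mul_zero]
  obtain ⟨C₁, hC₁⟩ := ((isCompact_Icc (a := (0:ℝ)) (b := t)).prod
    (isCompact_closedBall (0 : E3 × E3) R)).exists_bound_of_continuousOn
    ((hsl.continuousOn_fderivWithin h0).mono (prod_mono_right (subset_univ _)))
  have hC₁0 : 0 ≤ C₁ := (norm_nonneg _).trans
    (hC₁ (0, 0) ⟨left_mem_Icc.2 h0.le, Metric.mem_closedBall_self hR0.le⟩)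
  obtain ⟨C₂, hC₂0, hC₂⟩ := hf.integral_gradient_sq_le hR0
  set V := volume.real (Metric.closedBall (0 : E3) R) with hV
  set W : ℝ → E3 → ℝ := fun s y => potential (f s) y - potential (f s) (A y) with hW
  -- the transport equation for the difference
  have hmat : ∀ s ∈ Ioo 0 t, ∀ z : E3 × E3,
      matDeriv (field (f s)) (fun r w => f r w - f r (A w.1, A w.2)) s z
        = fderiv ℝ (f s) (A z.1, A z.2) (0, A (gradient (W s) z.1)) := by
    intro s hs z
    have hs' := Ioo_subset_Icc_self hs
    have e1 := htr.eq_zero s hs (A z.1, A z.2)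
    have hd := (hsl.contDiff hs').differentiable one_ne_zero
    have hl : HasFDerivAt (fun w : E3 × E3 => (A w.1, A w.2))
        ((A : E3 →L[ℝ] E3).prodMap (A : E3 →L[ℝ] E3)) z :=
      ((A : E3 →L[ℝ] E3).prodMap (A : E3 →L[ℝ] E3)).hasFDerivAt
    have e2 : fderiv ℝ (fun w : E3 × E3 => f s (A w.1, A w.2)) z = _ :=
      ((hd (A z.1, A z.2)).hasFDerivAt.comp z hl).fderiv
    rw [hsl.matDeriv_sub hslA hs, htr.eq_zero s hs, zero_sub]
    have e3 : A (gradient (W s) z.1) = A (field (f s) z.1) - field (f s) (A z.1) :=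
      gradient_sub_comp_isometry ((hf.contDiff_potential s
        (Icc_subset_timeInterval ht hs')).differentiable two_ne_zero) A z.1
    have e4 : ((0, A (gradient (W s) z.1)) : E3 × E3)
        = (A z.2, -field (f s) (A z.1)) - (A z.2, -A (field (f s) z.1)) := by
      rw [e3]
      ext1
      · simp
      · simp only [Prod.snd_sub]; abel
    rw [e4, map_sub]
    have e5 : fderiv ℝ (fun w : E3 × E3 => f s (A w.1, A w.2)) z (z.2, -field (f s) z.1)
        = fderiv ℝ (f s) (A z.1, A z.2) (A z.2, -A (field (f s) z.1)) := by
      rw [e2, ← map_neg]; rfl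
    simp only [matDeriv] at e1 ⊢
    rw [e5]
    linarith
  -- With h = f − f∘A, the derivative of h² along the field is 2h times a velocity derivative of f,
  -- bounded by C₁, applied to the field asymmetry. The bound 2|h||∇W| ≤ h² + |∇W|² is integrated
  -- over the product of balls; the velocity ball contributes V, and C₂ returns ∫|∇W|² to ∫h².
  have hle : ∀ s ∈ Ioo 0 t,
      ∫ z, matDeriv (field (f s)) (fun r w => (f r w - f r (A w.1, A w.2))
        * (f r w - f r (A w.1, A w.2))) s z
      ≤ (C₁ + C₁ * C₂ * V) * ∫ z, (f s z - f s (A z.1, A z.2)) * (f s z - f s (A z.1, A z.2)) := by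
    intro s hs
    have hs' := Ioo_subset_Icc_self hs
    have hst := Icc_subset_timeInterval ht hs'
    set h : E3 × E3 → ℝ := fun z => f s z - f s (A z.1, A z.2) with hh_def
    have hc : Continuous (f s) := (hsl.contDiff hs').continuous
    have hcW : Continuous (gradient (W s)) := continuous_gradient
      ((hf.contDiff_potential s hst).sub ((hf.contDiff_potential s hst).comp A.contDiff))
    set B := Metric.closedBall (0 : E3) R with hB
    have hBm : MeasurableSet B := Metric.isClosed_closedBall.measurableSet
    have ig : Integrable (B.indicator fun x => ‖gradient (W s) x‖ ^ 2) :=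
      (integrable_indicator_iff hBm).2
        ((hcW.norm.pow 2).continuousOn.integrableOn_compact (isCompact_closedBall (0 : E3) R))
    have i1 : Integrable (B.indicator fun _ : E3 => (1 : ℝ)) := (integrable_indicator_iff hBm).2
      (integrableOn_const (isCompact_closedBall (0 : E3) R).measure_lt_top.ne)
    have ip : Integrable fun z : E3 × E3 => (B.indicator fun x => ‖gradient (W s) x‖ ^ 2) z.1
        * (B.indicator fun _ : E3 => (1 : ℝ)) z.2 := by
      rw [Measure.volume_eq_prod]; exact ig.mul_prod i1
    have ih : Integrable fun z => h z * h z := integrable_of_eq_zero_of_lt (R := R)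
      (by rw [hh_def]; fun_prop) (hRhh s hs')
    have hpt : ∀ z, matDeriv (field (f s)) (fun r w => (f r w - f r (A w.1, A w.2))
        * (f r w - f r (A w.1, A w.2))) s z ≤ C₁ * (h z * h z)
          + C₁ * ((B.indicator fun x => ‖gradient (W s) x‖ ^ 2) z.1
            * (B.indicator fun _ : E3 => (1 : ℝ)) z.2) := by
      intro z
      rw [hh.matDeriv_mul hh hs, hmat s hs]
      have hnn : ∀ a : E3, 0 ≤ (B.indicator fun x => ‖gradient (W s) x‖ ^ 2) a := fun a =>
        indicator_nonneg (fun _ _ => sq_nonneg _) a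
      have hnn' : ∀ a : E3, 0 ≤ (B.indicator fun _ : E3 => (1 : ℝ)) a := fun a =>
        indicator_nonneg (fun _ _ => zero_le_one) a
      by_cases hz : R < ‖z‖
      · have := hRh s hs' z hz
        rw [this]
        have h2 := mul_nonneg hC₁0 (mul_nonneg (hnn z.1) (hnn' z.2))
        have h3 := mul_nonneg hC₁0 (mul_self_nonneg (h z))
        simp only [zero_mul, mul_zero, add_zero]
        linarith
      · have hz1 : z.1 ∈ B := by
          rw [hB, mem_closedBall_zero_iff]; exact (norm_fst_le z).trans (not_lt.1 hz)
        have hz2 : z.2 ∈ B := by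
          rw [hB, mem_closedBall_zero_iff]; exact (norm_snd_le z).trans (not_lt.1 hz)
        rw [indicator_of_mem hz1, indicator_of_mem hz2, mul_one]
        have hq : |fderiv ℝ (f s) (A z.1, A z.2) (0, A (gradient (W s) z.1))|
            ≤ C₁ * ‖gradient (W s) z.1‖ := by
          rw [hsl.fderiv_eq hs, ← Real.norm_eq_abs]
          refine (ContinuousLinearMap.le_opNorm _ _).trans
            (mul_le_mul (hC₁ (s, (A z.1, A z.2)) ⟨hs', ?_⟩) ?_ (norm_nonneg _) hC₁0)
          · rw [mem_closedBall_zero_iff]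
            rw [Prod.norm_def] at hz ⊢
            simpa using hz
          · simp
        have hq2 := (le_abs_self _).trans ((abs_mul (f s z - f s (A z.1, A z.2))
          (fderiv ℝ (f s) (A z.1, A z.2) (0, A (gradient (W s) z.1)))).le.trans
            (mul_le_mul_of_nonneg_left hq (abs_nonneg _)))
        have h3 := mul_nonneg hC₁0 (sq_nonneg (|h z| - ‖gradient (W s) z.1‖))
        have h4 : |h z| ^ 2 = h z * h z := by rw [sq_abs, sq]
        have h5 : C₁ * (|h z| - ‖gradient (W s) z.1‖) ^ 2
          = C₁ * |h z| ^ 2 - 2 * (|h z| * (C₁ * ‖gradient (W s) z.1‖))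
            + C₁ * ‖gradient (W s) z.1‖ ^ 2 := by ring
        rw [h4] at h5
        change _ ≤ |h z| * _ at hq2
        linarith
    refine (integral_mono (hhh.hasDerivAt_integral_matDeriv hRhh hs (htr.continuous s hs')).1
      ((ih.const_mul C₁).add (ip.const_mul C₁)) hpt).trans ?_
    have e1 : ∫ z, (C₁ * (h z * h z) + C₁ * ((B.indicator fun x => ‖gradient (W s) x‖ ^ 2) z.1
            * (B.indicator fun _ : E3 => (1 : ℝ)) z.2))
        = C₁ * (∫ z, h z * h z) + C₁ * ((∫ x in B, ‖gradient (W s) x‖ ^ 2) * V) := by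
      rw [integral_add (ih.const_mul C₁) (ip.const_mul C₁), integral_const_mul, integral_const_mul,
        Measure.volume_eq_prod, integral_prod_mul, integral_indicator hBm, integral_indicator hBm]
      simp [hV, hB]
    refine e1.le.trans ?_
    have h6 := hC₂ s hst hc (hR s hs') A
    simp only [sq (f s _ - _)] at h6
    have hV0 : 0 ≤ V := measureReal_nonneg
    have h7 := mul_le_mul_of_nonneg_left (mul_le_mul_of_nonneg_right h6 hV0) hC₁0
    have h8 : C₁ * (C₂ * (∫ z, h z * h z) * V) = C₁ * C₂ * V * ∫ z, h z * h z := by ring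
    rw [add_mul]
    exact add_le_add le_rfl (h7.trans h8.le)
  have hy := nonpos_of_deriv_le_mul h0.le
    (hhh.continuousOn_integral (μ := (volume : Measure (E3 × E3))) hRhh)
    (fun s hs => (hhh.hasDerivAt_integral_matDeriv hRhh hs
      (htr.continuous s (Ioo_subset_Icc_self hs))).2) hle
    (by simp [hA])
  have ht' := right_mem_Icc.2 h0.le
  have hcont := (hhh.contDiff ht').continuous
  have hz := (integral_eq_zero_iff_of_nonneg (fun z => mul_self_nonneg _)
    (integrable_of_eq_zero_of_lt hcont (hRhh t ht'))).1
    (le_antisymm hy (integral_nonneg fun z => mul_self_nonneg _))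
  have h1 := congrFun ((hcont.ae_eq_iff_eq volume continuous_const).1 hz) z
  have h2 : f t z - f t (A z.1, A z.2) = 0 := mul_self_eq_zero.1 h1
  linarith

/-! ### Conservation of functions of f and L -/

/-- The distribution of the pair `(f, L)` under the measure `f dz`. -/
def jointLaw (f : E3 × E3 → ℝ) : Measure (ℝ × ℝ) :=
  (volume.withDensity fun z => ENNReal.ofReal (f z)).map fun z => (f z, angMom z.1 z.2)

theorem integral_jointLaw {f : E3 × E3 → ℝ} (hc : Continuous f) (h0 : ∀ z, 0 ≤ f z)
    {E : Type*} [NormedAddCommGroup E] [NormedSpace ℝ E] {φ : ℝ × ℝ → E}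
    (hφ : StronglyMeasurable φ) :
    ∫ p, φ p ∂(jointLaw f) = ∫ z, f z • φ (f z, angMom z.1 z.2) := by
  have hm : Measurable fun z : E3 × E3 => (f z, angMom z.1 z.2) :=
    hc.measurable.prodMk continuous_angMom.measurable
  rw [jointLaw, integral_map hm.aemeasurable hφ.aestronglyMeasurable,
    integral_withDensity_eq_integral_toReal_smul hc.measurable.ennreal_ofReal
      (Eventually.of_forall fun _ => ENNReal.ofReal_lt_top)]
  simp only [ENNReal.toReal_ofReal (h0 _)]

theorem isFiniteMeasure_jointLaw {f : E3 × E3 → ℝ} (hi : Integrable f) : IsFiniteMeasure (jointLaw f) := by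
  have := isFiniteMeasure_withDensity_ofReal hi.2
  unfold jointLaw
  infer_instance

/-- The characteristic function consists of integrals of f times smooth functions of a·f − b·L,
which can be differentiated along the flow. The sign convention a·f − b·L is the one of the
conservation law, whence the double negation. -/
theorem charFunDual_jointLaw {f : E3 × E3 → ℝ} (hc : Continuous f) (h0 : ∀ z, 0 ≤ f z)
    (hi : Integrable f) (l : StrongDual ℝ (ℝ × ℝ)) :
    charFunDual (jointLaw f) l
      = ((∫ z, f z * Real.cos (l (1, 0) * f z - -l (0, 1) * angMom z.1 z.2) : ℝ) : ℂ)
        + ((∫ z, f z * Real.sin (l (1, 0) * f z - -l (0, 1) * angMom z.1 z.2) : ℝ) : ℂ)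
          * Complex.I := by
  have hL := continuous_angMom
  have hcont : Continuous fun z : E3 × E3 => l (1, 0) * f z - -l (0, 1) * angMom z.1 z.2 :=
    (continuous_const.mul hc).sub (continuous_const.mul hL)
  have i1 : Integrable fun z => f z * Real.cos (l (1, 0) * f z - -l (0, 1) * angMom z.1 z.2) :=
    hi.mul_bdd (c := 1) (Real.continuous_cos.comp hcont).aestronglyMeasurable
      (Eventually.of_forall fun z => Real.abs_cos_le_one _)
  have i2 : Integrable fun z => f z * Real.sin (l (1, 0) * f z - -l (0, 1) * angMom z.1 z.2) :=
    hi.mul_bdd (c := 1) (Real.continuous_sin.comp hcont).aestronglyMeasurable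
      (Eventually.of_forall fun z => Real.abs_sin_le_one _)
  rw [charFunDual_apply, integral_jointLaw hc h0 (by
    have : Continuous fun p : ℝ × ℝ => Complex.exp (l p * Complex.I) := by fun_prop
    exact this.stronglyMeasurable), ← integral_complex_ofReal, ← integral_complex_ofReal,
    ← integral_mul_const, ← integral_add i1.ofReal (i2.ofReal.mul_const _)]
  refine integral_congr_ae (Eventually.of_forall fun z => ?_)
  have e : l (f z, angMom z.1 z.2) = l (1, 0) * f z - -l (0, 1) * angMom z.1 z.2 := by
    have : ((f z, angMom z.1 z.2) : ℝ × ℝ)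
        = f z • ((1, 0) : ℝ × ℝ) + angMom z.1 z.2 • ((0, 1) : ℝ × ℝ) := by simp
    rw [this, map_add, map_smul, map_smul]
    simp only [smul_eq_mul]
    ring
  simp only
  rw [e, Complex.exp_mul_I, Complex.real_smul]
  push_cast
  ring

/-- A finite measure is determined by its characteristic function, so equality for sines and cosines
extends to every measurable φ. Weighting by f keeps the law finite. -/
theorem integral_mul_comp_eq {f g : E3 × E3 → ℝ} (hf : Continuous f) (hf0 : ∀ z, 0 ≤ f z)
    (hfi : Integrable f) (hg : Continuous g) (hg0 : ∀ z, 0 ≤ g z) (hgi : Integrable g)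
    (hcos : ∀ a b : ℝ, ∫ z, f z * Real.cos (a * f z - b * angMom z.1 z.2)
      = ∫ z, g z * Real.cos (a * g z - b * angMom z.1 z.2))
    (hsin : ∀ a b : ℝ, ∫ z, f z * Real.sin (a * f z - b * angMom z.1 z.2)
      = ∫ z, g z * Real.sin (a * g z - b * angMom z.1 z.2)) {φ : ℝ × ℝ → ℝ} (hφ : Measurable φ) :
    ∫ z, f z * φ (f z, angMom z.1 z.2) = ∫ z, g z * φ (g z, angMom z.1 z.2) := by
  have := isFiniteMeasure_jointLaw hfi
  have := isFiniteMeasure_jointLaw hgi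
  have h : jointLaw f = jointLaw g := by
    refine Measure.ext_of_charFunDual (funext fun l => ?_)
    rw [charFunDual_jointLaw hf hf0 hfi, charFunDual_jointLaw hg hg0 hgi, hcos, hsin]
  have h1 := integral_jointLaw hf hf0 hφ.stronglyMeasurable
  have h2 := integral_jointLaw hg hg0 hφ.stronglyMeasurable
  simp only [smul_eq_mul] at h1 h2
  rw [← h1, ← h2, h]

variable {Q : ℝ → ℝ → ℝ} {μ₁ μ₂ μ₃ C₁ C₂ C₃ C₄ F₀ M : ℝ}

/-- Q is only continuous in L, so Q(f, L) cannot be differentiated along the flow directly. Because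
Q(0, L) = 0, dividing by f brings the Casimir integral into the form handled by the joint law, for
which measurability is enough. -/
theorem CasimirAssumptions.integral_eq_integral_mul
    (hQ : CasimirAssumptions Q μ₁ μ₂ μ₃ C₁ C₂ C₃ C₄ F₀) {f : E3 × E3 → ℝ} (h0 : ∀ z, 0 ≤ f z) :
    ∫ z : E3 × E3, Q (f z) (angMom z.1 z.2)
      = ∫ z, f z * (fun p : ℝ × ℝ => Q (max p.1 0) (max p.2 0) / p.1) (f z, angMom z.1 z.2) := by
  refine integral_congr_ae (Eventually.of_forall fun z => ?_)
  simp only [max_eq_left (h0 z), max_eq_left (angMom_nonneg z.1 z.2)]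
  rcases (h0 z).eq_or_lt with h | h
  · rw [← h, hQ.zero (angMom_nonneg _ _), zero_mul]
  · field_simp

/-- Angular momentum is conserved by a central force. At x = 0 the differential vanishes in this
direction whatever the force, so the direction of the field there is irrelevant. -/
theorem fderiv_angMom_eq_zero {x v F : E3} {k : ℝ} (hF : x ≠ 0 → F = k • x) :
    fderiv ℝ (fun z : E3 × E3 => angMom z.1 z.2) (x, v) (v, -F) = 0 := by
  have hx : HasFDerivAt (fun z : E3 × E3 => z.1) (ContinuousLinearMap.fst ℝ E3 E3) (x, v) :=
    hasFDerivAt_fst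
  have hv : HasFDerivAt (fun z : E3 × E3 => z.2) (ContinuousLinearMap.snd ℝ E3 E3) (x, v) :=
    hasFDerivAt_snd
  have h : fderiv ℝ (fun z : E3 × E3 => angMom z.1 z.2) (x, v) = _ :=
    ((hx.norm_sq.mul hv.norm_sq).sub ((hx.inner ℝ hv).pow 2)).fderiv
  rw [h]
  by_cases hx0 : x = 0
  · subst hx0
    simp
  · rw [hF hx0]
    simp [inner_neg_right, inner_smul_right, real_inner_comm x v]
    ring

variable {τ R : ℝ} {f : ℝ → E3 × E3 → ℝ} {Φ : ℝ → E3 → E3}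

theorem Transported.integral_eq (h : Transported τ f Φ) {G : ℝ → E3 × E3 → ℝ} (hG : SlabC1 τ G)
    (hR : ∀ s ∈ Icc 0 τ, ∀ z, R < ‖z‖ → G s z = 0)
    (hz : ∀ s ∈ Ioo 0 τ, ∀ z, matDeriv (Φ s) G s z = 0) : ∫ z, G τ z = ∫ z, G 0 z :=
  eq_of_deriv_eq_zero h.pos.le (hG.continuousOn_integral hR) fun s hs =>
    (hG.hasDerivAt_integral_matDeriv hR hs (h.continuous s (Ioo_subset_Icc_self hs))).2.congr_deriv
      (integral_eq_zero_of_ae (Eventually.of_forall (hz s hs)))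

theorem contDiff_angMom : ContDiff ℝ 1 (fun z : E3 × E3 => angMom z.1 z.2) := by
  unfold angMom
  exact ((contDiff_fst.norm_sq ℝ).mul (contDiff_snd.norm_sq ℝ)).sub
    ((contDiff_fst.inner ℝ contDiff_snd).pow 2)

/-- In a central force field all functions of `f` and the angular momentum are conserved. -/
theorem Transported.integral_mul_comp_eq (h : Transported τ f Φ)
    (hR : ∀ s ∈ Icc 0 τ, ∀ z, R < ‖z‖ → f s z = 0)
    (hΦ : ∀ s ∈ Ioo 0 τ, ∀ x, x ≠ 0 → ∃ k : ℝ, Φ s x = k • x)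
    (h0 : ∀ s ∈ Icc 0 τ, ∀ z, 0 ≤ f s z) {φ : ℝ × ℝ → ℝ} (hφ : Measurable φ) :
    ∫ z, f τ z * φ (f τ z, angMom z.1 z.2) = ∫ z, f 0 z * φ (f 0 z, angMom z.1 z.2) := by
  -- Both f and L are annihilated by the derivative along the field, hence so is every C¹ function
  -- of them; only c = cos and c = sin are needed.
  have key : ∀ (c : ℝ → ℝ), ContDiff ℝ 1 c → ∀ a b : ℝ,
      ∫ z, f τ z * c (a * f τ z - b * angMom z.1 z.2)
        = ∫ z, f 0 z * c (a * f 0 z - b * angMom z.1 z.2) := by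
    intro c hcd a b
    have s1 : SlabC1 τ fun s z => a * f s z := h.slab.comp_left (b := fun y => a * y) (by fun_prop)
    have s2 : SlabC1 τ fun (_ : ℝ) (z : E3 × E3) => b * angMom z.1 z.2 :=
      SlabC1.const (contDiff_const.mul contDiff_angMom)
    have s3 := s1.sub s2
    have s4 := s3.comp_left hcd
    refine h.integral_eq (h.slab.mul s4) (fun s hs z hz => by rw [hR s hs z hz, zero_mul])
      fun s hs z => ?_
    rw [h.slab.matDeriv_mul s4 hs, h.eq_zero s hs, s3.matDeriv_comp hcd hs, s1.matDeriv_sub s2 hs,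
      h.slab.matDeriv_comp (b := fun y => a * y) (by fun_prop) hs, h.eq_zero s hs, matDeriv_const]
    have e : fderiv ℝ (fun z : E3 × E3 => b * angMom z.1 z.2) z (z.2, -Φ s z.1) = 0 := by
      rw [fderiv_const_mul (contDiff_angMom.differentiable one_ne_zero z)]
      have : fderiv ℝ (fun z : E3 × E3 => angMom z.1 z.2) z (z.2, -Φ s z.1) = 0 := by
        by_cases hz : z.1 = 0
        · exact fderiv_angMom_eq_zero (x := z.1) (v := z.2) (k := 0) fun h => absurd hz h
        · obtain ⟨k, hk⟩ := hΦ s hs z.1 hz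
          exact fderiv_angMom_eq_zero (x := z.1) (v := z.2) (k := k) fun _ => hk
      simp [this]
    rw [e]
    ring
  have hl := left_mem_Icc.2 h.pos.le
  have hr := right_mem_Icc.2 h.pos.le
  have hc : ∀ s ∈ Icc 0 τ, Continuous (f s) := fun s hs => (h.slab.contDiff hs).continuous
  exact VlasovPoisson.integral_mul_comp_eq (hc τ hr) (h0 τ hr)
    (integrable_of_eq_zero_of_lt (hc τ hr) (hR τ hr)) (hc 0 hl) (h0 0 hl)
    (integrable_of_eq_zero_of_lt (hc 0 hl) (hR 0 hl))
    (key Real.cos Real.contDiff_cos) (key Real.sin Real.contDiff_sin) hφ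

/-! ### Conservation of symmetry, mass, Casimir integral and energy along solutions -/

variable {Q : ℝ → ℝ → ℝ} {μ₁ μ₂ μ₃ C₁ C₂ C₃ C₄ F₀ M : ℝ} {T : EReal}
  {f : ℝ → E3 × E3 → ℝ} {t R : ℝ}

/-- Continuity of the initial datum upgrades its symmetry from almost every point to every point,
after which the Grönwall argument applies for each rotation. -/
theorem IsClassicalSolution.sphericallySymmetric (hf : IsClassicalSolution T f)
    (ht : t ∈ timeInterval T) (h0 : 0 < t) (hR0 : 0 < R)
    (hR : ∀ s ∈ Icc 0 t, ∀ z, R < ‖z‖ → f s z = 0) (hs : SphericallySymmetric (f 0)) :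
    ∀ s ∈ Icc 0 t, SphericallySymmetric (f s) := by
  intro s hst A hA
  have hc : Continuous (f 0) :=
    ((hf.slab ht).contDiff (left_mem_Icc.2 h0.le)).continuous
  have h := (((hc.comp (by fun_prop : Continuous fun z : E3 × E3 => (A z.1, A z.2))).ae_eq_iff_eq
    volume hc).1 (hs A hA))
  refine Eventually.of_forall fun z => ?_
  rcases hst.1.eq_or_lt with rfl | hs0
  · exact congrFun h z
  · exact hf.comp_isometry_eq (Icc_subset_timeInterval ht hst) hs0 hR0
      (fun r hr => hR r ⟨hr.1, hr.2.trans hst.2⟩) A (fun z => congrFun h z) z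

theorem IsClassicalSolution.isRadial (hf : IsClassicalSolution T f)
    (ht : t ∈ timeInterval T) (h0 : 0 < t) (hR0 : 0 < R)
    (hR : ∀ s ∈ Icc 0 t, ∀ z, R < ‖z‖ → f s z = 0) (hs : SphericallySymmetric (f 0)) :
    ∀ s ∈ Icc 0 t, IsRadial (f s) := fun s hst =>
  ⟨integrable_of_eq_zero_of_lt ((hf.slab ht).contDiff hst).continuous (hR s hst),
    Eventually.of_forall (hf.nonneg s (Icc_subset_timeInterval ht hst)),
    hf.sphericallySymmetric ht h0 hR0 hR hs s hst⟩

theorem IsClassicalSolution.integral_mul_comp_eq (hf : IsClassicalSolution T f)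
    (ht : t ∈ timeInterval T) (h0 : 0 < t) (hR0 : 0 < R)
    (hR : ∀ s ∈ Icc 0 t, ∀ z, R < ‖z‖ → f s z = 0) (hs : SphericallySymmetric (f 0))
    {φ : ℝ × ℝ → ℝ} (hφ : Measurable φ) :
    ∫ z, f t z * φ (f t z, angMom z.1 z.2) = ∫ z, f 0 z * φ (f 0 z, angMom z.1 z.2) :=
  (hf.transported ht h0).integral_mul_comp_eq hR (fun s hst _ hx =>
    ⟨_, (hf.isRadial ht h0 hR0 hR hs s (Ioo_subset_Icc_self hst)).field_eq hx⟩)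
    (fun s hst => hf.nonneg s (Icc_subset_timeInterval ht hst)) hφ

theorem IsClassicalSolution.integral_casimir_eq (hf : IsClassicalSolution T f)
    (hQ : CasimirAssumptions Q μ₁ μ₂ μ₃ C₁ C₂ C₃ C₄ F₀)
    (ht : t ∈ timeInterval T) (h0 : 0 < t) (hR0 : 0 < R)
    (hR : ∀ s ∈ Icc 0 t, ∀ z, R < ‖z‖ → f s z = 0) (hs : SphericallySymmetric (f 0)) :
    ∫ z : E3 × E3, Q (f t z) (angMom z.1 z.2) = ∫ z : E3 × E3, Q (f 0 z) (angMom z.1 z.2) := by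
  rw [hQ.integral_eq_integral_mul (hf.nonneg t ht), hQ.integral_eq_integral_mul
    (hf.nonneg 0 (Icc_subset_timeInterval ht (left_mem_Icc.2 h0.le)))]
  exact hf.integral_mul_comp_eq ht h0 hR0 hR hs
    (hQ.continuous_max.measurable.div measurable_fst)

theorem IsClassicalSolution.admissible (hf : IsClassicalSolution T f)
    (hQ : CasimirAssumptions Q μ₁ μ₂ μ₃ C₁ C₂ C₃ C₄ F₀)
    (ht : t ∈ timeInterval T) (h0 : 0 < t) (hR0 : 0 < R)
    (hR : ∀ s ∈ Icc 0 t, ∀ z, R < ‖z‖ → f s z = 0) (hA : Admissible Q M (f 0)) :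
    ∀ s ∈ Icc 0 t, Admissible Q M (f s) := by
  intro s hst
  rcases hst.1.eq_or_lt with rfl | hs0
  · exact hA
  have hs' := Icc_subset_timeInterval ht hst
  have hRs : ∀ r ∈ Icc 0 s, ∀ z, R < ‖z‖ → f r z = 0 := fun r hr =>
    hR r ⟨hr.1, hr.2.trans hst.2⟩
  have hrad := hf.isRadial ht h0 hR0 hR hA.symmetric s hst
  have hc : Continuous (f s) := ((hf.slab ht).contDiff hst).continuous
  refine ⟨hrad.integrable, hrad.nonneg, ?_, ?_, ?_, hrad.symmetric⟩
  · have := hf.integral_mul_comp_eq hs' hs0 hR0 hRs hA.symmetric (φ := fun _ => 1) measurable_const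
    simpa only [mul_one, hA.mass] using this
  · have e : (fun z : E3 × E3 => Q (f s z) (angMom z.1 z.2))
        = fun z => Q (max (f s z) 0) (max (angMom z.1 z.2) 0) := by
      ext z
      rw [max_eq_left (hf.nonneg s hs' z), max_eq_left (angMom_nonneg _ _)]
    have hcQ : Continuous fun z : E3 × E3 => Q (f s z) (angMom z.1 z.2) := by
      rw [e]
      exact hQ.continuous_max.comp (hc.prodMk continuous_angMom)
    exact integrable_of_eq_zero_of_lt hcQ (R := R) fun z hz => by
      rw [hR s hst z hz, hQ.zero (angMom_nonneg _ _)]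
  · exact integrable_of_eq_zero_of_lt (R := R) (by fun_prop) fun z hz => by
      rw [hR s hst z hz, mul_zero]

theorem potEnergy_comm (g h : E3 × E3 → ℝ) : potEnergy g h = potEnergy h g := by
  simp only [potEnergy, mul_comm (massIn g _)]

/-- Conservation of energy. -/
theorem IsClassicalSolution.energy_eq (hf : IsClassicalSolution T f)
    (hQ : CasimirAssumptions Q μ₁ μ₂ μ₃ C₁ C₂ C₃ C₄ F₀)
    (ht : t ∈ timeInterval T) (h0 : 0 < t) (hR0 : 0 < R)
    (hR : ∀ s ∈ Icc 0 t, ∀ z, R < ‖z‖ → f s z = 0) (hA : Admissible Q M (f 0)) :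
    (∫ z : E3 × E3, ‖z.2‖ ^ 2 * f t z) - potEnergy (f t) (f t)
      = (∫ z : E3 × E3, ‖z.2‖ ^ 2 * f 0 z) - potEnergy (f 0) (f 0) := by
  have htr := hf.transported ht h0
  have hadm := hf.admissible hQ ht h0 hR0 hR hA
  have hpot : ∀ r ∈ Icc 0 t, ∀ s ∈ Icc 0 t,
      ∫ z, potential (f r) z.1 * f s z = -potEnergy (f r) (f s) := fun r hr s hs =>
    ((hadm r hr).isRadial.integral_potential_mul (hadm s hs).isRadial
      (hQ.integrableOn_massIn_mul (hadm r hr) (hadm s hs))).2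
  have sU : SlabC1 t fun s (z : E3 × E3) => potential (f s) z.1 := by
    have : SlabC1 t fun s x => potential (f s) x :=
      ContDiffOn.mono hf.contDiffOn_potential (prod_mono_left (Icc_subset_timeInterval ht))
    exact this.comp_right (k := Prod.fst) contDiff_fst
  have sv : SlabC1 t fun (_ : ℝ) (z : E3 × E3) => ‖z.2‖ ^ 2 :=
    SlabC1.const (contDiff_snd.norm_sq ℝ)
  have sE := (sv.mul htr.slab)
  have sP := sU.mul htr.slab
  have hRE : ∀ s ∈ Icc 0 t, ∀ z : E3 × E3, R < ‖z‖ → ‖z.2‖ ^ 2 * f s z = 0 :=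
    fun s hs z hz => by rw [hR s hs z hz, mul_zero]
  have hRP : ∀ s ∈ Icc 0 t, ∀ z : E3 × E3, R < ‖z‖ → potential (f s) z.1 * f s z = 0 :=
    fun s hs z hz => by rw [hR s hs z hz, mul_zero]
  -- By Newton's formula the second integral is −`potEnergy (f s) (f s)`, so this sum is twice the
  -- total energy.
  have hy := eq_of_deriv_eq_zero (y := fun s => (∫ z : E3 × E3, ‖z.2‖ ^ 2 * f s z)
      + ∫ z : E3 × E3, potential (f s) z.1 * f s z) h0.le
    ((sE.continuousOn_integral hRE).add (sP.continuousOn_integral hRP)) (by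
      intro s hs
      have hs' := Ioo_subset_Icc_self hs
      have hst := Icc_subset_timeInterval ht hs'
      have hF := htr.continuous s hs'
      have hUd := (hf.contDiff_potential s hst).differentiable two_ne_zero
      have d1 := (sE.hasDerivAt_integral_matDeriv hRE hs hF).2
      have d2 := sP.hasDerivAt_integral_matDeriv hRP hs hF
      -- freeze the potential or the density
      have sB : SlabC1 t fun r (z : E3 × E3) => potential (f r) z.1 * f s z :=
        sU.mul (SlabC1.const (htr.slab.contDiff hs'))
      have hRB : ∀ r ∈ Icc 0 t, ∀ z : E3 × E3, R < ‖z‖ → potential (f r) z.1 * f s z = 0 :=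
        fun r _ z hz => by rw [hR s hs' z hz, mul_zero]
      have sU' : SlabC1 t fun (_ : ℝ) (z : E3 × E3) => potential (f s) z.1 :=
        SlabC1.const (((hf.contDiff_potential s hst).of_le (by norm_num)).comp contDiff_fst)
      have sD := sU'.mul htr.slab
      have hRD : ∀ r ∈ Icc 0 t, ∀ z : E3 × E3, R < ‖z‖ → potential (f s) z.1 * f r z = 0 :=
        fun r hr z hz => by rw [hR r hr z hz, mul_zero]
      have d3 := sB.hasDerivAt_integral (μ := (volume : Measure (E3 × E3))) hRB hs
      have d4 := sD.hasDerivAt_integral_matDeriv hRD hs hF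
      -- Mutual potential energy is symmetric: moving the potential against a frozen density gives
      -- the same function of time as moving the density against a frozen potential. This avoids any
      -- equation for the time derivative of the potential.
      have hBD : (fun r => ∫ z, potential (f r) z.1 * f s z)
          =ᶠ[𝓝 s] fun r => ∫ z, potential (f s) z.1 * f r z := by
        filter_upwards [Icc_mem_nhds hs.1 hs.2] with r hr
        rw [hpot r hr s hs', hpot s hs' r hr, potEnergy_comm]
      have hX := (d3.2.congr_of_eventuallyEq hBD.symm).unique d4.2
      have eU : ∀ z : E3 × E3, fderiv ℝ (fun w : E3 × E3 => potential (f s) w.1) z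
          (z.2, -field (f s) z.1) = inner ℝ (field (f s) z.1) z.2 := fun z => by
        have : fderiv ℝ (fun w : E3 × E3 => potential (f s) w.1) z = _ :=
          ((hUd z.1).hasFDerivAt.comp z hasFDerivAt_fst).fderiv
        rw [this, field, inner_gradient_left]
        rfl
      -- The kinetic energy integrand changes at −2 times the rate of the integrand with frozen
      -- potential. With X the integrated rate of either frozen variant, the total derivative is −2X
      -- + X + X = 0.
      have eE : ∀ z, matDeriv (field (f s)) (fun r z => ‖z.2‖ ^ 2 * f r z) s z
          = -2 * matDeriv (field (f s)) (fun r z => potential (f s) z.1 * f r z) s z := fun z => by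
        rw [sv.matDeriv_mul htr.slab hs, sU'.matDeriv_mul htr.slab hs, htr.eq_zero s hs,
          matDeriv_const, matDeriv_const, eU]
        have : fderiv ℝ (fun w : E3 × E3 => ‖w.2‖ ^ 2) z = _ :=
          ((hasFDerivAt_snd (𝕜 := ℝ) (p := z)).norm_sq).fderiv
        rw [this]
        simp [inner_neg_right, real_inner_comm z.2]
        ring
      have eP : ∀ z, matDeriv (field (f s)) (fun r z => potential (f r) z.1 * f r z) s z
          = deriv (fun r => potential (f r) z.1 * f s z) s
            + matDeriv (field (f s)) (fun r z => potential (f s) z.1 * f r z) s z := fun z => by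
        rw [sU.matDeriv_mul htr.slab hs, sU'.matDeriv_mul htr.slab hs, htr.eq_zero s hs,
          matDeriv_const, deriv_mul_const (sU.hasDerivAt hs z).differentiableAt]
        simp only [matDeriv]
        ring
      refine (d1.add d2.2).congr_deriv ?_
      simp only [eE, eP]
      rw [integral_const_mul, integral_add d3.1 d4.1, hX]
      ring)
  rw [hpot t (right_mem_Icc.2 h0.le) t (right_mem_Icc.2 h0.le),
    hpot 0 (left_mem_Icc.2 h0.le) 0 (left_mem_Icc.2 h0.le)] at hy
  linarith

/-- Classical solutions stay in the constraint set and preserve the energy-Casimir functional. -/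
theorem IsClassicalSolution.conservation (hf : IsClassicalSolution T f)
    (hQ : CasimirAssumptions Q μ₁ μ₂ μ₃ C₁ C₂ C₃ C₄ F₀) (hc : HasCompactSupport (f 0))
    (hA : Admissible Q M (f 0)) (ht : t ∈ timeInterval T) :
    Admissible Q M (f t) ∧ energyCasimir Q (f t) = energyCasimir Q (f 0) := by
  rcases ht.1.eq_or_lt with rfl | h0
  · exact ⟨hA, rfl⟩
  obtain ⟨K, hK⟩ := hf.field_bounded t ht
  obtain ⟨R, hR0, hR⟩ := (hf.transported ht h0).exists_support hK hc
  have hAt := hf.admissible hQ ht h0 hR0 hR hA t (right_mem_Icc.2 h0.le)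
  refine ⟨hAt, ?_⟩
  rw [hAt.isRadial.energyCasimir_eq, hA.isRadial.energyCasimir_eq, casimirKinetic, casimirKinetic,
    hf.integral_casimir_eq hQ ht h0 hR0 hR hA.symmetric]
  linarith [hf.energy_eq hQ ht h0 hR0 hR hA]

end VlasovPoisson

end

/-! ### The stability theorem -/

theorem mainTheorem7 (Q : ℝ → ℝ → ℝ) (μ₁ μ₂ μ₃ C₁ C₂ C₃ C₄ F₀ : ℝ)
    (hQ : VlasovPoisson.CasimirAssumptions Q μ₁ μ₂ μ₃ C₁ C₂ C₃ C₄ F₀)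
    (M : ℝ) (hM : 0 < M) :
    ∀ ε : ℝ, 0 < ε → ∃ δ : ℝ, 0 < δ ∧
      ∀ (T : EReal) (f : ℝ → VlasovPoisson.E3 × VlasovPoisson.E3 → ℝ),
        VlasovPoisson.IsClassicalSolution T f →
        ContDiff ℝ 1 (f 0) → HasCompactSupport (f 0) →
        VlasovPoisson.Admissible Q M (f 0) →
        VlasovPoisson.distToMinimizers Q M (f 0) < (δ : EReal) →
        ∀ t ∈ VlasovPoisson.timeInterval T,
          VlasovPoisson.distToMinimizers Q M (f t) < (ε : EReal) := by
  intro ε hε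
  obtain ⟨δ, hδ, h⟩ := hQ.exists_delta hM hε
  refine ⟨δ, hδ, fun T f hf _ hK hA hd t ht => ?_⟩
  obtain ⟨hAt, hE⟩ := hf.conservation hQ hK hA ht
  exact h _ _ hA hAt hE hd
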